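/- Let $\Psi$ be a pillowcase cover, i.e. a compact half-translation surface (flat, possibly with piecewise geodesic boundary and with conical points) with a fixed tiling by finitely many unit Euclidean squares: it is obtained from finitely many unit squares by gluing some of their sides in pairs through maps $z\mapsto\pm z+\mathrm{const}$, and the sides that are not glued form $\partial\Psi$. Let $\overline\Psi$ be the compact surface, conical points included, and let $(F,h^F,\nabla^F)$ be a flat unitary vector bundle of finite rank on $\overline\Psi$. For $n\ge 1$ subdivide each tile into $n^2$ equal squares. Let $\Psi_n$ be the nearest-neighbour (multi)graph whose vertices are the centres of these small squares, with one edge for each common side of small squares, and let $F_n$ be the restriction of $F$ to the vertices, with the parallel transport of $\nabla^F$ along the straight paths that represent the edges. The discrete Laplacian acts on $f\in \mathrm{Map}(V(\Psi_n),F_n)$ by $$(\Delta_{\Psi_n}^{F_n}f)(v)=\sum_{(v,v')\in E(\Psi_n)}\bigl(f(v)-\phi_{v'v}f(v')\bigr),$$ where $\phi_{v'v}$ is the parallel transport from $v'$ to $v$. An open set $U\subset\overline\Psi$ is called tiled if it is a union of open tiles, open sides of tiles and corners of tiles; then $U_n$ denotes the graph formed by the vertices of $\Psi_n$ in $U$ and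 the edges of $\Psi_n$ that stay in $U$, and $\Delta_{U_n}^{F_n}$ its Laplacian. For $s\in\mathbb C$, $(n^2\Delta^{\perp})^{-s}$ denotes the $(-s)$-th power of the non-negative self-adjoint operator $n^2\Delta$ on the span of its eigenvectors with non-zero eigenvalues, extended by zero on the kernel. Let $(U_\alpha)_{\alpha\in I}$ be a finite covering of $\overline\Psi$ by tiled open sets, $(\phi_\alpha)_{\alpha\in I}$ a continuous partition of unity on $\overline\Psi$ with $\mathrm{supp}(\phi_\alpha)\subset U_\alpha$, and $(\psi_\alpha)_{\alpha\in I}$ continuous real functions on $\overline\Psi$ such that $\mathrm{supp}(\psi_\alpha)\subset U_\alpha$ and $\psi_\alpha=1$ on an open set $V_\alpha\supset\mathrm{supp}(\phi_\alpha)$. Define the renormalized discrete zeta function $$\zeta^{F_n,\mathrm{ren}}_{\Psi_n}(s)=\mathrm{Tr}\Bigl[(n^2\Delta_{\Psi_n}^{F_n,\perp})^{-s}-\sum_{\alpha\in I}\phi_\alpha\,(n^2\Delta_{U_{\alpha,n}}^{F_n,\perp})^{-s}\,\psi_\alpha\Bigr],\qquad s\in\mathbb C,$$ where $\phi_\alpha$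 and $\psi_\alpha$ act by pointwise multiplication and operators on sections over $V(U_{\alpha,n})$ act on $\mathrm{Map}(V(\Psi_n),F_n)$ by restriction and extension by zero. Then for every compact $K\subset\mathbb C$ there is $C>0$ such that for all $s\in K$ and all integers $n\ge 1$, $$\bigl|\zeta^{F_n,\mathrm{ren}}_{\Psi_n}(s)\bigr|\le C .$$ -/

import Mathlib

open scoped unitInterval

noncomputable section

/-- A pillowcase cover (compact half-translation surface, possibly with boundary and conical
points, with a fixed tiling by unit squares), given by its gluing pattern. `T` is the set of
tiles; each tile is a copy of the oriented unit square `[0,1]²`, and `(t, k)` is its side number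
`k` (`0` bottom, `1` right, `2` top, `3` left). A side fixed by `glue` lies on the boundary of the
surface; any other side `d` is glued to `glue d`. Sides are glued with reversal of their
counterclockwise orientation (so the surface is oriented), and horizontal sides are glued to
horizontal ones, vertical to vertical ones: the transition maps are `z ↦ ± z + const`. -/
structure PillowcaseCover (T : Type*) where
  /-- the side to which a side is glued, or itself for a side on the boundary -/
  glue : T × Fin 4 → T × Fin 4
  glue_glue : ∀ d, glue (glue d) = d
  half_translation : ∀ d, (glue d).2 = d.2 ∨ (glue d).2 = d.2 + 2

/-- The sides of the unit square, parametrised counterclockwise by `[0,1]`. -/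
def squareSide (k : Fin 4) (x : I) : I × I :=
  match k with
  | 0 => (x, 0)
  | 1 => (1, x)
  | 2 => (σ x, 1)
  | 3 => (0, σ x)

/-- The midpoint of `[0,1]`. -/
def unitHalf : I := ⟨1 / 2, by norm_num, by norm_num⟩

/-- The affine map of `[0,1]` onto `[a/n, (a+1)/n]`. -/
def shrink (n : ℕ) (a : Fin n) (x : I) : I :=
  ⟨((a : ℕ) + (x : ℝ)) / n, by
    have h0 := x.2.1
    have h1 := x.2.2
    have hn : (0 : ℝ) < n := by exact_mod_cast a.pos
    have ha : ((a : ℕ) : ℝ) + 1 ≤ n := by exact_mod_cast a.2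
    constructor
    · positivity
    · rw [div_le_one hn]; linarith⟩

/-- The affine map of `[0,1]²` onto the square number `(a, b)` of its subdivision into `n²`
squares. -/
def subSquare (n : ℕ) (a b : Fin n) (p : I × I) : I × I := (shrink n a p.1, shrink n b p.2)

/-- The straight path from `x` to `y` in `[0,1]`. -/
def segmentI (x y : I) : Path x y where
  toFun τ := ⟨(1 - (τ : ℝ)) * x + τ * y, by
    have := τ.2.1
    have h : (0 : ℝ) ≤ 1 - τ := sub_nonneg.2 τ.2.2
    have := x.2.1
    have := y.2.1
    constructor
    · positivity
    · nlinarith [x.2.2, y.2.2, τ.2.1]⟩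
  continuous_toFun := by fun_prop
  source' := by ext; simp
  target' := by ext; simp

/-- The straight path from `p` to `q` in `[0,1]²`. -/
def segmentSq (p q : I × I) : Path p q := (segmentI p.1 q.1).prod (segmentI p.2 q.2)

namespace PillowcaseCover

/-- The identifications of boundary points of the tiles. -/
inductive GlueRel {T : Type*} (Ψ : PillowcaseCover T) :
    (Σ _ : T, I × I) → (Σ _ : T, I × I) → Prop
  | glue (d : T × Fin 4) (hd : Ψ.glue d ≠ d) (x : I) :
      GlueRel Ψ ⟨d.1, squareSide d.2 x⟩ ⟨(Ψ.glue d).1, squareSide (Ψ.glue d).2 (σ x)⟩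

/-- The compact surface `Ψ̄` (conical points included), with the quotient topology of the disjoint
union of the closed tiles. -/
def Space {T : Type*} (Ψ : PillowcaseCover T) : Type _ := Quot Ψ.GlueRel

instance {T : Type*} (Ψ : PillowcaseCover T) : TopologicalSpace Ψ.Space :=
  inferInstanceAs (TopologicalSpace (Quot Ψ.GlueRel))

/-- The point of the surface with coordinates `p` in the tile `t`. -/
def point {T : Type*} (Ψ : PillowcaseCover T) (t : T) (p : I × I) : Ψ.Space := Quot.mk _ ⟨t, p⟩

theorem continuous_point {T : Type*} (Ψ : PillowcaseCover T) (t : T) : Continuous (Ψ.point t) :=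
  continuous_quot_mk.comp continuous_sigmaMk

/-- The open tile `t`. -/
def openTile {T : Type*} (Ψ : PillowcaseCover T) (t : T) : Set Ψ.Space :=
  Ψ.point t '' {p | 0 < p.1 ∧ p.1 < 1 ∧ 0 < p.2 ∧ p.2 < 1}

/-- The open side `d` of a tile. -/
def openSide {T : Type*} (Ψ : PillowcaseCover T) (d : T × Fin 4) : Set Ψ.Space :=
  (fun x => Ψ.point d.1 (squareSide d.2 x)) '' {x | 0 < x ∧ x < 1}

/-- An open subset of the surface which is a union of open tiles, open sides and corners of tiles,
i.e. an open subset which is itself a pillowcase cover, with boundary made of sides of tiles. -/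
structure IsTiledOpen {T : Type*} (Ψ : PillowcaseCover T) (U : Set Ψ.Space) : Prop where
  isOpen : IsOpen U
  tile : ∀ t, Ψ.openTile t ⊆ U ∨ Disjoint (Ψ.openTile t) U
  side : ∀ d, Ψ.openSide d ⊆ U ∨ Disjoint (Ψ.openSide d) U

/-- The centre, as a point of the surface, of a square of the subdivision of the tiles into `n²`
squares. -/
def centre {T : Type*} (Ψ : PillowcaseCover T) {n : ℕ} (v : T × Fin n × Fin n) : Ψ.Space :=
  Ψ.point v.1 (subSquare n v.2.1 v.2.2 (unitHalf, unitHalf))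

/-- The midpoint, as a point of the surface, of a side of a square of the subdivision. -/
def sideMid {T : Type*} (Ψ : PillowcaseCover T) {n : ℕ} (v : T × Fin n × Fin n) (k : Fin 4) :
    Ψ.Space :=
  Ψ.point v.1 (subSquare n v.2.1 v.2.2 (squareSide k unitHalf))

/-- The straight path from the centre of a square of the subdivision to the midpoint of a side. -/
def halfEdge {T : Type*} (Ψ : PillowcaseCover T) {n : ℕ} (v : T × Fin n × Fin n) (k : Fin 4) :
    Path (Ψ.centre v) (Ψ.sideMid v k) :=
  (segmentSq (subSquare n v.2.1 v.2.2 (unitHalf, unitHalf))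
    (subSquare n v.2.1 v.2.2 (squareSide k unitHalf))).map (Ψ.continuous_point v.1)

/-- The vertices of the discretization `U_n`: the centres, lying in `U`, of the squares of the
subdivision. For the discretization `Ψ_n` of the whole surface take `U = Set.univ`. -/
abbrev Vertex {T : Type*} (Ψ : PillowcaseCover T) (U : Set Ψ.Space) (n : ℕ) : Type _ :=
  {v : T × Fin n × Fin n // Ψ.centre v ∈ U}

/-- The oriented edges of the nearest-neighbour multigraph `U_n` starting at the vertex `v`: the
side `k` of the square of `v` coincides in the surface with the side `l` of the square of another
vertex `w` (or with another side of the square of `v`), and the edge, which crosses this side at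
its midpoint, stays inside `U`. -/
def EdgeFrom {T : Type*} (Ψ : PillowcaseCover T) (U : Set Ψ.Space) (n : ℕ) (v : Ψ.Vertex U n) :
    Type _ :=
  {e : Fin 4 × (Ψ.Vertex U n × Fin 4) // (v, e.1) ≠ e.2 ∧
    Ψ.sideMid v.1 e.1 = Ψ.sideMid e.2.1.1 e.2.2 ∧ Ψ.sideMid v.1 e.1 ∈ U}

instance {T : Type*} [Finite T] (Ψ : PillowcaseCover T) (U : Set Ψ.Space) (n : ℕ) :
    Fintype (Ψ.Vertex U n) := Fintype.ofFinite _

instance {T : Type*} [Finite T] (Ψ : PillowcaseCover T) (U : Set Ψ.Space) (n : ℕ)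
    (v : Ψ.Vertex U n) : Fintype (Ψ.EdgeFrom U n v) :=
  haveI : Finite (Ψ.EdgeFrom U n v) := Subtype.finite
  Fintype.ofFinite _

/-- The other end of an edge. -/
def EdgeFrom.head {T : Type*} {Ψ : PillowcaseCover T} {U : Set Ψ.Space} {n : ℕ}
    {v : Ψ.Vertex U n} (e : Ψ.EdgeFrom U n v) : Ψ.Vertex U n := e.1.2.1

/-- The straight path along an edge, from its other end to `v`. -/
def EdgeFrom.path {T : Type*} {Ψ : PillowcaseCover T} {U : Set Ψ.Space} {n : ℕ}
    {v : Ψ.Vertex U n} (e : Ψ.EdgeFrom U n v) : Path (Ψ.centre e.head.1) (Ψ.centre v.1) :=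
  (Ψ.halfEdge e.1.2.1.1 e.1.2.2).trans ((Ψ.halfEdge v.1 e.1.1).symm.cast e.2.2.1.symm rfl)

end PillowcaseCover

/-- A flat unitary (Hermitian, finite-dimensional) vector bundle on a space `X`, given by its
fibres and its unitary parallel transport, which is compatible with concatenation of paths.
Flatness: the parallel transport depends only on the homotopy class of a path, i.e. contractible
loops have trivial monodromy. -/
structure FlatUnitaryBundle (X : Type*) [TopologicalSpace X] where
  fiber : X → Type*
  [normedAddCommGroup : ∀ x, NormedAddCommGroup (fiber x)]
  [innerProductSpace : ∀ x, InnerProductSpace ℂ (fiber x)]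
  [finiteDimensional : ∀ x, FiniteDimensional ℂ (fiber x)]
  transport : ∀ {x y : X}, Path x y → (fiber x ≃ₗᵢ[ℂ] fiber y)
  transport_refl : ∀ (x : X) (f : fiber x), transport (Path.refl x) f = f
  transport_trans : ∀ {x y z : X} (p : Path x y) (q : Path y z) (f : fiber x),
    transport (p.trans q) f = transport q (transport p f)
  flat : ∀ {x y : X} (p q : Path x y), p.Homotopic q → transport p = transport q

attribute [instance] FlatUnitaryBundle.normedAddCommGroup FlatUnitaryBundle.innerProductSpace
  FlatUnitaryBundle.finiteDimensional

/-- The complex power `(A^⊥)^z` of a self-adjoint positive operator `A` on a finite-dimensional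
Hermitian space, restricted to the span of the eigenvectors with non-zero eigenvalues (and zero on
the kernel): the sum of `μ ^ z` times the orthogonal projection onto the `μ`-eigenspace over
all eigenvalues `μ ≠ 0`. -/
def perpPower {E : Type*} [NormedAddCommGroup E] [InnerProductSpace ℂ E] [FiniteDimensional ℂ E]
    (A : E →ₗ[ℂ] E) (z : ℂ) : E →ₗ[ℂ] E :=
  ∑ μ : Module.End.Eigenvalues A, if (μ : ℂ) = 0 then 0 else
    (μ : ℂ) ^ z • ((Module.End.eigenspace A (μ : ℂ)).starProjection : E →ₗ[ℂ] E)

namespace FlatUnitaryBundle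

/-- The Hermitian space `Map(V(U_n), F_n)` of sections over the vertices of `U_n` of the bundle
`F_n`, the restriction of `F`; its norm is the `L²` norm. -/
abbrev Sections {T : Type*} {Ψ : PillowcaseCover T} (F : FlatUnitaryBundle Ψ.Space)
    (U : Set Ψ.Space) (n : ℕ) : Type _ :=
  PiLp 2 fun v : Ψ.Vertex U n => F.fiber (Ψ.centre v.1)

/-- The twisted discrete Laplacian of `U_n`: `(Δ f)(v) = ∑ (f(v) - φ_{v'v} f(v'))`, the sum
over the edges `(v, v')` at `v`, where `φ_{v'v}` is the parallel transport along the edge. -/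
def laplacian {T : Type*} [Finite T] {Ψ : PillowcaseCover T} (F : FlatUnitaryBundle Ψ.Space)
    (U : Set Ψ.Space) (n : ℕ) : F.Sections U n →ₗ[ℂ] F.Sections U n where
  toFun f := WithLp.toLp 2 fun v => ∑ e : Ψ.EdgeFrom U n v, (f v - F.transport e.path (f e.head))
  map_add' f g := by
    ext v
    simp only [PiLp.add_apply, map_add, ← Finset.sum_add_distrib]
    exact Finset.sum_congr rfl fun e _ => by abel
  map_smul' c f := by
    ext v
    simp only [PiLp.smul_apply, map_smul, RingHom.id_apply, Finset.smul_sum, smul_sub]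

/-- Restriction of sections from `Ψ_n` to `U_n`. -/
def restrict {T : Type*} {Ψ : PillowcaseCover T} (F : FlatUnitaryBundle Ψ.Space)
    (U : Set Ψ.Space) (n : ℕ) : F.Sections Set.univ n →ₗ[ℂ] F.Sections U n where
  toFun f := WithLp.toLp 2 fun v => f ⟨v.1, Set.mem_univ _⟩
  map_add' _ _ := rfl
  map_smul' _ _ := rfl

open Classical in
/-- Extension by zero of sections from `U_n` to `Ψ_n`. -/
def extend {T : Type*} {Ψ : PillowcaseCover T} (F : FlatUnitaryBundle Ψ.Space)
    (U : Set Ψ.Space) (n : ℕ) : F.Sections U n →ₗ[ℂ] F.Sections Set.univ n where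
  toFun f := WithLp.toLp 2 fun v => if h : Ψ.centre v.1 ∈ U then f ⟨v.1, h⟩ else 0
  map_add' f g := by
    ext v
    by_cases h : Ψ.centre v.1 ∈ U <;> simp [h]
  map_smul' c f := by
    ext v
    by_cases h : Ψ.centre v.1 ∈ U <;> simp [h]

/-- Pointwise multiplication of sections over `Ψ_n` by a function on the surface. -/
def mulFun {T : Type*} {Ψ : PillowcaseCover T} (F : FlatUnitaryBundle Ψ.Space) (n : ℕ)
    (φ : C(Ψ.Space, ℝ)) : F.Sections Set.univ n →ₗ[ℂ] F.Sections Set.univ n where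
  toFun f := WithLp.toLp 2 fun v => (φ (Ψ.centre v.1) : ℂ) • f v
  map_add' f g := by
    ext v
    simp
  map_smul' c f := by
    ext v
    exact smul_comm _ c (f v)

/-- `(n² Δ_{U_n}^⊥)^{-s}`. -/
def laplacianPower {T : Type*} [Finite T] {Ψ : PillowcaseCover T} (F : FlatUnitaryBundle Ψ.Space)
    (U : Set Ψ.Space) (n : ℕ) (s : ℂ) : F.Sections U n →ₗ[ℂ] F.Sections U n :=
  perpPower ((n : ℂ) ^ 2 • F.laplacian U n) (-s)

/-- The renormalized discrete zeta function
`Tr [ (n² Δ_{Ψ_n}^⊥)^{-s} - ∑_α φ_α (n² Δ_{U_{α,n}}^⊥)^{-s} ψ_α ]`, where operators on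
sections over `U_{α,n}` act on sections over `Ψ_n` by restriction and extension by zero. -/
def renormalizedZeta {T : Type*} [Finite T] {Ψ : PillowcaseCover T}
    (F : FlatUnitaryBundle Ψ.Space) {ι : Type*} [Fintype ι] (U : ι → Set Ψ.Space)
    (φ ψ : ι → C(Ψ.Space, ℝ)) (n : ℕ) (s : ℂ) : ℂ :=
  LinearMap.trace ℂ (F.Sections Set.univ n)
    (F.laplacianPower Set.univ n s -
      ∑ α, F.mulFun n (φ α) ∘ₗ F.extend (U α) n ∘ₗ F.laplacianPower (U α) n s ∘ₗ
        F.restrict (U α) n ∘ₗ F.mulFun n (ψ α))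

end FlatUnitaryBundle

end

/-!
Put `N = n²`, and let `A = n² Δ` be the rescaled Laplacian of `Ψ_n` and `B` the one of `U_n` for one
of the sets `U = U_α`, with `J` and `R` extension and restriction. Since `φ_α ψ_α = φ_α` and
`∑ φ_α = 1`, the renormalized zeta function is the sum over `α` of the traces of
`φ_α (A^{-s} - J B^{-s} R)`, and each of these is bounded.

With a constant `Λ` such that `A, B ≤ Λ N`, the contractions `P = 1 - A / (Λ N)` and
`Q = 1 - B / (Λ N)` turn the powers into binomial series:
`(A / (Λ N))^{-s} = ∑ a_k(s) P^k` off the kernel, with `|a_k(s)| ≤ C k^{Re s - 1}`. The theorem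
follows from two bounds of the traces of the terms (`exists_bound_sum_cpow`).

* For `k ≤ N`, the trace `D_k` of `φ (P^k - J Q^k R)` is at most `C (k / N)^M`, for any `M`. As `A`
  and `B` are nearest-neighbour operators, `p(A) φ = J p(B) R φ` for polynomials `p` of degree
  less than `ε n`. On `[-1, 1]` the monomial `x^k` is approximated by such polynomials up to an
  error of the size of the probability that a random walk reaches the distance `ε n` in `k` steps,
  because its Chebyshev coefficients are binomial (`exists_polynomial_approx_pow`). Hence
  `φ (P^k - J Q^k R)` has small operator norm. Writing `k` as a sum of two halves, the other half
  of the power provides the trace norm (`norm_trace_pow_sub_le`).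
* For `k > N`, the traces of `P^k` and `Q^k` off the kernels are at most `C (N / k)^M`.

The kernels contribute at `k ≤ N` a bounded multiple of
`∑_{k ≤ N} a_k(s) = a_N(s + 1) = O(N^{Re s})`.

Both bounds use spectral information which is uniform in `n` (`SpectralBounds`): a bound of
`Tr (1 + A)⁻²`, a gap above `0`, and `A ≤ Λ N`, the latter because the degrees are bounded. After
trivialising the bundle on each tile, they are Poincaré inequalities on grids. For the first one, a
section whose sums over about `M²` blocks per tile vanish has Rayleigh quotient at least `M² / 16`,
so the number of eigenvalues below `M² / 16` is `O(M²)`. For the gap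
(`FlatUnitaryBundle.exists_norm_sq_le_energy`), a section is compared with its means over the
tiles. The jumps of the means across the sides are controlled by the energy, and the map which
sends the means to their jumps is a linear map of finite-dimensional spaces that does not depend
on `n`; its kernel consists of flat sections, to which eigensections with non-zero eigenvalue are
orthogonal.

The locality needs that about `ε n` steps of the graph lead from the support of `φ_α` to the
complement of `U_α`. The graph distance is measured by an approximation of `ψ_α` which is Lipschitz
on each tile, namely its tensor product Bernstein approximation; this is compatible with the
gluing, since on a side it depends only on the values on this side
(`PillowcaseCover.exists_lipschitz_approx`).
-/

/-! ### Polynomial approximation of powers -/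

open Polynomial in
/-- Fourier expansion of `cos ^ k`. -/
theorem two_mul_cos_pow (θ : ℝ) (k : ℕ) :
    (2 * Real.cos θ) ^ k =
      ∑ j ∈ Finset.range (k + 1), (k.choose j : ℝ) * Real.cos (((k : ℤ) - 2 * j : ℤ) * θ) := by
  have h : ((2 * Real.cos θ : ℝ) : ℂ) ^ k = ∑ j ∈ Finset.range (k + 1),
      (k.choose j : ℂ) * Complex.exp (((((k : ℤ) - 2 * j : ℤ) : ℝ) * θ : ℝ) * Complex.I) := by
    have : ((2 * Real.cos θ : ℝ) : ℂ) =
        Complex.exp (-(θ * Complex.I)) + Complex.exp (θ * Complex.I) := by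
      push_cast
      rw [Complex.cos]
      ring_nf
    rw [this, add_pow]
    refine Finset.sum_congr rfl fun j hj => ?_
    rw [← Complex.exp_nat_mul, ← Complex.exp_nat_mul, ← Complex.exp_add, mul_comm]
    congr 2
    have : j ≤ k := by simpa [Nat.lt_succ_iff] using hj
    push_cast [Nat.cast_sub this]
    ring
  have h2 := congrArg Complex.re h
  rw [← Complex.ofReal_pow, Complex.ofReal_re, Complex.re_sum] at h2
  rw [h2]
  refine Finset.sum_congr rfl fun j _ => ?_
  rw [← Complex.ofReal_natCast, Complex.re_ofReal_mul, Complex.exp_ofReal_mul_I_re]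

/-- The two-sided Chernoff bound for a sum of `k` independent signs. -/
theorem sum_choose_tail_le (k m : ℕ) (hk : 1 ≤ k) :
    ∑ j ∈ Finset.range (k + 1) with ¬ |((k : ℤ) - 2 * ((j : ℕ) : ℤ))| < m, (k.choose j : ℝ) ≤
      2 ^ k * (2 * Real.exp (-(m ^ 2 / (2 * k)))) := by
  have hk0 : (0 : ℝ) < k := by exact_mod_cast hk
  -- the exponent `l = m / k` is optimal in the exponential Markov inequality
  set l : ℝ := m / k with hl
  have hl0 : 0 ≤ l := by positivity
  have key : ∀ r : ℝ, ∑ j ∈ Finset.range (k + 1),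
      (k.choose j : ℝ) * Real.exp (r * ((k : ℤ) - 2 * j : ℤ)) = (2 * Real.cosh r) ^ k := by
    intro r
    have : 2 * Real.cosh r = Real.exp (-r) + Real.exp r := by rw [Real.cosh_eq]; ring
    rw [this, add_pow]
    refine Finset.sum_congr rfl fun j hj => ?_
    rw [← Real.exp_nat_mul, ← Real.exp_nat_mul, ← Real.exp_add, mul_comm]
    congr 2
    have : j ≤ k := by simpa [Nat.lt_succ_iff] using hj
    push_cast [Nat.cast_sub this]
    ring
  calc ∑ j ∈ Finset.range (k + 1) with ¬ |((k : ℤ) - 2 * ((j : ℕ) : ℤ))| < m, (k.choose j : ℝ)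
      ≤ ∑ j ∈ Finset.range (k + 1) with ¬ |((k : ℤ) - 2 * ((j : ℕ) : ℤ))| < m, (k.choose j : ℝ) *
          (Real.exp (-(l * m)) * (Real.exp (l * ((k : ℤ) - 2 * j : ℤ)) +
            Real.exp (-l * ((k : ℤ) - 2 * j : ℤ)))) := by
        refine Finset.sum_le_sum fun j hj => ?_
        have hj2 := (Finset.mem_filter.1 hj).2
        refine le_mul_of_one_le_right (by positivity) ?_
        rw [mul_add, ← Real.exp_add, ← Real.exp_add]
        have h1 : (m : ℤ) ≤ |((k : ℤ) - 2 * j)| := not_lt.1 hj2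
        rcases le_abs.1 h1 with h | h
        · have h' : (m : ℝ) ≤ (((k : ℤ) - 2 * j : ℤ) : ℝ) := by exact_mod_cast h
          have : 1 ≤ Real.exp (-(l * m) + l * ((k : ℤ) - 2 * j : ℤ)) := by
            apply Real.one_le_exp
            nlinarith
          linarith [Real.exp_pos (-(l * m) + -l * ((k : ℤ) - 2 * j : ℤ))]
        · have h' : (m : ℝ) ≤ -(((k : ℤ) - 2 * j : ℤ) : ℝ) := by exact_mod_cast h
          have : 1 ≤ Real.exp (-(l * m) + -l * ((k : ℤ) - 2 * j : ℤ)) := by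
            apply Real.one_le_exp
            nlinarith
          linarith [Real.exp_pos (-(l * m) + l * ((k : ℤ) - 2 * j : ℤ))]
    _ ≤ ∑ j ∈ Finset.range (k + 1), (k.choose j : ℝ) *
          (Real.exp (-(l * m)) * (Real.exp (l * ((k : ℤ) - 2 * j : ℤ)) +
            Real.exp (-l * ((k : ℤ) - 2 * j : ℤ)))) :=
        Finset.sum_le_sum_of_subset_of_nonneg (Finset.filter_subset _ _)
          fun _ _ _ => by positivity
    _ = Real.exp (-(l * m)) * (2 * (2 * Real.cosh l) ^ k) := by
        have h1 := key l
        have h2 := key (-l)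
        rw [Real.cosh_neg] at h2
        rw [two_mul ((2 * Real.cosh l) ^ k)]
        nth_rewrite 1 [← h1]
        rw [← h2, ← Finset.sum_add_distrib, Finset.mul_sum]
        exact Finset.sum_congr rfl fun j _ => by ring
    _ ≤ Real.exp (-(l * m)) * (2 * (2 * Real.exp (l ^ 2 / 2)) ^ k) := by
        have := Real.cosh_le_exp_half_sq l
        have := Real.cosh_pos l
        gcongr
    _ = 2 ^ k * (2 * (Real.exp (-(l * m)) * Real.exp (k * (l ^ 2 / 2)))) := by
        rw [mul_pow, ← Real.exp_nat_mul]; ring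
    _ = _ := by
        rw [← Real.exp_add]
        congr 3
        rw [hl]
        field_simp
        ring

open Polynomial in
/-- On `[-1, 1]` the monomial `x ^ k` is close to a polynomial of degree `< m` as soon as `m` is
large compared with `√k`: truncate its expansion in Chebyshev polynomials. -/
theorem exists_polynomial_approx_pow (k m M : ℕ) (hm : 1 ≤ m) :
    ∃ q : ℝ[X], q.degree < m ∧ ∀ x ∈ Set.Icc (-1 : ℝ) 1,
      |x ^ k - q.eval x| ≤ 2 * M.factorial * (2 * k / m ^ 2) ^ M := by
  rcases Nat.eq_zero_or_pos k with rfl | hk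
  · refine ⟨1, ?_, fun x _ => ?_⟩
    · rw [degree_one]; exact_mod_cast hm
    · simp only [pow_zero, eval_one, sub_self, abs_zero]
      positivity
  have hk0 : (0 : ℝ) < k := by exact_mod_cast hk
  have hm0 : (0 : ℝ) < m := by exact_mod_cast hm
  refine ⟨∑ j ∈ Finset.range (k + 1) with |((k : ℤ) - 2 * ((j : ℕ) : ℤ))| < m,
    C ((k.choose j : ℝ) / 2 ^ k) * Chebyshev.T ℝ ((k : ℤ) - 2 * j), ?_, fun x hx => ?_⟩
  · refine (degree_sum_le _ _).trans_lt ?_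
    rw [Finset.sup_lt_iff (by exact_mod_cast WithBot.bot_lt_coe m)]
    intro j hj
    refine (degree_mul_le _ _).trans_lt ?_
    refine (add_le_of_nonpos_left degree_C_le).trans_lt ?_
    refine degree_le_natDegree.trans_lt ?_
    rw [Chebyshev.natDegree_T]
    have := (Finset.mem_filter.1 hj).2
    rw [Int.abs_eq_natAbs] at this
    have : ((k : ℤ) - 2 * j).natAbs < m := by exact_mod_cast this
    exact_mod_cast this
  · obtain ⟨θ, rfl⟩ : ∃ θ, Real.cos θ = x := ⟨Real.arccos x, Real.cos_arccos hx.1 hx.2⟩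
    have h1 : Real.cos θ ^ k = ∑ j ∈ Finset.range (k + 1), (k.choose j : ℝ) / 2 ^ k *
        Real.cos (((k : ℤ) - 2 * j : ℤ) * θ) := by
      have := two_mul_cos_pow θ k
      rw [mul_pow] at this
      rw [← mul_right_inj' (pow_ne_zero k (two_ne_zero (α := ℝ))), this, Finset.mul_sum]
      refine Finset.sum_congr rfl fun j _ => ?_
      field_simp
    rw [eval_finsetSum, h1, ← Finset.sum_filter_add_sum_filter_not (Finset.range (k + 1))
      (fun j : ℕ => |((k : ℤ) - 2 * ((j : ℕ) : ℤ))| < m)]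
    simp only [eval_mul, eval_C, Chebyshev.T_real_cos]
    rw [add_sub_cancel_left]
    refine (Finset.abs_sum_le_sum_abs _ _).trans ?_
    calc _ ≤ ∑ j ∈ Finset.range (k + 1) with ¬ |((k : ℤ) - 2 * ((j : ℕ) : ℤ))| < m,
            (k.choose j : ℝ) / 2 ^ k := by
          refine Finset.sum_le_sum fun j _ => ?_
          rw [abs_mul, abs_of_nonneg (by positivity : (0 : ℝ) ≤ (k.choose j : ℝ) / 2 ^ k)]
          exact mul_le_of_le_one_right (by positivity) (Real.abs_cos_le_one _)
      _ ≤ 2 * Real.exp (-(m ^ 2 / (2 * k))) := by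
          rw [← Finset.sum_div, div_le_iff₀ (by positivity), mul_comm]
          exact sum_choose_tail_le k m hk
      _ ≤ _ := by
          rw [mul_assoc]
          gcongr
          have h := Real.pow_div_factorial_le_exp (x := (m : ℝ) ^ 2 / (2 * k)) (by positivity) M
          rw [Real.exp_neg, inv_le_comm₀ (Real.exp_pos _) (by positivity)]
          refine le_trans (le_of_eq ?_) h
          rw [mul_inv, ← inv_pow, inv_div]
          ring

/-! ### The binomial series -/

theorem multichoose_succ_mul (s : ℂ) (k : ℕ) :
    ((k : ℂ) + 1) * Ring.multichoose s (k + 1) = (s + k) * Ring.multichoose s k := by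
  have h1 := Ring.factorial_nsmul_multichoose_eq_ascPochhammer s (k + 1)
  have h2 := Ring.factorial_nsmul_multichoose_eq_ascPochhammer s k
  rw [ascPochhammer_succ_right, Polynomial.smeval_mul, ← h2, nsmul_eq_mul, nsmul_eq_mul,
    Nat.factorial_succ] at h1
  have h3 : (Polynomial.X + (k : Polynomial ℕ)).smeval s = s + k := by
    simp [Polynomial.smeval_add, Polynomial.smeval_X, Polynomial.smeval_natCast]
  rw [h3] at h1
  have h4 : (k.factorial : ℂ) ≠ 0 := by exact_mod_cast k.factorial_ne_zero
  apply mul_left_cancel₀ h4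
  push_cast at h1
  linear_combination h1

/-- The partial sums of the binomial series at `x = 0`; they give the contribution of the zero
eigenvalues. -/
theorem sum_multichoose (s : ℂ) (N : ℕ) :
    ∑ k ∈ Finset.range (N + 1), Ring.multichoose s k = Ring.multichoose (s + 1) N := by
  induction N with
  | zero => simp
  | succ N ih => rw [Finset.sum_range_succ, ih, Ring.multichoose_succ_succ, add_comm]

/-- The error `‖w‖ ^ 2` is summable along `w = (s - 1) / (k + 1)`. -/
theorem norm_one_add_le_exp (w : ℂ) : ‖1 + w‖ ≤ Real.exp (w.re + ‖w‖ ^ 2) := by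
  have h1 : ‖1 + w‖ ^ 2 = 1 + (2 * w.re + ‖w‖ ^ 2) := by
    rw [Complex.sq_norm, Complex.sq_norm, Complex.normSq_apply, Complex.normSq_apply]
    simp
    ring
  have h2 : ‖1 + w‖ ^ 2 ≤ Real.exp (w.re + ‖w‖ ^ 2) ^ 2 := by
    rw [h1, ← Real.exp_nat_mul]
    have := Real.add_one_le_exp (((2 : ℕ) : ℝ) * (w.re + ‖w‖ ^ 2))
    push_cast at this ⊢
    nlinarith [sq_nonneg ‖w‖]
  exact le_of_sq_le_sq h2 (Real.exp_pos _).le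

/-- The binomial coefficients `Γ(k+s) / (Γ(s) k!)` grow like `k ^ (Re s - 1)`, locally uniformly
in `s`. -/
theorem norm_multichoose_le {R : ℝ} {s : ℂ} (hs : ‖s‖ ≤ R) {k : ℕ} (hk : 1 ≤ k) :
    ‖Ring.multichoose s k‖ ≤ Real.exp (R + 1 + 2 * (R + 1) ^ 2) * (k : ℝ) ^ (s.re - 1) := by
  have hsum : ∀ k : ℕ, ∑ j ∈ Finset.range k, ((j : ℝ) + 1)⁻¹ ^ 2 ≤ 2 := by
    intro k
    have h := sum_Ioo_inv_sq_le (α := ℝ) 0 (k + 1)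
    have h2 : ∑ j ∈ Finset.range k, ((j : ℝ) + 1)⁻¹ ^ 2 =
        ∑ i ∈ Finset.Ioo 0 (k + 1), ((i : ℝ) ^ 2)⁻¹ := by
      have himg : Finset.Ioo 0 (k + 1) = (Finset.range k).image (fun j => j + 1) := by
        ext i
        simp only [Finset.mem_image, Finset.mem_range, Finset.mem_Ioo]
        constructor
        · rintro ⟨h1, h2⟩; exact ⟨i - 1, by omega, by omega⟩
        · rintro ⟨a, ha, rfl⟩; omega
      rw [himg, Finset.sum_image (by intro a _ b _ h; simpa using h)]
      exact Finset.sum_congr rfl fun j _ => by push_cast; rw [inv_pow]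
    rw [h2]
    simpa using h
  -- the coefficient is the product of the factors `1 + (s - 1) / (j + 1)` over `j < k`
  have key : ∀ k : ℕ, ‖Ring.multichoose s k‖ ≤ Real.exp ((s.re - 1) * (harmonic k : ℝ) +
      ‖s - 1‖ ^ 2 * ∑ j ∈ Finset.range k, ((j : ℝ) + 1)⁻¹ ^ 2) := by
    intro k
    induction k with
    | zero => simp
    | succ k ih =>
      have hk1 : ((k : ℂ) + 1) ≠ 0 := by exact_mod_cast Nat.succ_ne_zero k
      have hrec : Ring.multichoose s (k + 1) =
          (1 + (((k : ℝ) + 1)⁻¹ : ℝ) * (s - 1)) * Ring.multichoose s k := by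
        apply mul_left_cancel₀ hk1
        rw [multichoose_succ_mul]
        push_cast
        field_simp
        ring
      rw [hrec, norm_mul, harmonic_succ, Finset.sum_range_succ]
      refine (mul_le_mul (norm_one_add_le_exp _) ih (norm_nonneg _) (Real.exp_pos _).le).trans ?_
      rw [← Real.exp_add, Complex.re_ofReal_mul, norm_mul, Complex.norm_real, mul_pow,
        Real.norm_eq_abs, sq_abs]
      apply le_of_eq
      congr 1
      push_cast
      simp
      ring
  have hk0 : (0 : ℝ) < k := by exact_mod_cast hk
  have h1 : Real.log k ≤ harmonic k := by
    refine le_trans ?_ (log_add_one_le_harmonic k)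
    exact Real.log_le_log hk0 (by push_cast; linarith)
  have h2 := harmonic_le_one_add_log k
  have h3 : ‖s - 1‖ ≤ R + 1 := (norm_sub_le _ _).trans (by simpa using hs)
  have h4 : |s.re - 1| ≤ R + 1 := by
    refine le_trans ?_ h3
    simpa using Complex.abs_re_le_norm (s - 1)
  refine (key k).trans ?_
  rw [Real.rpow_def_of_pos hk0, ← Real.exp_add]
  apply Real.exp_le_exp.2
  have h5 : (s.re - 1) * ((harmonic k : ℝ) - Real.log k) ≤ (R + 1) * 1 := by
    refine (le_abs_self _).trans ?_
    rw [abs_mul]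
    refine mul_le_mul h4 ?_ (abs_nonneg _) ((abs_nonneg _).trans h4)
    rw [abs_le]; constructor <;> linarith
  have h6 : ‖s - 1‖ ^ 2 * ∑ j ∈ Finset.range k, ((j : ℝ) + 1)⁻¹ ^ 2 ≤ (R + 1) ^ 2 * 2 := by
    refine mul_le_mul ?_ (hsum k) (Finset.sum_nonneg fun _ _ => by positivity) (by positivity)
    exact pow_le_pow_left₀ (norm_nonneg _) h3 2
  linarith

/-- The binomial series for `X ^ (-s)` around `X = 1`. -/
theorem hasSum_multichoose_mul_pow (s : ℂ) {x : ℝ} (h0 : 0 < x) (h1 : x ≤ 1) :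
    HasSum (fun k => Ring.multichoose s k * ((1 - x : ℝ) : ℂ) ^ k) ((x : ℂ) ^ (-s)) := by
  have h := (Complex.one_div_one_sub_cpow_hasFPowerSeriesOnBall_zero s).hasSum
    (y := ((1 - x : ℝ) : ℂ)) (by
      rw [← ENNReal.ofReal_one, Metric.eball_ofReal, mem_ball_zero_iff, Complex.norm_real,
        Real.norm_eq_abs, abs_lt]
      constructor <;> linarith)
  have h2 : 1 / (1 - (0 + ((1 - x : ℝ) : ℂ))) ^ s = (x : ℂ) ^ (-s) := by
    rw [Complex.cpow_neg]; push_cast; simp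
  rw [h2] at h
  have h3 : (fun k => Ring.multichoose s k * ((1 - x : ℝ) : ℂ) ^ k) = fun k =>
      (FormalMultilinearSeries.ofScalars ℂ (fun n => Ring.choose (s + n - 1) n) k)
        fun _ => ((1 - x : ℝ) : ℂ) := by
    ext k
    simp [FormalMultilinearSeries.ofScalars, Ring.multichoose_eq]
  rw [h3]
  exact h

/-! ### Weighted sums of complex powers of eigenvalues -/

/-- Exponential decay beats every power. -/
theorem one_sub_pow_le {y : ℝ} (h0 : 0 < y) (h1 : y ≤ 1) {k : ℕ} (hk : 1 ≤ k) (M : ℕ) :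
    (1 - y) ^ k ≤ M.factorial * ((k * y) ^ M)⁻¹ := by
  have hk0 : (0 : ℝ) < k := by exact_mod_cast hk
  have h2 : (1 - y) ^ k ≤ Real.exp (-(k * y)) := by
    have := Real.add_one_le_exp (-y)
    calc (1 - y) ^ k ≤ Real.exp (-y) ^ k := pow_le_pow_left₀ (by linarith) (by linarith) k
      _ = _ := by rw [← Real.exp_nat_mul]; ring_nf
  refine h2.trans ?_
  have h3 := Real.pow_div_factorial_le_exp (x := k * y) (by positivity) M
  rw [Real.exp_neg, inv_le_comm₀ (Real.exp_pos _) (by positivity)]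
  refine le_trans (le_of_eq ?_) h3
  rw [mul_inv, inv_inv]
  ring

/-- The scalar form of the theorem. The points `x i` are the eigenvalues of the two operators to
be compared, and `w i` their signed local weights. If the weighted power sums of
`1 - x i / (Λ N)` are small up to the power `N`, and if the number of eigenvalues is controlled by
`∑ (1 + x i)⁻²` and non-zero eigenvalues stay away from `0`, then the weighted sum of `x i ^ (-s)`
is bounded, uniformly in `N`. -/
theorem exists_bound_sum_cpow {R c Λ C₀ C₁ : ℝ} (hc : 0 < c) (hΛ : 1 ≤ Λ)
    (hC₀ : 0 ≤ C₀) (hC₁ : 0 ≤ C₁)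
    {M : ℕ} (hM : R + 1 ≤ M) (hM2 : 2 ≤ M) :
    ∃ C : ℝ, ∀ {ι : Type} [Fintype ι] (w x : ι → ℝ) (N : ℕ), 1 ≤ N → (∀ i, |w i| ≤ 1) →
      (∀ i, x i = 0 ∨ c ≤ x i) → (∀ i, x i ≤ Λ * N) →
      ∑ i, ((1 + x i) ^ 2)⁻¹ ≤ C₀ → ∑ i, w i = 0 →
      (∀ k : ℕ, 1 ≤ k → k ≤ N → |∑ i, w i * (1 - x i / (Λ * N)) ^ k| ≤ C₁ * (k / N) ^ M) →
      ∀ s : ℂ, ‖s‖ ≤ R →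
        ‖∑ i, (w i : ℂ) * (if x i = 0 then 0 else (x i : ℂ) ^ (-s))‖ ≤ C := by
  set Ca : ℝ := Real.exp (R + 1 + 2 * (R + 1) ^ 2) with hCa
  set Cb : ℝ := Real.exp (R + 1 + 1 + 2 * (R + 1 + 1) ^ 2) with hCb
  set Ct : ℝ := M.factorial * Λ ^ M * ((1 + c) / c) ^ M * C₀ with hCt
  refine ⟨Λ ^ R * (Ca * C₁ + C₀ * Cb + Ca * Ct), ?_⟩
  intro ι _ w x N hN hw hx hxN hsum hw0 hD s hs
  have hN0 : (0 : ℝ) < N := by exact_mod_cast hN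
  have hΛ0 : 0 < Λ := by linarith
  have hσ : |s.re| ≤ R := (Complex.abs_re_le_norm s).trans hs
  have hσ1 := (abs_le.1 hσ).1
  have hσ2 := (abs_le.1 hσ).2
  have hx0 : ∀ i, 0 ≤ x i := fun i => by rcases hx i with h | h <;> linarith
  set a : ℕ → ℂ := fun k => Ring.multichoose s k with ha
  have ha_le : ∀ k : ℕ, 1 ≤ k → ‖a k‖ ≤ Ca * (k : ℝ) ^ (s.re - 1) := fun k hk =>
    norm_multichoose_le hs hk
  -- power sums over the non-zero eigenvalues
  set d : ℕ → ℝ := fun k => ∑ i, if x i = 0 then 0 else w i * (1 - x i / (Λ * N)) ^ k with hd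
  set d₀ : ℝ := ∑ i, if x i = 0 then w i else 0 with hd₀
  have hd_eq : ∀ k, d k = (∑ i, w i * (1 - x i / (Λ * N)) ^ k) - d₀ := by
    intro k
    rw [hd, hd₀, ← Finset.sum_sub_distrib]
    refine Finset.sum_congr rfl fun i _ => ?_
    by_cases h : x i = 0 <;> simp [h]
  have hd₀_le : |d₀| ≤ C₀ := by
    refine (Finset.abs_sum_le_sum_abs _ _).trans (le_trans ?_ hsum)
    refine Finset.sum_le_sum fun i _ => ?_
    by_cases h : x i = 0
    · simpa [h] using hw i
    · have := hx0 i
      simp only [h, if_false, abs_zero]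
      positivity
  -- for `k > N` the bound of the power sums of order `k` comes from the spectral gap
  have hd_tail : ∀ k : ℕ, 1 ≤ k → |d k| ≤ Ct * (N / k) ^ M := by
    intro k hk
    have hk0 : (0 : ℝ) < k := by exact_mod_cast hk
    refine (Finset.abs_sum_le_sum_abs _ _).trans ?_
    have : ∀ i, |if x i = 0 then 0 else w i * (1 - x i / (Λ * N)) ^ k| ≤
        (M.factorial * Λ ^ M * ((1 + c) / c) ^ M * (N / k) ^ M) * ((1 + x i) ^ 2)⁻¹ := by
      intro i
      have hxi := hx0 i
      rcases hx i with h | h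
      · simp only [h, if_true, abs_zero]
        positivity
      · have hxp : 0 < x i := lt_of_lt_of_le hc h
        rw [if_neg hxp.ne']
        have hy1 : x i / (Λ * N) ≤ 1 := by rw [div_le_one (by positivity)]; exact hxN i
        have hy0 : 0 < x i / (Λ * N) := by positivity
        rw [abs_mul, abs_of_nonneg (pow_nonneg (sub_nonneg.2 hy1) k)]
        refine (mul_le_of_le_one_left (pow_nonneg (sub_nonneg.2 hy1) k) (hw i)).trans ?_
        refine (one_sub_pow_le hy0 hy1 hk M).trans ?_
        have h1 : 1 + x i ≤ (1 + c) / c * x i := by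
          rw [div_mul_eq_mul_div, le_div_iff₀ hc]
          nlinarith
        have h2 : (1 + x i) ^ 2 ≤ ((1 + c) / c * x i) ^ M :=
          (pow_le_pow_right₀ (by linarith) hM2).trans (pow_le_pow_left₀ (by linarith) h1 M)
        have h3 : ((x i) ^ M)⁻¹ ≤ ((1 + c) / c) ^ M * ((1 + x i) ^ 2)⁻¹ := by
          rw [mul_pow] at h2
          rw [inv_le_iff_one_le_mul₀ (by positivity), mul_right_comm, ← div_eq_mul_inv,
            one_le_div (by positivity)]
          exact h2
        calc (M.factorial : ℝ) * ((k * (x i / (Λ * N))) ^ M)⁻¹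
            = M.factorial * Λ ^ M * (N / k) ^ M * ((x i) ^ M)⁻¹ := by
              have e : (k * (x i / (Λ * N)))⁻¹ = Λ * (N / k) * (x i)⁻¹ := by field_simp
              rw [← inv_pow, e, mul_pow, mul_pow, inv_pow]
              ring
          _ ≤ M.factorial * Λ ^ M * (N / k) ^ M * (((1 + c) / c) ^ M * ((1 + x i) ^ 2)⁻¹) := by
              gcongr
          _ = _ := by ring
    refine (Finset.sum_le_sum fun i _ => this i).trans ?_
    rw [← Finset.mul_sum]
    refine (mul_le_mul_of_nonneg_left hsum (by positivity)).trans (le_of_eq ?_)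
    rw [hCt]; ring
  -- the sum as a series
  have hS : HasSum (fun k => a k * (d k : ℂ)) (∑ i, (w i : ℂ) *
      (if x i = 0 then 0 else ((x i / (Λ * N) : ℝ) : ℂ) ^ (-s))) := by
    have : ∀ i ∈ Finset.univ, HasSum (fun k => a k *
        (((if x i = 0 then 0 else w i * (1 - x i / (Λ * N)) ^ k : ℝ)) : ℂ))
        ((w i : ℂ) * (if x i = 0 then 0 else ((x i / (Λ * N) : ℝ) : ℂ) ^ (-s))) := by
      intro i _
      by_cases h : x i = 0
      · simp [h, hasSum_zero]
      · have hxp : 0 < x i := lt_of_le_of_ne (hx0 i) (Ne.symm h)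
        have hy1 : x i / (Λ * N) ≤ 1 := by rw [div_le_one (by positivity)]; exact hxN i
        have h1 := (hasSum_multichoose_mul_pow s (by positivity : 0 < x i / (Λ * N)) hy1).mul_left
          (w i : ℂ)
        simp only [h, if_false]
        refine h1.congr_fun ?_
        intro k
        push_cast
        ring
    have h2 := hasSum_sum this
    refine h2.congr_fun ?_
    intro k
    rw [hd]
    push_cast
    rw [Finset.mul_sum]
  -- up to `k = N` the hypothesis on the power sums is used, and the zero eigenvalues contribute
  -- a multiple of a partial sum of the binomial coefficients
  have hpow : ∀ k : ℕ, 1 ≤ k → (k : ℝ) ^ (s.re - 1) =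
      (N : ℝ) ^ (s.re - 1) * ((k : ℝ) / N) ^ (s.re - 1) := by
    intro k hk
    have hk0 : (0 : ℝ) < k := by exact_mod_cast hk
    rw [← Real.mul_rpow hN0.le (by positivity), mul_div_cancel₀ _ hN0.ne']
  have hNN : (N : ℝ) ^ (s.re - 1) * N = (N : ℝ) ^ s.re := by
    rw [← Real.rpow_add_one hN0.ne', sub_add_cancel]
  have hbound1 : ‖∑ k ∈ Finset.range (N + 1), a k * (d k : ℂ)‖ ≤
      (Ca * C₁ + C₀ * Cb) * (N : ℝ) ^ s.re := by
    have e1 : ∑ k ∈ Finset.range (N + 1), a k * (d k : ℂ) =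
        (∑ k ∈ Finset.range (N + 1), a k *
          ((∑ i, w i * (1 - x i / (Λ * N)) ^ k : ℝ) : ℂ)) -
        (d₀ : ℂ) * Ring.multichoose (s + 1) N := by
      rw [← sum_multichoose, Finset.mul_sum, ← Finset.sum_sub_distrib]
      refine Finset.sum_congr rfl fun k _ => ?_
      rw [hd_eq]
      push_cast
      ring
    rw [e1, add_mul]
    refine (norm_sub_le _ _).trans (add_le_add ?_ ?_)
    · rw [Finset.sum_range_succ']
      simp only [pow_zero, mul_one, hw0, Complex.ofReal_zero, mul_zero, add_zero]
      have : ∀ k ∈ Finset.range N, ‖a (k + 1) *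
          ((∑ i, w i * (1 - x i / (Λ * N)) ^ (k + 1) : ℝ) : ℂ)‖ ≤
          Ca * C₁ * (N : ℝ) ^ (s.re - 1) := by
        intro k hk
        have hk1 : 1 ≤ k + 1 := by omega
        have hkN : k + 1 ≤ N := by simpa using hk
        have hk0 : (0 : ℝ) < ((k + 1 : ℕ) : ℝ) := by exact_mod_cast hk1
        rw [norm_mul, Complex.norm_real, Real.norm_eq_abs]
        refine (mul_le_mul (ha_le _ hk1) (hD _ hk1 hkN) (abs_nonneg _) (by positivity)).trans ?_
        rw [hpow _ hk1]
        have h1 : (((k + 1 : ℕ) : ℝ) / N) ^ (s.re - 1) * (((k + 1 : ℕ) : ℝ) / N) ^ M ≤ 1 := by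
          rw [← Real.rpow_natCast, ← Real.rpow_add (by positivity)]
          refine Real.rpow_le_one (by positivity) ?_ (by linarith)
          rw [div_le_one hN0]; exact_mod_cast hkN
        calc _ = Ca * C₁ * (N : ℝ) ^ (s.re - 1) * ((((k + 1 : ℕ) : ℝ) / N) ^ (s.re - 1) *
              (((k + 1 : ℕ) : ℝ) / N) ^ M) := by ring
          _ ≤ _ := mul_le_of_le_one_right (by positivity) h1
      refine (norm_sum_le_of_le _ this).trans (le_of_eq ?_)
      rw [Finset.sum_const, Finset.card_range, nsmul_eq_mul, ← hNN]
      ring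
    · rw [norm_mul, Complex.norm_real, Real.norm_eq_abs]
      have h1 : ‖s + 1‖ ≤ R + 1 := (norm_add_le _ _).trans (by simpa using hs)
      have h2 := norm_multichoose_le h1 hN
      simp only [Complex.add_re, Complex.one_re, add_sub_cancel_right] at h2
      rw [mul_assoc]
      exact mul_le_mul hd₀_le h2 (norm_nonneg _) hC₀
  have hbound2 : ∀ K, N ≤ K → ‖∑ k ∈ Finset.Ioc N K, a k * (d k : ℂ)‖ ≤
      Ca * Ct * (N : ℝ) ^ s.re := by
    intro K hK
    have hCt0 : 0 ≤ Ct := by positivity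
    have : ∀ k ∈ Finset.Ioc N K, ‖a k * (d k : ℂ)‖ ≤
        Ca * Ct * (N : ℝ) ^ (s.re - 1) * N ^ 2 * ((k : ℝ) ^ 2)⁻¹ := by
      intro k hk
      have hkN : N < k := (Finset.mem_Ioc.1 hk).1
      have hk1 : 1 ≤ k := by omega
      have hk0 : (0 : ℝ) < k := by exact_mod_cast hk1
      have hr : 1 ≤ (k : ℝ) / N := by rw [one_le_div hN0]; exact_mod_cast hkN.le
      rw [norm_mul, Complex.norm_real, Real.norm_eq_abs]
      refine (mul_le_mul (ha_le _ hk1) (hd_tail _ hk1) (abs_nonneg _) (by positivity)).trans ?_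
      rw [hpow _ hk1]
      have h1 : ((k : ℝ) / N) ^ (s.re - 1) * ((N : ℝ) / k) ^ M ≤ N ^ 2 * ((k : ℝ) ^ 2)⁻¹ := by
        have e : ((N : ℝ) / k) ^ M = ((k : ℝ) / N) ^ (-(M : ℝ)) := by
          rw [Real.rpow_neg (by positivity), Real.rpow_natCast, ← inv_pow, inv_div]
        have e2 : (N : ℝ) ^ 2 * ((k : ℝ) ^ 2)⁻¹ = ((k : ℝ) / N) ^ (-((2 : ℕ) : ℝ)) := by
          rw [Real.rpow_neg (by positivity), Real.rpow_natCast]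
          field_simp
        rw [e, e2, ← Real.rpow_add (by positivity)]
        refine Real.rpow_le_rpow_of_exponent_le hr ?_
        push_cast
        linarith
      calc _ = Ca * Ct * (N : ℝ) ^ (s.re - 1) * (((k : ℝ) / N) ^ (s.re - 1) *
            ((N : ℝ) / k) ^ M) := by ring
        _ ≤ Ca * Ct * (N : ℝ) ^ (s.re - 1) * (N ^ 2 * ((k : ℝ) ^ 2)⁻¹) := by gcongr
        _ = _ := by ring
    refine (norm_sum_le_of_le _ this).trans ?_
    rw [← Finset.mul_sum]
    have h1 := sum_Ioc_inv_sq_le_sub (α := ℝ) (by omega : N ≠ 0) hK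
    have h2 : ∑ i ∈ Finset.Ioc N K, ((i : ℝ) ^ 2)⁻¹ ≤ (N : ℝ)⁻¹ := by
      have : (0 : ℝ) ≤ (K : ℝ)⁻¹ := by positivity
      linarith
    refine (mul_le_mul_of_nonneg_left h2 (by positivity)).trans (le_of_eq ?_)
    rw [← hNN]
    field_simp
  have hbound : ‖∑ i, (w i : ℂ) *
      (if x i = 0 then 0 else ((x i / (Λ * N) : ℝ) : ℂ) ^ (-s))‖ ≤
      (Ca * C₁ + C₀ * Cb + Ca * Ct) * (N : ℝ) ^ s.re := by
    refine le_of_tendsto hS.tendsto_sum_nat.norm ?_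
    filter_upwards [Filter.eventually_ge_atTop (N + 1)] with K hK
    obtain ⟨K, rfl⟩ : ∃ K', K = K' + 1 := ⟨K - 1, by omega⟩
    have e : ∑ k ∈ Finset.range (K + 1), a k * (d k : ℂ) =
        (∑ k ∈ Finset.range (N + 1), a k * (d k : ℂ)) +
          ∑ k ∈ Finset.Ioc N K, a k * (d k : ℂ) := by
      rw [Finset.range_eq_Ico, Finset.range_eq_Ico,
        ← Finset.sum_Ico_consecutive _ (Nat.zero_le (N + 1)) hK]
      congr 1
      exact Finset.sum_congr (by ext i; simp) fun _ _ => rfl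
    rw [e, add_mul]
    exact (norm_add_le _ _).trans (add_le_add hbound1 (hbound2 K (by omega)))
  -- the factor `N ^ Re s` is compensated by the rescaling of the eigenvalues
  have hfin : ∑ i, (w i : ℂ) * (if x i = 0 then 0 else (x i : ℂ) ^ (-s)) =
      ((Λ * N : ℝ) : ℂ) ^ (-s) * ∑ i, (w i : ℂ) *
      (if x i = 0 then 0 else ((x i / (Λ * N) : ℝ) : ℂ) ^ (-s)) := by
    rw [Finset.mul_sum]
    refine Finset.sum_congr rfl fun i _ => ?_
    by_cases h : x i = 0
    · simp [h]
    · simp only [h, if_false]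
      have hxi := hx0 i
      rw [mul_left_comm, ← Complex.mul_cpow_ofReal_nonneg (by positivity) (by positivity),
        ← Complex.ofReal_mul, mul_div_cancel₀ _ (by positivity)]
  rw [hfin, norm_mul, Complex.norm_cpow_eq_rpow_re_of_pos (by positivity), Complex.neg_re,
    Real.mul_rpow hΛ0.le hN0.le]
  have h1 : Λ ^ (-s.re) ≤ Λ ^ R := Real.rpow_le_rpow_of_exponent_le hΛ (by linarith)
  have h2 : (N : ℝ) ^ (-s.re) * (N : ℝ) ^ s.re = 1 := by
    rw [← Real.rpow_add hN0]; simp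
  have hnn : 0 ≤ Ca * C₁ + C₀ * Cb + Ca * Ct := by positivity
  calc _ ≤ Λ ^ (-s.re) * (N : ℝ) ^ (-s.re) * ((Ca * C₁ + C₀ * Cb + Ca * Ct) * (N : ℝ) ^ s.re) :=
        mul_le_mul_of_nonneg_left hbound (by positivity)
    _ = Λ ^ (-s.re) * (Ca * C₁ + C₀ * Cb + Ca * Ct) * ((N : ℝ) ^ (-s.re) * (N : ℝ) ^ s.re) := by
        ring
    _ ≤ _ := by
        rw [h2, mul_one]
        exact mul_le_mul_of_nonneg_right h1 hnn

/-! ### Traces and locality -/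

section Trace

variable {E E' : Type*} [NormedAddCommGroup E] [InnerProductSpace ℂ E]
  [NormedAddCommGroup E'] [InnerProductSpace ℂ E']

theorem perpPower_apply_of_eigenvector [FiniteDimensional ℂ E] {A : E →ₗ[ℂ] E}
    (hA : A.IsSymmetric) (z : ℂ) {v : E} {μ : ℝ} (hv : A v = (μ : ℂ) • v) :
    perpPower A z v = (if μ = 0 then 0 else (μ : ℂ) ^ z) • v := by
  classical
  rcases eq_or_ne v 0 with rfl | hv0
  · simp
  have hev : Module.End.HasEigenvalue A (μ : ℂ) :=
    Module.End.hasEigenvalue_of_hasEigenvector (x := v)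
      ⟨Module.End.mem_eigenspace_iff.2 hv, hv0⟩
  obtain ⟨μ', hμ'⟩ : ∃ μ' : Module.End.Eigenvalues A, (μ' : ℂ) = μ := ⟨⟨_, hev⟩, rfl⟩
  rw [perpPower, LinearMap.sum_apply]
  refine (Finset.sum_eq_single μ' (fun ν _ hν => ?_)
    (fun h => absurd (Finset.mem_univ _) h)).trans ?_
  · split_ifs with h
    · simp
    · have hne : (ν : ℂ) ≠ μ := fun h => hν (Subtype.val_injective (h.trans hμ'.symm))
      rw [LinearMap.smul_apply]
      have h0 : (Module.End.eigenspace A (ν : ℂ)).starProjection v = 0 := by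
        apply (Submodule.starProjection_apply_eq_zero_iff _).2
        rw [Submodule.mem_orthogonal]
        intro u hu
        exact hA.orthogonalFamily_eigenspaces hne ⟨u, hu⟩
          ⟨v, Module.End.mem_eigenspace_iff.2 hv⟩
      exact (congrArg _ h0).trans (smul_zero _)
  · have hstar : (Module.End.eigenspace A (μ' : ℂ)).starProjection v = v :=
      Submodule.starProjection_eq_self_iff.2 (Module.End.mem_eigenspace_iff.2 (by rw [hμ', hv]))
    by_cases h : μ = 0
    · rw [if_pos (by rw [hμ', h, Complex.ofReal_zero]), if_pos h, zero_smul, LinearMap.zero_apply]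
    · have h' : (μ' : ℂ) ≠ 0 := by rw [hμ']; exact_mod_cast h
      rw [if_neg h', if_neg h, LinearMap.smul_apply]
      exact congrArg₂ (· • ·) (by rw [hμ']) hstar

theorem aeval_apply_of_eigenvector {A : E →ₗ[ℂ] E} {v : E} {μ : ℂ} (hv : A v = μ • v)
    (p : Polynomial ℂ) : (Polynomial.aeval A p) v = p.eval μ • v := by
  rcases eq_or_ne v 0 with rfl | hv0
  · simp
  exact Module.End.aeval_apply_of_hasEigenvector
    ⟨Module.End.mem_eigenspace_iff.2 hv, hv0⟩

theorem norm_apply_le_of_diagonal {ι : Type*} [Fintype ι] (b : OrthonormalBasis ι ℂ E)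
    {S : E →ₗ[ℂ] E} {d : ι → ℂ} (hS : ∀ i, S (b i) = d i • b i) {ε : ℝ} (hε : 0 ≤ ε)
    (hd : ∀ i, ‖d i‖ ≤ ε) (v : E) : ‖S v‖ ≤ ε * ‖v‖ := by
  have h1 : S v = ∑ i, (d i * b.repr v i) • b i := by
    conv_lhs => rw [← b.sum_repr v]
    rw [map_sum]
    refine Finset.sum_congr rfl fun i _ => ?_
    rw [map_smul, hS, smul_smul, mul_comm]
  have h2 : ∀ i, b.repr (S v) i = d i * b.repr v i := by
    classical
    intro i
    rw [h1, map_sum]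
    simp only [map_smul, b.repr_self]
    rw [WithLp.ofLp_sum, Finset.sum_apply, Finset.sum_eq_single i]
    · simp
    · intro j _ hj
      simp [hj.symm]
    · simp
  refine le_of_sq_le_sq ?_ (by positivity)
  rw [mul_pow, ← b.repr.norm_map (S v), ← b.repr.norm_map v, EuclideanSpace.norm_sq_eq,
    EuclideanSpace.norm_sq_eq, Finset.mul_sum]
  refine Finset.sum_le_sum fun i _ => ?_
  rw [h2, norm_mul, mul_pow]
  gcongr
  exact hd i

theorem trace_mul_diagonal {ι : Type*} [Fintype ι] (b : OrthonormalBasis ι ℂ E)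
    {S : E →ₗ[ℂ] E} {d : ι → ℂ} (hS : ∀ i, S (b i) = d i • b i) (X : E →ₗ[ℂ] E) :
    LinearMap.trace ℂ E (X ∘ₗ S) = ∑ i, inner ℂ (b i) (X (b i)) * d i := by
  rw [LinearMap.trace_eq_sum_inner _ b]
  refine Finset.sum_congr rfl fun i _ => ?_
  rw [LinearMap.comp_apply, hS, map_smul, inner_smul_right, mul_comm]

theorem norm_trace_mul_diagonal_le {ι : Type*} [Fintype ι] (b : OrthonormalBasis ι ℂ E)
    {S : E →ₗ[ℂ] E} {d : ι → ℝ} (hd : ∀ i, 0 ≤ d i) (hS : ∀ i, S (b i) = (d i : ℂ) • b i)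
    {X : E →ₗ[ℂ] E} {δ : ℝ} (hX : ∀ v, ‖X v‖ ≤ δ * ‖v‖) :
    ‖LinearMap.trace ℂ E (X ∘ₗ S)‖ ≤ δ * ∑ i, d i := by
  rw [trace_mul_diagonal b hS, Finset.mul_sum]
  refine norm_sum_le_of_le _ fun i _ => ?_
  rw [norm_mul, Complex.norm_real, Real.norm_eq_abs, abs_of_nonneg (hd i)]
  refine mul_le_mul_of_nonneg_right ?_ (hd i)
  refine (norm_inner_le_norm _ _).trans ?_
  have := hX (b i)
  simpa using this

theorem pow_apply_of_eigenvector {P : E →ₗ[ℂ] E} {v : E} {ρ : ℝ} (hv : P v = (ρ : ℂ) • v) (k : ℕ) :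
    (P ^ k) v = ((ρ ^ k : ℝ) : ℂ) • v := by
  have := aeval_apply_of_eigenvector hv (Polynomial.X ^ k)
  simpa using this

theorem norm_pow_sub_aeval_le {ι : Type*} [Fintype ι] (b : OrthonormalBasis ι ℂ E)
    {S : E →ₗ[ℂ] E} {d : ι → ℝ} (hS : ∀ i, S (b i) = (d i : ℂ) • b i)
    (hd : ∀ i, d i ∈ Set.Icc (0 : ℝ) 1) {k : ℕ} {q : Polynomial ℝ} {ε : ℝ} (hε : 0 ≤ ε)
    (hq : ∀ x ∈ Set.Icc (-1 : ℝ) 1, |x ^ k - q.eval x| ≤ ε) (v : E) :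
    ‖(S ^ k - Polynomial.aeval S (q.map (algebraMap ℝ ℂ))) v‖ ≤ ε * ‖v‖ := by
  refine norm_apply_le_of_diagonal b (d := fun i => ((d i ^ k - q.eval (d i) : ℝ) : ℂ))
    (fun i => ?_) hε (fun i => ?_) v
  · rw [LinearMap.sub_apply, pow_apply_of_eigenvector (hS i), aeval_apply_of_eigenvector (hS i),
      ← sub_smul]
    congr 1
    have : (q.map (algebraMap ℝ ℂ)).eval ((d i : ℝ) : ℂ) = ((q.eval (d i) : ℝ) : ℂ) := by
      rw [Polynomial.eval_map_algebraMap, ← Complex.coe_algebraMap,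
        Polynomial.aeval_algebraMap_apply]
      rfl
    rw [this]
    push_cast
    rfl
  · rw [Complex.norm_real, Real.norm_eq_abs]
    exact hq _ ⟨by linarith [(hd i).1], (hd i).2⟩

theorem norm_apply_of_comp_eq_id {J : E' →ₗ[ℂ] E} {R : E →ₗ[ℂ] E'}
    (hJR : ∀ x y, inner ℂ (J x) y = inner ℂ x (R y)) (hRJ : R ∘ₗ J = LinearMap.id) (x : E') :
    ‖J x‖ = ‖x‖ := by
  have h : inner ℂ (J x) (J x) = inner ℂ x x := by
    rw [hJR, ← LinearMap.comp_apply, hRJ, LinearMap.id_apply]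
  rw [inner_self_eq_norm_sq_to_K, inner_self_eq_norm_sq_to_K] at h
  have h2 : ‖J x‖ ^ 2 = ‖x‖ ^ 2 := by exact_mod_cast h
  exact (sq_eq_sq₀ (norm_nonneg _) (norm_nonneg _)).1 h2

/-- Comparison of the powers of two contractions `P`, `Q` that agree locally. Since `P ^ j` and
`Q ^ j` agree near the support of `Φ` for `j < m`, only the difference between a power and its
polynomial approximations of degree `< m` contributes; splitting the power into two factors, one
of them provides the small operator norm and the other one the trace norm. -/
theorem norm_trace_pow_sub_le [FiniteDimensional ℂ E]
    [FiniteDimensional ℂ E'] {ι ι' : Type*} [Fintype ι] [Fintype ι']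
    (b : OrthonormalBasis ι ℂ E) (b' : OrthonormalBasis ι' ℂ E')
    {P : E →ₗ[ℂ] E} {Q : E' →ₗ[ℂ] E'} (hPs : P.IsSymmetric) (hQs : Q.IsSymmetric)
    {ρ : ι → ℝ} {ρ' : ι' → ℝ}
    (hP : ∀ i, P (b i) = (ρ i : ℂ) • b i) (hQ : ∀ i, Q (b' i) = (ρ' i : ℂ) • b' i)
    (hρ : ∀ i, ρ i ∈ Set.Icc (0 : ℝ) 1) (hρ' : ∀ i, ρ' i ∈ Set.Icc (0 : ℝ) 1)
    {J : E' →ₗ[ℂ] E} {R : E →ₗ[ℂ] E'} (hJR : ∀ x y, inner ℂ (J x) y = inner ℂ x (R y))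
    (hRJ : R ∘ₗ J = LinearMap.id) {Φ : E →ₗ[ℂ] E} (hΦs : Φ.IsSymmetric)
    (hΦ : ∀ v, ‖Φ v‖ ≤ ‖v‖) {m : ℕ}
    (hloc : ∀ p : Polynomial ℂ, p.degree < m →
      (Polynomial.aeval P p) ∘ₗ Φ = J ∘ₗ (Polynomial.aeval Q p) ∘ₗ R ∘ₗ Φ)
    {k₁ k₂ : ℕ} {ε : ℝ} (hε : 0 ≤ ε)
    (hq : ∀ k ∈ ({k₁, k₂} : Set ℕ), ∃ q : Polynomial ℝ, q.degree < m ∧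
      ∀ x ∈ Set.Icc (-1 : ℝ) 1, |x ^ k - q.eval x| ≤ ε) :
    ‖LinearMap.trace ℂ E (Φ ∘ₗ (P ^ (k₁ + k₂) - J ∘ₗ (Q ^ (k₁ + k₂)) ∘ₗ R))‖ ≤
      2 * ε * (∑ i, ρ i ^ k₂ + ∑ i, ρ' i ^ k₁) := by
  have hJn := norm_apply_of_comp_eq_id hJR hRJ
  have hRn : ∀ y, ‖R y‖ ≤ ‖y‖ := by
    intro y
    have h : ‖R y‖ ^ 2 ≤ ‖R y‖ * ‖y‖ := by
      have h1 : inner ℂ (J (R y)) y = inner ℂ (R y) (R y) := hJR _ _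
      rw [inner_self_eq_norm_sq_to_K] at h1
      have h2 := norm_inner_le_norm (𝕜 := ℂ) (J (R y)) y
      rw [h1, hJn] at h2
      simpa using h2
    by_contra hlt
    push Not at hlt
    have : 0 < ‖R y‖ := lt_of_le_of_lt (norm_nonneg _) hlt
    nlinarith
  set X : ℕ → E →ₗ[ℂ] E := fun k => P ^ k - J ∘ₗ (Q ^ k) ∘ₗ R with hX
  have hXΦ : ∀ k ∈ ({k₁, k₂} : Set ℕ), ∀ v, ‖X k (Φ v)‖ ≤ 2 * ε * ‖v‖ := by
    intro k hk v
    obtain ⟨q, hqd, hqk⟩ := hq k hk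
    have hd : (q.map (algebraMap ℝ ℂ)).degree < m :=
      (Polynomial.degree_map_le).trans_lt hqd
    have h1 := LinearMap.congr_fun (hloc _ hd) v
    simp only [LinearMap.comp_apply] at h1
    have h2 : X k (Φ v) = (P ^ k - Polynomial.aeval P (q.map (algebraMap ℝ ℂ))) (Φ v) -
        J ((Q ^ k - Polynomial.aeval Q (q.map (algebraMap ℝ ℂ))) (R (Φ v))) := by
      simp only [hX, LinearMap.sub_apply, LinearMap.comp_apply, map_sub]
      rw [h1]
      abel
    rw [h2]
    refine (norm_sub_le _ _).trans ?_
    rw [hJn]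
    have h3 := norm_pow_sub_aeval_le b hP hρ hε hqk (Φ v)
    have h4 := norm_pow_sub_aeval_le b' hQ hρ' hε hqk (R (Φ v))
    have h5 := hΦ v
    have h6 := hRn (Φ v)
    nlinarith
  -- the bound of `Φ ∘ X k` follows by taking adjoints
  have hXs : ∀ k x y, inner ℂ (X k x) y = inner ℂ x (X k y) := by
    intro k x y
    have hP1 : inner ℂ ((P ^ k) x) y = inner ℂ x ((P ^ k) y) := hPs.pow k x y
    have hQ1 : ∀ x y, inner ℂ ((Q ^ k) x) y = inner ℂ x ((Q ^ k) y) := hQs.pow k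
    have hRJ' : ∀ x y, inner ℂ (R x) y = inner ℂ x (J y) := by
      intro x y
      rw [← inner_conj_symm, ← hJR, inner_conj_symm]
    simp only [hX, LinearMap.sub_apply, LinearMap.comp_apply, inner_sub_left, inner_sub_right]
    rw [hP1, hJR, hQ1, hRJ']
  have hΦX : ∀ k ∈ ({k₁, k₂} : Set ℕ), ∀ v, ‖Φ (X k v)‖ ≤ 2 * ε * ‖v‖ := by
    intro k hk v
    set u := Φ (X k v) with hu
    have h1 : inner ℂ u u = inner ℂ v (X k (Φ u)) := by
      conv_lhs => rw [hu]
      rw [hΦs (X k v) _, hXs]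
    have h2 : ‖u‖ ^ 2 ≤ ‖v‖ * (2 * ε * ‖u‖) := by
      have h3 := norm_inner_le_norm (𝕜 := ℂ) v (X k (Φ u))
      rw [← h1, inner_self_eq_norm_sq_to_K] at h3
      have h4 : ‖u‖ ^ 2 ≤ ‖v‖ * ‖X k (Φ u)‖ := by simpa using h3
      exact h4.trans (mul_le_mul_of_nonneg_left (hXΦ k hk u) (norm_nonneg _))
    by_contra hlt
    push Not at hlt
    have : 0 < ‖u‖ := lt_of_le_of_lt (by positivity) hlt
    nlinarith
  have hsplit : Φ ∘ₗ (P ^ (k₁ + k₂) - J ∘ₗ (Q ^ (k₁ + k₂)) ∘ₗ R) =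
      (Φ ∘ₗ X k₁) ∘ₗ (P ^ k₂) + (Φ ∘ₗ J) ∘ₗ ((Q ^ k₁) ∘ₗ R ∘ₗ X k₂) := by
    ext v
    have h1 : ∀ x, R (J x) = x := fun x => by rw [← LinearMap.comp_apply, hRJ, LinearMap.id_apply]
    simp only [hX, LinearMap.comp_apply, LinearMap.sub_apply, LinearMap.add_apply, pow_add,
      Module.End.mul_apply, map_sub, h1]
    abel
  rw [hsplit, map_add, mul_add]
  refine (norm_add_le _ _).trans (add_le_add ?_ ?_)
  · exact norm_trace_mul_diagonal_le b (fun i => pow_nonneg (hρ i).1 _)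
      (fun i => pow_apply_of_eigenvector (hP i) k₂) (hΦX k₁ (by simp))
  · have hcyc : LinearMap.trace ℂ E ((Φ ∘ₗ J) ∘ₗ ((Q ^ k₁) ∘ₗ R ∘ₗ X k₂)) =
        LinearMap.trace ℂ E' ((R ∘ₗ X k₂ ∘ₗ Φ ∘ₗ J) ∘ₗ (Q ^ k₁)) := by
      rw [← LinearMap.comp_assoc, LinearMap.trace_comp_comm' (R ∘ₗ X k₂) ((Φ ∘ₗ J) ∘ₗ (Q ^ k₁))]
      rfl
    rw [hcyc]
    refine norm_trace_mul_diagonal_le b' (fun i => pow_nonneg (hρ' i).1 _)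
      (fun i => pow_apply_of_eigenvector (hQ i) k₁) fun v => ?_
    simp only [LinearMap.comp_apply]
    refine (hRn _).trans ((hXΦ k₂ (by simp) _).trans ?_)
    rw [hJn]

end Trace

/-! ### Comparison of local zeta functions -/

section Compare

/-- Uniform spectral information on a non-negative self-adjoint operator: a spectral gap `c`, an
upper bound `Λ` of the spectrum, and a bound `C₀` of the trace of `(1 + A)⁻²`. -/
structure SpectralBounds {E : Type*} [NormedAddCommGroup E] [InnerProductSpace ℂ E]
    [FiniteDimensional ℂ E] (A : E →ₗ[ℂ] E) (c Λ C₀ : ℝ) : Prop where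
  isSymmetric : A.IsSymmetric
  gap : ∀ i, isSymmetric.eigenvalues rfl i = 0 ∨ c ≤ isSymmetric.eigenvalues rfl i
  le : ∀ i, isSymmetric.eigenvalues rfl i ≤ Λ
  sum_le : ∑ i, ((1 + isSymmetric.eigenvalues rfl i) ^ 2)⁻¹ ≤ C₀

/-- A power of the contraction `1 - A / (Λ N)` is bounded by the trace class operator
`(1 + A)⁻²`. The hypothesis `j ≤ N` takes care of the eigenvalue `0`. -/
theorem one_sub_div_pow_le {x Λ N : ℝ} (hΛ : 1 ≤ Λ) (hN : 1 ≤ N) (hx : 0 ≤ x)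
    (hxN : x ≤ Λ * N) {j : ℕ} (hj : (j : ℝ) ≤ N) :
    (1 - x / (Λ * N)) ^ j ≤
      2 * Real.exp 3 * Λ ^ 2 * (N / ((j : ℝ) + 1)) ^ 2 * ((1 + x) ^ 2)⁻¹ := by
  have hΛN : 1 ≤ Λ * N := by nlinarith
  set y := x / (Λ * N) with hy
  have hy0 : 0 ≤ y := by positivity
  have hy1 : y ≤ 1 := by rw [hy, div_le_one (by positivity)]; exact hxN
  set z : ℝ := ((j : ℝ) + 1) * ((1 + x) / (Λ * N)) with hz
  have hz0 : 0 < z := by positivity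
  have h1 : (1 - y) ^ j ≤ Real.exp (3 - z) := by
    have := Real.add_one_le_exp (-y)
    refine (pow_le_pow_left₀ (by linarith) (by linarith : 1 - y ≤ Real.exp (-y)) j).trans ?_
    rw [← Real.exp_nat_mul]
    apply Real.exp_le_exp.2
    have e : z = (j + 1) * y + (j + 1) / (Λ * N) := by rw [hz, hy]; ring
    have h2 : ((j : ℝ) + 1) / (Λ * N) ≤ 2 := by
      rw [div_le_iff₀ (by positivity)]
      nlinarith
    rw [e]
    linarith
  refine h1.trans ?_
  have h3 := Real.pow_div_factorial_le_exp (x := z) hz0.le 2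
  rw [Real.exp_sub]
  have h4 : (Real.exp z)⁻¹ ≤ 2 * (z ^ 2)⁻¹ := by
    rw [inv_le_comm₀ (Real.exp_pos _) (by positivity)]
    refine le_trans (le_of_eq ?_) h3
    rw [mul_inv, inv_inv]
    norm_num
    ring
  have h5 : (z ^ 2)⁻¹ = Λ ^ 2 * (N / ((j : ℝ) + 1)) ^ 2 * ((1 + x) ^ 2)⁻¹ := by
    rw [hz]
    field_simp
  rw [div_eq_mul_inv]
  calc _ ≤ Real.exp 3 * (2 * (z ^ 2)⁻¹) := by gcongr
    _ = _ := by rw [h5]; ring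

universe u

/-- Two uniformly spectrally bounded operators `A` and `B` with spectrum in `[0, Λ n²]`, which agree
locally up to `ε n` steps near the support of `Φ`, have nearly the same local zeta functions. -/
theorem exists_bound_trace_perpPower {r c Λ C₀ ε : ℝ} (hr : 0 ≤ r) (hc : 0 < c) (hΛ : 1 ≤ Λ)
    (hC₀ : 0 ≤ C₀) (hε : 0 < ε) :
    ∃ C : ℝ, ∀ {E E' : Type u} [NormedAddCommGroup E] [InnerProductSpace ℂ E]
      [FiniteDimensional ℂ E] [NormedAddCommGroup E'] [InnerProductSpace ℂ E']
      [FiniteDimensional ℂ E'] (A : E →ₗ[ℂ] E) (B : E' →ₗ[ℂ] E') (n : ℕ), 1 ≤ n →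
      SpectralBounds A c (Λ * n ^ 2) C₀ → SpectralBounds B c (Λ * n ^ 2) C₀ →
      ∀ (J : E' →ₗ[ℂ] E) (R : E →ₗ[ℂ] E'), (∀ x y, inner ℂ (J x) y = inner ℂ x (R y)) →
      R ∘ₗ J = LinearMap.id → ∀ Φ : E →ₗ[ℂ] E, Φ.IsSymmetric → (∀ v, ‖Φ v‖ ≤ ‖v‖) →
      ∀ m : ℕ, 1 ≤ m → ε * n ≤ m →
      (∀ p : Polynomial ℂ, p.degree < m →
        (Polynomial.aeval A p) ∘ₗ Φ = J ∘ₗ (Polynomial.aeval B p) ∘ₗ R ∘ₗ Φ) →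
      ∀ s : ℂ, ‖s‖ ≤ r →
        ‖LinearMap.trace ℂ E (Φ ∘ₗ (perpPower A (-s) - J ∘ₗ perpPower B (-s) ∘ₗ R))‖ ≤ C := by
  obtain ⟨M, hM⟩ := exists_nat_ge (r + 2)
  have hM2 : 2 ≤ M := by
    have : (2 : ℝ) ≤ M := by linarith
    exact_mod_cast this
  -- two powers of `k / N` beyond `M` compensate the growth `(N / k) ^ 2` of the traces
  set Ce : ℝ := 2 * (M + 2).factorial * (2 / ε ^ 2) ^ (M + 2) with hCe
  set Cp : ℝ := 2 * Real.exp 3 * Λ ^ 2 * C₀ * 4 with hCp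
  have hCe0 : 0 ≤ Ce := by positivity
  have hCp0 : 0 ≤ Cp := by positivity
  obtain ⟨C, hC⟩ := exists_bound_sum_cpow (R := r) hc hΛ (by positivity : 0 ≤ C₀ + C₀)
    (C₁ := 2 * Ce * (Cp + Cp)) (by positivity) (M := M) (by linarith) hM2
  refine ⟨C, ?_⟩
  intro E E' _ _ _ _ _ _ A B n hn hA hB J R hJR hRJ Φ hΦs hΦ m hm hεm hloc s hs
  set b := hA.isSymmetric.eigenvectorBasis rfl with hb
  set b' := hB.isSymmetric.eigenvectorBasis rfl with hb'
  set x := hA.isSymmetric.eigenvalues rfl with hx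
  set x' := hB.isSymmetric.eigenvalues rfl with hx'
  have hAb : ∀ i, A (b i) = (x i : ℂ) • b i := hA.isSymmetric.apply_eigenvectorBasis rfl
  have hBb : ∀ i, B (b' i) = (x' i : ℂ) • b' i := hB.isSymmetric.apply_eigenvectorBasis rfl
  have hx0 : ∀ i, 0 ≤ x i := fun i => by rcases hA.gap i with h | h <;> linarith
  have hx0' : ∀ i, 0 ≤ x' i := fun i => by rcases hB.gap i with h | h <;> linarith
  set N : ℕ := n ^ 2 with hN
  have hN1 : 1 ≤ N := Nat.one_le_pow _ _ hn
  have hN1' : (1 : ℝ) ≤ N := by exact_mod_cast hN1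
  have hΛN : 0 < Λ * N := by positivity
  have hxN : ∀ i, x i ≤ Λ * N := fun i => by simpa [hN] using hA.le i
  have hxN' : ∀ i, x' i ≤ Λ * N := fun i => by simpa [hN] using hB.le i
  -- the traces in terms of the eigenbases
  set w : Fin _ → ℝ := fun i => (inner ℂ (b i) (Φ (b i))).re with hw
  set w' : Fin _ → ℝ := fun i => (inner ℂ (b' i) ((R ∘ₗ Φ ∘ₗ J) (b' i))).re with hw'
  have hJn := norm_apply_of_comp_eq_id hJR hRJ
  have hw_eq : ∀ i, inner ℂ (b i) (Φ (b i)) = (w i : ℂ) := by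
    intro i
    have h := hΦs (b i) (b i)
    rw [← inner_conj_symm] at h
    exact (Complex.conj_eq_iff_re.1 h).symm
  have hJΦ : ∀ i, inner ℂ (b' i) ((R ∘ₗ Φ ∘ₗ J) (b' i)) =
      inner ℂ (J (b' i)) (Φ (J (b' i))) := fun i => by rw [hJR]; rfl
  have hw_eq' : ∀ i, inner ℂ (b' i) ((R ∘ₗ Φ ∘ₗ J) (b' i)) = (w' i : ℂ) := by
    intro i
    have h := hΦs (J (b' i)) (J (b' i))
    rw [← inner_conj_symm] at h
    have h2 := (Complex.conj_eq_iff_re.1 h).symm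
    rw [← hJΦ] at h2
    exact h2
  have hw1 : ∀ i, |w i| ≤ 1 := by
    intro i
    refine (Complex.abs_re_le_norm _).trans ((norm_inner_le_norm _ _).trans ?_)
    have := hΦ (b i)
    simpa using this
  have hw1' : ∀ i, |w' i| ≤ 1 := by
    intro i
    rw [hw']
    simp only [hJΦ]
    refine (Complex.abs_re_le_norm _).trans ((norm_inner_le_norm _ _).trans ?_)
    have := hΦ (J (b' i))
    rw [hJn] at this ⊢
    simpa using this
  have htrace : ∀ (S : E →ₗ[ℂ] E) (S' : E' →ₗ[ℂ] E') (f : ℝ → ℂ),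
      (∀ i, S (b i) = f (x i) • b i) → (∀ i, S' (b' i) = f (x' i) • b' i) →
      LinearMap.trace ℂ E (Φ ∘ₗ (S - J ∘ₗ S' ∘ₗ R)) =
        ∑ i, ((Sum.elim w (fun j => -w' j) i : ℝ) : ℂ) * f (Sum.elim x x' i) := by
    intro S S' f hS hS'
    have h1 : LinearMap.trace ℂ E (Φ ∘ₗ J ∘ₗ S' ∘ₗ R) =
        LinearMap.trace ℂ E' ((R ∘ₗ Φ ∘ₗ J) ∘ₗ S') := by
      have := LinearMap.trace_comp_comm' (R := ℂ) R (Φ ∘ₗ J ∘ₗ S')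
      exact this
    rw [LinearMap.comp_sub, map_sub, h1, trace_mul_diagonal b hS, trace_mul_diagonal b' hS',
      Fintype.sum_sum_type]
    simp only [hw_eq, hw_eq', Sum.elim_inl, Sum.elim_inr, Complex.ofReal_neg, neg_mul,
      Finset.sum_neg_distrib, sub_eq_add_neg]
  have hpow := htrace (perpPower A (-s)) (perpPower B (-s))
    (fun μ => if μ = 0 then 0 else (μ : ℂ) ^ (-s))
    (fun i => perpPower_apply_of_eigenvector hA.isSymmetric _ (hAb i))
    (fun i => perpPower_apply_of_eigenvector hB.isSymmetric _ (hBb i))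
  rw [hpow]
  -- the contractions
  set a : ℂ := ((Λ * N : ℝ) : ℂ)⁻¹ with ha
  set P : E →ₗ[ℂ] E := 1 - a • A with hP
  set Q : E' →ₗ[ℂ] E' := 1 - a • B with hQ
  have hPb : ∀ i, P (b i) = ((1 - x i / (Λ * N) : ℝ) : ℂ) • b i := by
    intro i
    rw [hP, LinearMap.sub_apply, LinearMap.smul_apply, hAb, Module.End.one_apply, ha, smul_smul,
      Complex.ofReal_sub, sub_smul, Complex.ofReal_one, one_smul]
    congr 2
    push_cast
    rw [div_eq_mul_inv, mul_comm]
  have hQb : ∀ i, Q (b' i) = ((1 - x' i / (Λ * N) : ℝ) : ℂ) • b' i := by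
    intro i
    rw [hQ, LinearMap.sub_apply, LinearMap.smul_apply, hBb, Module.End.one_apply, ha, smul_smul,
      Complex.ofReal_sub, sub_smul, Complex.ofReal_one, one_smul]
    congr 2
    push_cast
    rw [div_eq_mul_inv, mul_comm]
  have hareal : (starRingEnd ℂ) a = a := by rw [ha, map_inv₀, Complex.conj_ofReal]
  have hPs : P.IsSymmetric := LinearMap.IsSymmetric.sub LinearMap.IsSymmetric.one
    (hA.isSymmetric.smul hareal)
  have hQs : Q.IsSymmetric := LinearMap.IsSymmetric.sub LinearMap.IsSymmetric.one
    (hB.isSymmetric.smul hareal)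
  have hρ : ∀ i, 1 - x i / (Λ * N) ∈ Set.Icc (0 : ℝ) 1 := fun i =>
    ⟨sub_nonneg.2 ((div_le_one hΛN).2 (hxN i)), sub_le_self _ (div_nonneg (hx0 i) hΛN.le)⟩
  have hρ' : ∀ i, 1 - x' i / (Λ * N) ∈ Set.Icc (0 : ℝ) 1 := fun i =>
    ⟨sub_nonneg.2 ((div_le_one hΛN).2 (hxN' i)), sub_le_self _ (div_nonneg (hx0' i) hΛN.le)⟩
  have hlocP : ∀ p : Polynomial ℂ, p.degree < m →
      (Polynomial.aeval P p) ∘ₗ Φ = J ∘ₗ (Polynomial.aeval Q p) ∘ₗ R ∘ₗ Φ := by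
    intro p hp
    set g : Polynomial ℂ := 1 - Polynomial.C a * Polynomial.X with hg
    have hgA : Polynomial.aeval A g = P := by
      rw [hg, map_sub, map_one, map_mul, Polynomial.aeval_X, Polynomial.aeval_C, hP,
        Algebra.smul_def]
    have hgB : Polynomial.aeval B g = Q := by
      rw [hg, map_sub, map_one, map_mul, Polynomial.aeval_X, Polynomial.aeval_C, hQ,
        Algebra.smul_def]
    rw [← hgA, ← hgB, ← Polynomial.aeval_comp, ← Polynomial.aeval_comp]
    apply hloc
    have hg1 : g.natDegree ≤ 1 := by
      rw [hg]; compute_degree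
    rcases eq_or_ne p 0 with rfl | hp0
    · simp
    · refine Polynomial.degree_le_natDegree.trans_lt ?_
      have h1 := Polynomial.natDegree_comp_le (p := p) (q := g)
      have h2 : p.natDegree < m := (Polynomial.natDegree_lt_iff_degree_lt hp0).2 hp
      have h3 : (p.comp g).natDegree < m := by nlinarith
      exact_mod_cast h3
  -- the power `k` is split into two halves `k₁`, `k₂`
  have hD : ∀ k : ℕ, k ≤ N →
      |∑ i, Sum.elim w (fun j => -w' j) i * (1 - Sum.elim x x' i / (Λ * N)) ^ k| ≤
        2 * (2 * (M + 2).factorial * (2 * k / m ^ 2) ^ (M + 2)) *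
          ((Cp + Cp) * (N / (k + 1)) ^ 2) := by
    intro k hk
    have hk' : (k : ℝ) ≤ N := by exact_mod_cast hk
    obtain ⟨k₁, k₂, rfl, h12, h21⟩ : ∃ k₁ k₂ : ℕ, k = k₁ + k₂ ∧ k ≤ 2 * k₁ + 1 ∧ k ≤ 2 * k₂ + 1 :=
      ⟨k / 2, k - k / 2, by omega, by omega, by omega⟩
    have h1 := norm_trace_pow_sub_le b b' hPs hQs hPb hQb hρ hρ' hJR hRJ hΦs hΦ hlocP
      (k₁ := k₁) (k₂ := k₂)
      (ε := 2 * (M + 2).factorial * (2 * ((k₁ + k₂ : ℕ) : ℝ) / m ^ 2) ^ (M + 2)) (by positivity) (by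
        intro k hkmem
        obtain ⟨q, hq1, hq2⟩ := exists_polynomial_approx_pow k m (M + 2) hm
        refine ⟨q, hq1, fun y hy => (hq2 y hy).trans ?_⟩
        have : (k : ℝ) ≤ ((k₁ + k₂ : ℕ) : ℝ) := by
          have : k ≤ k₁ + k₂ := by
            simp only [Set.mem_insert_iff, Set.mem_singleton_iff] at hkmem
            omega
          exact_mod_cast this
        gcongr)
    have h2 := htrace (P ^ (k₁ + k₂)) (Q ^ (k₁ + k₂))
      (fun y => (((1 - y / (Λ * N)) ^ (k₁ + k₂) : ℝ) : ℂ))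
      (fun i => pow_apply_of_eigenvector (hPb i) _) (fun i => pow_apply_of_eigenvector (hQb i) _)
    rw [h2] at h1
    have h3 : ∑ i, ((Sum.elim w (fun j => -w' j) i : ℝ) : ℂ) *
        (((1 - Sum.elim x x' i / (Λ * N)) ^ (k₁ + k₂) : ℝ) : ℂ) =
        ((∑ i, Sum.elim w (fun j => -w' j) i *
          (1 - Sum.elim x x' i / (Λ * N)) ^ (k₁ + k₂) : ℝ) : ℂ) := by
      push_cast; rfl
    rw [h3, Complex.norm_real, Real.norm_eq_abs] at h1
    refine h1.trans (mul_le_mul_of_nonneg_left ?_ (by positivity))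
    have key : ∀ {l : ℕ} (y : Fin l → ℝ), (∀ i, 0 ≤ y i) → (∀ i, y i ≤ Λ * N) →
        ∑ i, ((1 + y i) ^ 2)⁻¹ ≤ C₀ → ∀ j : ℕ, j ≤ k₁ + k₂ → k₁ + k₂ ≤ 2 * j + 1 →
        ∑ i, (1 - y i / (Λ * N)) ^ j ≤ Cp * (N / (((k₁ + k₂ : ℕ) : ℝ) + 1)) ^ 2 := by
      intro l y hy0 hyN hy j hj1 hj2
      have hj : (j : ℝ) ≤ N := by exact_mod_cast hj1.trans hk
      refine (Finset.sum_le_sum fun i _ =>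
        one_sub_div_pow_le hΛ hN1' (hy0 i) (hyN i) hj).trans ?_
      rw [← Finset.mul_sum]
      have hjj : (N : ℝ) / (j + 1) ≤ 2 * (N / (((k₁ + k₂ : ℕ) : ℝ) + 1)) := by
        rw [mul_div_assoc', div_le_div_iff₀ (by positivity) (by positivity)]
        have : (((k₁ + k₂ : ℕ) : ℝ) + 1) ≤ 2 * (j + 1) := by
          have : k₁ + k₂ + 1 ≤ 2 * (j + 1) := by omega
          exact_mod_cast this
        nlinarith
      calc _ ≤ 2 * Real.exp 3 * Λ ^ 2 * (2 * (N / (((k₁ + k₂ : ℕ) : ℝ) + 1))) ^ 2 * C₀ := by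
            gcongr
        _ = _ := by rw [hCp]; ring
    rw [add_mul]
    exact add_le_add (key x hx0 hxN hA.sum_le k₂ (by omega) h21)
      (key x' hx0' hxN' hB.sum_le k₁ (by omega) h12)
  refine hC (Sum.elim w (fun j => -w' j)) (Sum.elim x x') N hN1 ?_ ?_ ?_ ?_ ?_ ?_ s hs
  · rintro (i | i)
    · exact hw1 i
    · simpa using hw1' i
  · rintro (i | i)
    · exact hA.gap i
    · exact hB.gap i
  · rintro (i | i)
    · exact hxN i
    · exact hxN' i
  · rw [Fintype.sum_sum_type]
    exact add_le_add hA.sum_le hB.sum_le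
  · have := hD 0 (Nat.zero_le _)
    simpa using this
  · intro k hk hkN
    refine (hD k hkN).trans ?_
    have hk0 : (0 : ℝ) < k := by exact_mod_cast hk
    have hn0 : (0 : ℝ) < n := by exact_mod_cast hn
    have hm0 : (0 : ℝ) < m := by exact_mod_cast hm
    have h1 : 2 * (k : ℝ) / m ^ 2 ≤ 2 / ε ^ 2 * (k / N) := by
      have : ε ^ 2 * N ≤ (m : ℝ) ^ 2 := by
        rw [hN]; push_cast
        rw [← mul_pow]
        exact pow_le_pow_left₀ (by positivity) hεm 2
      rw [div_mul_div_comm]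
      exact div_le_div_of_nonneg_left (by positivity) (by positivity) this
    calc _ ≤ 2 * (2 * (M + 2).factorial * (2 / ε ^ 2 * (k / N)) ^ (M + 2)) *
          ((Cp + Cp) * (N / k) ^ 2) := by
          gcongr
          linarith
      _ = 2 * Ce * (Cp + Cp) * (k / N) ^ M * ((k / N) * (N / k)) ^ 2 := by
          rw [hCe]; ring
      _ = _ := by
          have : (k : ℝ) / N * (N / k) = 1 := by field_simp
          rw [this]; ring

end Compare

/-! ### Poincaré and trace inequalities on a grid -/

section Poincare

variable {E : Type*} [NormedAddCommGroup E]

/-- Two points of one block of length `l` are joined by a path of length `< l` in this block. -/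
theorem norm_sub_sq_le_of_div_eq (g : ℕ → E) {n l i a a' : ℕ} (hl : 1 ≤ l) (ha : a < n)
    (ha' : a' < n) (hai : a / l = i) (hai' : a' / l = i) :
    ‖g a - g a'‖ ^ 2 ≤ ((l : ℝ) - 1) *
      ∑ c ∈ (Finset.range (n - 1)).filter (fun c => c / l = i), ‖g (c + 1) - g c‖ ^ 2 := by
  wlog h : a ≤ a' generalizing a a'
  · rw [norm_sub_rev]
    exact this ha' ha hai' hai (by omega)
  have h1 : g a' - g a = ∑ c ∈ Finset.Ico a a', (g (c + 1) - g c) := by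
    rw [Finset.sum_Ico_sub _ h]
  have hsub : Finset.Ico a a' ⊆ (Finset.range (n - 1)).filter (fun c => c / l = i) := by
    intro c hc
    rw [Finset.mem_Ico] at hc
    rw [Finset.mem_filter, Finset.mem_range]
    refine ⟨by omega, le_antisymm ?_ ?_⟩
    · rw [← hai']; exact Nat.div_le_div_right (by omega)
    · rw [← hai]; exact Nat.div_le_div_right (by omega)
  have hlen : a' - a + 1 ≤ l := by
    have h2 := Nat.div_add_mod a l
    have h3 := Nat.div_add_mod a' l
    have h4 := Nat.mod_lt a' hl
    rw [hai] at h2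
    rw [hai'] at h3
    omega
  have hlen' : ((a' - a : ℕ) : ℝ) ≤ (l : ℝ) - 1 := by
    have : ((a' - a + 1 : ℕ) : ℝ) ≤ l := by exact_mod_cast hlen
    push_cast at this
    linarith
  rw [norm_sub_rev, h1]
  calc ‖∑ c ∈ Finset.Ico a a', (g (c + 1) - g c)‖ ^ 2
      ≤ (∑ c ∈ Finset.Ico a a', ‖g (c + 1) - g c‖) ^ 2 :=
        pow_le_pow_left₀ (norm_nonneg _) (norm_sum_le _ _) 2
    _ ≤ ((Finset.Ico a a').card : ℝ) * ∑ c ∈ Finset.Ico a a', ‖g (c + 1) - g c‖ ^ 2 :=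
        sq_sum_le_card_mul_sum_sq
    _ ≤ _ := by
        rw [Nat.card_Ico]
        have : (0 : ℝ) ≤ ((a' - a : ℕ) : ℝ) := by positivity
        refine mul_le_mul hlen' ?_ (Finset.sum_nonneg fun _ _ => by positivity) (by linarith)
        exact Finset.sum_le_sum_of_subset_of_nonneg hsub fun _ _ _ => by positivity

/-- The horizontal part of the Dirichlet energy of a function on an `n × n` grid. -/
def gridEnergyH (n : ℕ) (g : ℕ → ℕ → E) : ℝ :=
  ∑ b ∈ Finset.range n, ∑ c ∈ Finset.range (n - 1), ‖g (c + 1) b - g c b‖ ^ 2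

/-- The vertical part of the Dirichlet energy of a function on an `n × n` grid. -/
def gridEnergyV (n : ℕ) (g : ℕ → ℕ → E) : ℝ :=
  ∑ a ∈ Finset.range n, ∑ c ∈ Finset.range (n - 1), ‖g a (c + 1) - g a c‖ ^ 2

variable [NormedSpace ℂ E]

/-- A pointwise Poincaré inequality on a product `S × S'` for a function of mean zero. -/
theorem card_mul_norm_sq_le {S S' : Finset ℕ} (g : ℕ → ℕ → E) {L : ℝ} {H V : ℕ → ℝ}
    (hH : ∀ b ∈ S', ∀ a ∈ S, ∀ a' ∈ S, ‖g a b - g a' b‖ ^ 2 ≤ L * H b)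
    (hV : ∀ a ∈ S, ∀ b ∈ S', ∀ b' ∈ S', ‖g a b - g a b'‖ ^ 2 ≤ L * V a)
    (h0 : ∑ a ∈ S, ∑ b ∈ S', g a b = 0) {a b : ℕ} (ha : a ∈ S) (hb : b ∈ S') :
    (S.card : ℝ) * ‖g a b‖ ^ 2 ≤ 2 * L * (S.card * H b + ∑ a' ∈ S, V a') := by
  have hc : (0 : ℝ) < S.card := by exact_mod_cast Finset.card_pos.2 ⟨a, ha⟩
  have hc' : (0 : ℝ) < S'.card := by exact_mod_cast Finset.card_pos.2 ⟨b, hb⟩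
  have hcard : (((S ×ˢ S').card : ℕ) : ℝ) = S.card * S'.card := by
    rw [Finset.card_product]; push_cast; rfl
  have h1 : ((S ×ˢ S').card : ℝ) * ‖g a b‖ ≤ ∑ p ∈ S ×ˢ S', ‖g a b - g p.1 p.2‖ := by
    have : ∑ p ∈ S ×ˢ S', (g a b - g p.1 p.2) = (S ×ˢ S').card • g a b := by
      rw [Finset.sum_sub_distrib, Finset.sum_const, Finset.sum_product, h0, sub_zero]
    have h2 := norm_sum_le (S ×ˢ S') (fun p => g a b - g p.1 p.2)
    rw [this] at h2
    rwa [RCLike.norm_nsmul ℂ, nsmul_eq_mul] at h2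
  have h2 : ((S ×ˢ S').card : ℝ) * ‖g a b‖ ^ 2 ≤ ∑ p ∈ S ×ˢ S', ‖g a b - g p.1 p.2‖ ^ 2 := by
    have h3 := sq_sum_le_card_mul_sum_sq (s := S ×ˢ S') (f := fun p => ‖g a b - g p.1 p.2‖)
    have h4 := pow_le_pow_left₀ (by positivity) h1 2
    have hcp : (0 : ℝ) < ((S ×ˢ S').card : ℝ) := by rw [hcard]; positivity
    have h5 := h4.trans h3
    rw [mul_pow, sq ((S ×ˢ S').card : ℝ), mul_assoc] at h5
    exact le_of_mul_le_mul_left h5 hcp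
  have h3 : ∑ p ∈ S ×ˢ S', ‖g a b - g p.1 p.2‖ ^ 2 ≤
      S'.card * (2 * L * (S.card * H b + ∑ a' ∈ S, V a')) := by
    have : ∀ p ∈ S ×ˢ S', ‖g a b - g p.1 p.2‖ ^ 2 ≤ 2 * L * H b + 2 * L * V p.1 := by
      intro p hp
      obtain ⟨hp1, hp2⟩ := Finset.mem_product.1 hp
      have e : g a b - g p.1 p.2 = (g a b - g p.1 b) + (g p.1 b - g p.1 p.2) := by abel
      have h6 := hH b hb a ha p.1 hp1
      have h7 := hV p.1 hp1 b hb p.2 hp2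
      rw [e]
      have h8 := norm_add_le (g a b - g p.1 b) (g p.1 b - g p.1 p.2)
      have h9 := pow_le_pow_left₀ (norm_nonneg _) h8 2
      nlinarith [sq_nonneg (‖g a b - g p.1 b‖ - ‖g p.1 b - g p.1 p.2‖)]
    refine (Finset.sum_le_sum this).trans (le_of_eq ?_)
    rw [Finset.sum_product]
    simp only [Finset.sum_const, nsmul_eq_mul]
    rw [← Finset.mul_sum, Finset.sum_add_distrib, Finset.sum_const, nsmul_eq_mul, ← Finset.mul_sum]
    ring
  have h4 := h2.trans h3
  rw [hcard, mul_comm (S.card : ℝ), mul_assoc] at h4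
  exact le_of_mul_le_mul_left h4 hc'

theorem card_filter_div_le (n : ℕ) {l : ℕ} (hl : 1 ≤ l) (i : ℕ) :
    ((Finset.range n).filter (fun a => a / l = i)).card ≤ l := by
  have : (Finset.range n).filter (fun a => a / l = i) ⊆ Finset.Ico (l * i) (l * i + l) := by
    intro a ha
    have h := (Finset.mem_filter.1 ha).2
    have h2 := Nat.div_add_mod a l
    have h4 := Nat.mod_lt a hl
    rw [h] at h2
    rw [Finset.mem_Ico]
    omega
  simpa using Finset.card_le_card this

theorem sum_range_fiber_div {M : Type*} [AddCommMonoid M] (n l : ℕ) (f : ℕ → M) {k : ℕ}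
    (hk : k ≤ n) :
    ∑ i ∈ Finset.range n, ∑ a ∈ (Finset.range k).filter (fun a => a / l = i), f a =
      ∑ a ∈ Finset.range k, f a :=
  Finset.sum_fiberwise_of_maps_to (fun a ha => by
    rw [Finset.mem_range] at ha ⊢
    exact lt_of_le_of_lt (Nat.div_le_self a l) (by omega)) f

/-- Poincaré inequality for a function on a grid whose sum over each block of size `l × l`
vanishes. For `l = 1` the factor `l - 1` makes the right hand side zero. -/
theorem sum_norm_sq_le_of_block_sum_eq_zero (g : ℕ → ℕ → E) (n : ℕ) {l : ℕ} (hl : 1 ≤ l)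
    (h0 : ∀ i j, ∑ a ∈ (Finset.range n).filter (fun a => a / l = i),
      ∑ b ∈ (Finset.range n).filter (fun b => b / l = j), g a b = 0) :
    ∑ a ∈ Finset.range n, ∑ b ∈ Finset.range n, ‖g a b‖ ^ 2 ≤
      2 * ((l : ℝ) - 1) * l * (gridEnergyH n g + gridEnergyV n g) := by
  set S : ℕ → Finset ℕ := fun i => (Finset.range n).filter (fun a => a / l = i) with hS
  set T : ℕ → Finset ℕ := fun i => (Finset.range (n - 1)).filter (fun a => a / l = i) with hT
  set L : ℝ := (l : ℝ) - 1 with hL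
  have hL0 : 0 ≤ L := by
    have : (1 : ℝ) ≤ l := by exact_mod_cast hl
    linarith
  set H : ℕ → ℕ → ℝ := fun i b => ∑ c ∈ T i, ‖g (c + 1) b - g c b‖ ^ 2 with hH
  set V : ℕ → ℕ → ℝ := fun j a => ∑ c ∈ T j, ‖g a (c + 1) - g a c‖ ^ 2 with hV
  have hH0 : ∀ i b, 0 ≤ H i b := fun i b => Finset.sum_nonneg fun _ _ => by positivity
  have hV0 : ∀ i b, 0 ≤ V i b := fun i b => Finset.sum_nonneg fun _ _ => by positivity
  have hcard : ∀ i, ((S i).card : ℝ) ≤ l := fun i => by exact_mod_cast card_filter_div_le n hl i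
  have hblock : ∀ i j, ∑ a ∈ S i, ∑ b ∈ S j, ‖g a b‖ ^ 2 ≤
      2 * L * l * (∑ b ∈ S j, H i b + ∑ a ∈ S i, V j a) := by
    intro i j
    rcases (S i).eq_empty_or_nonempty with he | hne
    · simp only [he, Finset.sum_empty, add_zero]
      have : 0 ≤ ∑ b ∈ S j, H i b := Finset.sum_nonneg fun b _ => hH0 i b
      positivity
    have hc : (0 : ℝ) < (S i).card := by exact_mod_cast Finset.card_pos.2 hne
    have key : ∀ a ∈ S i, ∀ b ∈ S j, ((S i).card : ℝ) * ‖g a b‖ ^ 2 ≤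
        2 * L * ((S i).card * H i b + ∑ a' ∈ S i, V j a') := by
      intro a ha b hb
      refine card_mul_norm_sq_le g ?_ ?_ (h0 i j) ha hb
      · intro b hb a ha a' ha'
        have ha := Finset.mem_filter.1 ha
        have ha' := Finset.mem_filter.1 ha'
        exact norm_sub_sq_le_of_div_eq (fun c => g c b) hl (Finset.mem_range.1 ha.1)
          (Finset.mem_range.1 ha'.1) ha.2 ha'.2
      · intro a ha b hb b' hb'
        have hb := Finset.mem_filter.1 hb
        have hb' := Finset.mem_filter.1 hb'
        exact norm_sub_sq_le_of_div_eq (fun c => g a c) hl (Finset.mem_range.1 hb.1)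
          (Finset.mem_range.1 hb'.1) hb.2 hb'.2
    have hsum : ((S i).card : ℝ) * ∑ a ∈ S i, ∑ b ∈ S j, ‖g a b‖ ^ 2 ≤
        ((S i).card : ℝ) * (2 * L * ((S i).card * ∑ b ∈ S j, H i b +
          (S j).card * ∑ a ∈ S i, V j a)) := by
      calc ((S i).card : ℝ) * ∑ a ∈ S i, ∑ b ∈ S j, ‖g a b‖ ^ 2
          = ∑ a ∈ S i, ∑ b ∈ S j, ((S i).card : ℝ) * ‖g a b‖ ^ 2 := by
            rw [Finset.mul_sum]
            exact Finset.sum_congr rfl fun _ _ => Finset.mul_sum _ _ _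
        _ ≤ ∑ a ∈ S i, ∑ b ∈ S j, 2 * L * ((S i).card * H i b + ∑ a' ∈ S i, V j a') :=
            Finset.sum_le_sum fun a ha => Finset.sum_le_sum fun b hb => key a ha b hb
        _ = _ := by
            rw [Finset.sum_const, nsmul_eq_mul, ← Finset.mul_sum, Finset.sum_add_distrib,
              Finset.sum_const, nsmul_eq_mul, ← Finset.mul_sum]
    refine (le_of_mul_le_mul_left hsum hc).trans ?_
    have h1 : 0 ≤ ∑ b ∈ S j, H i b := Finset.sum_nonneg fun b _ => hH0 i b
    have h2 : 0 ≤ ∑ a ∈ S i, V j a := Finset.sum_nonneg fun b _ => hV0 j b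
    have h3 := mul_le_mul_of_nonneg_right (hcard i) h1
    have h4 := mul_le_mul_of_nonneg_right (hcard j) h2
    have h5 : ((S i).card : ℝ) * ∑ b ∈ S j, H i b + (S j).card * ∑ a ∈ S i, V j a ≤
        l * (∑ b ∈ S j, H i b + ∑ a ∈ S i, V j a) := by rw [mul_add]; linarith
    calc _ ≤ 2 * L * (l * (∑ b ∈ S j, H i b + ∑ a ∈ S i, V j a)) := by gcongr
      _ = _ := by ring
  have e1 : ∑ a ∈ Finset.range n, ∑ b ∈ Finset.range n, ‖g a b‖ ^ 2 =
      ∑ i ∈ Finset.range n, ∑ j ∈ Finset.range n, ∑ a ∈ S i, ∑ b ∈ S j, ‖g a b‖ ^ 2 := by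
    refine (sum_range_fiber_div n l (fun a => ∑ b ∈ Finset.range n, ‖g a b‖ ^ 2)
      le_rfl).symm.trans (Finset.sum_congr rfl fun i _ => ?_)
    rw [Finset.sum_comm (s := Finset.range n) (t := S i)]
    exact Finset.sum_congr rfl fun a _ =>
      (sum_range_fiber_div n l (fun b => ‖g a b‖ ^ 2) le_rfl).symm
  have e2 : ∑ i ∈ Finset.range n, ∑ j ∈ Finset.range n, ∑ b ∈ S j, H i b =
      gridEnergyH n g := by
    rw [Finset.sum_comm]
    simp_rw [Finset.sum_comm (s := Finset.range n) (t := S _)]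
    rw [sum_range_fiber_div n l _ le_rfl, gridEnergyH]
    refine Finset.sum_congr rfl fun b _ => ?_
    exact sum_range_fiber_div n l _ (Nat.sub_le _ _)
  have e3 : ∑ i ∈ Finset.range n, ∑ j ∈ Finset.range n, ∑ a ∈ S i, V j a =
      gridEnergyV n g := by
    simp_rw [Finset.sum_comm (s := Finset.range n) (t := S _)]
    rw [sum_range_fiber_div n l _ le_rfl, gridEnergyV]
    refine Finset.sum_congr rfl fun b _ => ?_
    exact sum_range_fiber_div n l _ (Nat.sub_le _ _)
  rw [e1]
  refine (Finset.sum_le_sum fun i _ => Finset.sum_le_sum fun j _ => hblock i j).trans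
    (le_of_eq ?_)
  simp_rw [← Finset.mul_sum, Finset.sum_add_distrib]
  rw [e2, e3]

/-- Trace inequality: the values of a function of mean zero on a column of the grid. -/
theorem sum_column_norm_sq_le (g : ℕ → ℕ → E) {n : ℕ}
    (h0 : ∑ a ∈ Finset.range n, ∑ b ∈ Finset.range n, g a b = 0) {a : ℕ} (ha : a < n) :
    ∑ b ∈ Finset.range n, ‖g a b‖ ^ 2 ≤ 2 * n * (gridEnergyH n g + gridEnergyV n g) := by
  have hn0 : (0 : ℝ) < n := by exact_mod_cast (by omega : 0 < n)
  have hf : ∀ k, k ≤ n → (Finset.range k).filter (fun c => c / n = 0) = Finset.range k := by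
    intro k hk
    refine Finset.filter_true_of_mem fun c hc => Nat.div_eq_of_lt ?_
    have := Finset.mem_range.1 hc
    omega
  have hpath : ∀ f : ℕ → E, ∀ c ∈ Finset.range n, ∀ c' ∈ Finset.range n,
      ‖f c - f c'‖ ^ 2 ≤ n * ∑ d ∈ Finset.range (n - 1), ‖f (d + 1) - f d‖ ^ 2 := by
    intro f c hc c' hc'
    rw [Finset.mem_range] at hc hc'
    have h := norm_sub_sq_le_of_div_eq f (by omega : 1 ≤ n) hc hc' (Nat.div_eq_of_lt hc)
      (Nat.div_eq_of_lt hc')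
    rw [hf _ (Nat.sub_le _ _)] at h
    refine h.trans (mul_le_mul_of_nonneg_right (by linarith) ?_)
    exact Finset.sum_nonneg fun _ _ => by positivity
  have key : ∀ b ∈ Finset.range n, (n : ℝ) * ‖g a b‖ ^ 2 ≤ 2 * n *
      (n * (∑ d ∈ Finset.range (n - 1), ‖g (d + 1) b - g d b‖ ^ 2) + gridEnergyV n g) := by
    intro b hb
    have := card_mul_norm_sq_le g (S := Finset.range n) (S' := Finset.range n) (L := n)
      (H := fun b => ∑ d ∈ Finset.range (n - 1), ‖g (d + 1) b - g d b‖ ^ 2)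
      (V := fun a => ∑ d ∈ Finset.range (n - 1), ‖g a (d + 1) - g a d‖ ^ 2)
      (fun b _ => hpath fun c => g c b) (fun a _ => hpath (g a)) h0 (Finset.mem_range.2 ha) hb
    rwa [Finset.card_range] at this
  have h1 := Finset.sum_le_sum key
  rw [← Finset.mul_sum, ← Finset.mul_sum, Finset.sum_add_distrib, ← Finset.mul_sum,
    Finset.sum_const, Finset.card_range, nsmul_eq_mul, ← mul_add] at h1
  have h2 : (n : ℝ) * ∑ b ∈ Finset.range n, ‖g a b‖ ^ 2 ≤
      n * (2 * n * (gridEnergyH n g + gridEnergyV n g)) := by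
    refine h1.trans (le_of_eq ?_)
    rw [gridEnergyH]
    ring
  exact le_of_mul_le_mul_left h2 hn0

/-- Trace inequality: the values of a function of mean zero on a row of the grid. -/
theorem sum_row_norm_sq_le (g : ℕ → ℕ → E) {n : ℕ}
    (h0 : ∑ a ∈ Finset.range n, ∑ b ∈ Finset.range n, g a b = 0) {b : ℕ} (hb : b < n) :
    ∑ a ∈ Finset.range n, ‖g a b‖ ^ 2 ≤ 2 * n * (gridEnergyH n g + gridEnergyV n g) := by
  have h := sum_column_norm_sq_le (fun a b => g b a) (by rw [Finset.sum_comm]; exact h0) hb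
  rw [add_comm]
  exact h

end Poincare

/-! ### Eigenvalue counting -/

section Counting

/-- If a linear map `T` kills no vector of small Rayleigh quotient, the number of small eigenvalues
is at most the dimension of the target of `T`. -/
theorem card_eigenvalues_lt_le {E W : Type*} [NormedAddCommGroup E] [InnerProductSpace ℂ E]
    [FiniteDimensional ℂ E] [AddCommGroup W] [Module ℂ W] [FiniteDimensional ℂ W]
    {A : E →ₗ[ℂ] E} (hA : A.IsSymmetric) (T : E →ₗ[ℂ] W) {c : ℝ}
    (hT : ∀ f, T f = 0 → c * ‖f‖ ^ 2 ≤ (inner ℂ f (A f)).re) :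
    (Finset.univ.filter fun i => hA.eigenvalues rfl i < c).card ≤ Module.finrank ℂ W := by
  classical
  by_contra! hlt
  set b := hA.eigenvectorBasis rfl with hb
  set x := hA.eigenvalues rfl with hx
  set S := {i // x i < c} with hS
  -- `T` has a non-zero kernel on the span of the eigenvectors with eigenvalues below `c`
  set Tc : (S → ℂ) →ₗ[ℂ] W := T ∘ₗ (Fintype.linearCombination ℂ (fun i : S => b i.1)) with hTc
  have hdim : Module.finrank ℂ W < Module.finrank ℂ (S → ℂ) := by
    rw [Module.finrank_fintype_fun_eq_card, Fintype.card_subtype]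
    exact hlt
  have hker := LinearMap.ker_ne_bot_of_finrank_lt (f := Tc) hdim
  obtain ⟨d, hd, hd0⟩ := Submodule.exists_mem_ne_zero_of_ne_bot hker
  set f : E := ∑ i : S, d i • b i.1 with hf
  have hTf : T f = 0 := by
    have := LinearMap.mem_ker.1 hd
    simpa [hTc, hf, Fintype.linearCombination_apply] using this
  have horth : Orthonormal ℂ (fun i : S => b i.1) := b.orthonormal.comp _ Subtype.val_injective
  have hAf : A f = ∑ i : S, (d i * (x i.1 : ℂ)) • b i.1 := by
    rw [hf, map_sum]
    refine Finset.sum_congr rfl fun i _ => ?_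
    rw [map_smul, hb, hA.apply_eigenvectorBasis, smul_smul]
    rfl
  have h1 : inner ℂ f (A f) = ((∑ i : S, x i.1 * ‖d i‖ ^ 2 : ℝ) : ℂ) := by
    rw [hAf, hf, horth.inner_sum]
    push_cast
    refine Finset.sum_congr rfl fun i _ => ?_
    rw [← mul_assoc, ← Complex.normSq_eq_conj_mul_self, Complex.normSq_eq_norm_sq]
    push_cast
    ring
  have h2 : ‖f‖ ^ 2 = ∑ i : S, ‖d i‖ ^ 2 := by
    have : inner ℂ f f = ((∑ i : S, ‖d i‖ ^ 2 : ℝ) : ℂ) := by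
      rw [hf, horth.inner_sum]
      push_cast
      refine Finset.sum_congr rfl fun i _ => ?_
      rw [← Complex.normSq_eq_conj_mul_self, Complex.normSq_eq_norm_sq]
      push_cast
      rfl
    rw [inner_self_eq_norm_sq_to_K] at this
    refine Complex.ofReal_injective (Eq.trans ?_ this)
    push_cast
    rfl
  have h3 := hT f hTf
  rw [h1, Complex.ofReal_re, h2, Finset.mul_sum] at h3
  have h4 : ∑ i : S, x i.1 * ‖d i‖ ^ 2 < ∑ i : S, c * ‖d i‖ ^ 2 := by
    obtain ⟨i, hi⟩ := Function.ne_iff.1 hd0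
    refine Finset.sum_lt_sum (fun j _ => ?_) ⟨i, Finset.mem_univ _, ?_⟩
    · exact mul_le_mul_of_nonneg_right j.2.le (by positivity)
    · have : 0 < ‖d i‖ := norm_pos_iff.2 hi
      exact mul_lt_mul_of_pos_right i.2 (by positivity)
  linarith

/-- A quadratic bound of the eigenvalue counting function bounds the trace of `(1 + A)⁻²`. -/
theorem sum_inv_sq_le_of_card_le {ι : Type*} [Fintype ι] (x : ι → ℝ) (hx : ∀ i, 0 ≤ x i)
    {r : ℝ} (h : ∀ N : ℕ, 1 ≤ N →
      ((Finset.univ.filter fun i => x i < (N : ℝ) ^ 2 / 16).card : ℝ) ≤ r * N ^ 2) :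
    ∑ i, ((1 + x i) ^ 2)⁻¹ ≤ 2048 * r := by
  classical
  have hr : 0 ≤ r := by
    have := h 1 le_rfl
    have h2 : (0 : ℝ) ≤ ((Finset.univ.filter fun i => x i < ((1 : ℕ) : ℝ) ^ 2 / 16).card : ℝ) := by
      positivity
    norm_num at this h2
    linarith
  -- `N i` is the least `N` with `x i < N² / 16`
  set N : ι → ℕ := fun i => ⌊4 * Real.sqrt (x i)⌋₊ + 1 with hN
  have hN1 : ∀ i, x i < (N i : ℝ) ^ 2 / 16 := by
    intro i
    have h1 := Nat.lt_floor_add_one (4 * Real.sqrt (x i))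
    have h2 : 4 * Real.sqrt (x i) < N i := by rw [hN]; push_cast; exact h1
    have h3 := Real.sq_sqrt (hx i)
    have h4 := Real.sqrt_nonneg (x i)
    nlinarith
  have hN2 : ∀ i, ((1 + x i) ^ 2)⁻¹ ≤ 1024 * ((N i : ℝ) ^ 4)⁻¹ := by
    intro i
    have h1 := Nat.floor_le (by positivity : 0 ≤ 4 * Real.sqrt (x i))
    have h2 : (N i : ℝ) ≤ 4 * Real.sqrt (x i) + 1 := by rw [hN]; push_cast; linarith
    have h3 := Real.sq_sqrt (hx i)
    have h4 := Real.sqrt_nonneg (x i)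
    have h0 : (0 : ℝ) < N i := by rw [hN]; positivity
    have h5 : (N i : ℝ) ^ 2 ≤ 32 * (1 + x i) := by
      nlinarith [sq_nonneg (4 * Real.sqrt (x i) - 1)]
    have h6 : (N i : ℝ) ^ 4 ≤ 1024 * (1 + x i) ^ 2 := by
      have := pow_le_pow_left₀ (by positivity) h5 2
      calc (N i : ℝ) ^ 4 = ((N i : ℝ) ^ 2) ^ 2 := by ring
        _ ≤ _ := this
        _ = _ := by ring
    have hxi := hx i
    rw [inv_le_iff_one_le_mul₀ (by positivity), mul_right_comm, ← div_eq_mul_inv,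
      one_le_div (by positivity)]
    exact h6
  set K : ℕ := Finset.univ.sup N + 1 with hK
  have hmaps : ∀ i ∈ (Finset.univ : Finset ι), N i ∈ Finset.Ioo 0 K := by
    intro i _
    rw [Finset.mem_Ioo]
    refine ⟨by rw [hN]; positivity, ?_⟩
    have := Finset.le_sup (f := N) (Finset.mem_univ i)
    omega
  calc ∑ i, ((1 + x i) ^ 2)⁻¹ ≤ ∑ i, 1024 * ((N i : ℝ) ^ 4)⁻¹ :=
        Finset.sum_le_sum fun i _ => hN2 i
    _ = 1024 * ∑ k ∈ Finset.Ioo 0 K, ∑ i with N i = k, ((N i : ℝ) ^ 4)⁻¹ := by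
        rw [← Finset.mul_sum, Finset.sum_fiberwise_of_maps_to hmaps]
    _ ≤ 1024 * ∑ k ∈ Finset.Ioo 0 K, r * ((k : ℝ) ^ 2)⁻¹ := by
        gcongr with k hk
        have hk1 : 1 ≤ k := (Finset.mem_Ioo.1 hk).1
        have hk0 : (0 : ℝ) < k := by exact_mod_cast hk1
        have h1 : ∑ i with N i = k, ((N i : ℝ) ^ 4)⁻¹ =
            ((Finset.univ.filter fun i => N i = k).card : ℝ) * ((k : ℝ) ^ 4)⁻¹ := by
          rw [← nsmul_eq_mul, ← Finset.sum_const]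
          refine Finset.sum_congr rfl fun i hi => ?_
          rw [(Finset.mem_filter.1 hi).2]
        have h2 : ((Finset.univ.filter fun i => N i = k).card : ℝ) ≤ r * k ^ 2 := by
          refine le_trans ?_ (h k hk1)
          have : (Finset.univ.filter fun i => N i = k) ⊆
              (Finset.univ.filter fun i => x i < (k : ℝ) ^ 2 / 16) := by
            intro i hi
            have hi := (Finset.mem_filter.1 hi).2
            rw [Finset.mem_filter]
            refine ⟨Finset.mem_univ _, ?_⟩
            rw [← hi]
            exact hN1 i
          exact_mod_cast Finset.card_le_card this
        rw [h1]
        calc _ ≤ r * (k : ℝ) ^ 2 * ((k : ℝ) ^ 4)⁻¹ := by gcongr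
          _ = _ := by field_simp
    _ ≤ 1024 * (r * 2) := by
        rw [← Finset.mul_sum]
        have := sum_Ioo_inv_sq_le (α := ℝ) 0 K
        norm_num at this
        gcongr
    _ = _ := by ring

end Counting

/-! ### Points and edges of a pillowcase cover -/

theorem symm_unitHalf : σ unitHalf = unitHalf := by
  ext
  simp only [unitInterval.coe_symm_eq, unitHalf]
  norm_num

theorem shrink_pos {n : ℕ} (a : Fin n) {x : I} (hx : 0 < x) : 0 < shrink n a x := by
  have hn : (0 : ℝ) < n := by exact_mod_cast a.pos
  have hx' : (0 : ℝ) < x := hx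
  change (0 : ℝ) < ((a : ℕ) + (x : ℝ)) / n
  positivity

theorem shrink_lt_one {n : ℕ} (a : Fin n) {x : I} (hx : x < 1) : shrink n a x < 1 := by
  have hn : (0 : ℝ) < n := by exact_mod_cast a.pos
  have hx' : (x : ℝ) < 1 := hx
  have ha : ((a : ℕ) : ℝ) + 1 ≤ n := by exact_mod_cast a.2
  change ((a : ℕ) + (x : ℝ)) / n < 1
  rw [div_lt_one hn]
  linarith

theorem shrink_one_pos {n : ℕ} (a : Fin n) : 0 < shrink n a 1 := by
  have hn : (0 : ℝ) < n := by exact_mod_cast a.pos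
  change (0 : ℝ) < ((a : ℕ) + (1 : ℝ)) / n
  positivity

theorem shrink_zero_lt_one {n : ℕ} (a : Fin n) : shrink n a 0 < 1 := by
  have hn : (0 : ℝ) < n := by exact_mod_cast a.pos
  have ha : ((a : ℕ) : ℝ) + 1 ≤ n := by exact_mod_cast a.2
  change ((a : ℕ) + (0 : ℝ)) / n < 1
  rw [div_lt_one hn]
  linarith

theorem abs_shrink_sub_le {n : ℕ} (a : Fin n) (x y : I) :
    |(shrink n a x : ℝ) - shrink n a y| ≤ 1 / n := by
  have hn : (0 : ℝ) < n := by exact_mod_cast a.pos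
  change |((a : ℕ) + (x : ℝ)) / n - ((a : ℕ) + (y : ℝ)) / n| ≤ 1 / n
  rw [← sub_div, add_sub_add_left_eq_sub, abs_div, abs_of_pos hn]
  refine div_le_div_of_nonneg_right ?_ hn.le
  rw [abs_le]
  constructor <;> linarith [x.2.1, x.2.2, y.2.1, y.2.2]

theorem shrink_injective {n : ℕ} {a a' : Fin n} {x : I} (h : shrink n a x = shrink n a' x) :
    a = a' := by
  have hn : (n : ℝ) ≠ 0 := by exact_mod_cast a.pos.ne'
  have h1 : (((a : ℕ) + (x : ℝ)) / n : ℝ) = ((a' : ℕ) + (x : ℝ)) / n := congrArg Subtype.val h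
  rw [div_left_inj' hn, add_left_inj] at h1
  exact Fin.ext (by exact_mod_cast h1)

theorem symm_shrink {n : ℕ} (a : Fin n) (x : I) : σ (shrink n a x) = shrink n a.rev (σ x) := by
  have hn : (n : ℝ) ≠ 0 := by exact_mod_cast a.pos.ne'
  ext
  change 1 - ((a : ℕ) + (x : ℝ)) / n = ((a.rev : ℕ) + (1 - (x : ℝ))) / n
  rw [Fin.val_rev, Nat.cast_sub a.2]
  field_simp
  push_cast
  ring

theorem shrink_one_eq_shrink_zero {n : ℕ} {a a' : Fin n} (h : (a : ℕ) + 1 = a') :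
    shrink n a 1 = shrink n a' 0 := by
  ext
  change (((a : ℕ) : ℝ) + (1 : ℝ)) / n = (((a' : ℕ) : ℝ) + (0 : ℝ)) / n
  rw [← h]
  push_cast
  ring

theorem symm_pos_and_lt_one_iff {x : I} : (0 < σ x ∧ σ x < 1) ↔ (0 < x ∧ x < 1) := by
  rw [unitInterval.lt_symm_comm, unitInterval.symm_lt_comm, unitInterval.symm_zero,
    unitInterval.symm_one, and_comm]

theorem unitHalf_pos : 0 < unitHalf := by
  change (0 : ℝ) < 1 / 2
  norm_num

theorem unitHalf_lt_one : unitHalf < 1 := by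
  change (1 / 2 : ℝ) < 1
  norm_num

/-- A point of the unit square which is not a corner. -/
def NonCorner (p : I × I) : Prop := (0 < p.1 ∧ p.1 < 1) ∨ (0 < p.2 ∧ p.2 < 1)

theorem nonCorner_squareSide (k : Fin 4) (x : I) : NonCorner (squareSide k x) ↔ 0 < x ∧ x < 1 := by
  fin_cases k <;> simp [NonCorner, squareSide, and_comm, unitInterval.pos_iff_ne_zero,
    unitInterval.lt_one_iff_ne_one]

/-- A point which is not a corner lies on at most one side of the square. -/
theorem squareSide_injective {k k' : Fin 4} {x x' : I} (hx : 0 < x ∧ x < 1)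
    (h : squareSide k x = squareSide k' x') : k = k' ∧ x = x' := by
  obtain ⟨h0, h1⟩ := hx
  have h0' := h0.ne'
  have h1' := h1.ne
  fin_cases k <;> fin_cases k' <;> simp_all [squareSide, Prod.ext_iff]

theorem continuous_squareSide (k : Fin 4) : Continuous (squareSide k) := by
  fin_cases k
  · exact continuous_id.prodMk continuous_const
  · exact continuous_const.prodMk continuous_id
  · exact unitInterval.continuous_symm.prodMk continuous_const
  · exact continuous_const.prodMk unitInterval.continuous_symm

theorem nonCorner_subSquare {n : ℕ} (a b : Fin n) (k : Fin 4) :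
    NonCorner (subSquare n a b (squareSide k unitHalf)) := by
  have h := fun c : Fin n => And.intro (shrink_pos c unitHalf_pos) (shrink_lt_one c unitHalf_lt_one)
  fin_cases k
  · exact Or.inl (h a)
  · exact Or.inr (h b)
  · exact Or.inl (by
      change 0 < shrink n a (σ unitHalf) ∧ shrink n a (σ unitHalf) < 1
      rw [symm_unitHalf]
      exact h a)
  · exact Or.inr (by
      change 0 < shrink n b (σ unitHalf) ∧ shrink n b (σ unitHalf) < 1
      rw [symm_unitHalf]
      exact h b)

theorem subSquare_injective {n : ℕ} {a b a' b' : Fin n} {p : I × I}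
    (h : subSquare n a b p = subSquare n a' b' p) : a = a' ∧ b = b' :=
  ⟨shrink_injective (congrArg Prod.fst h), shrink_injective (congrArg Prod.snd h)⟩

/-- The small square along the side `k` of a tile whose side number `k` has the midpoint with
parameter `shrink n i unitHalf`. -/
def sideSquare (n : ℕ) (k : Fin 4) (i : Fin n) : Fin n × Fin n :=
  match k with
  | 0 => (i, ⟨0, i.pos⟩)
  | 1 => (⟨n - 1, Nat.sub_one_lt i.pos.ne'⟩, i)
  | 2 => (i.rev, ⟨n - 1, Nat.sub_one_lt i.pos.ne'⟩)
  | 3 => (⟨0, i.pos⟩, i.rev)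

theorem sideSquare_injective (n : ℕ) (k : Fin 4) : Function.Injective (sideSquare n k) := by
  intro i j h
  fin_cases k <;> simpa [sideSquare] using h

theorem subSquare_sideSquare {n : ℕ} (k : Fin 4) (i : Fin n) :
    subSquare n (sideSquare n k i).1 (sideSquare n k i).2 (squareSide k unitHalf) =
      squareSide k (shrink n i unitHalf) := by
  have hn : (n : ℝ) ≠ 0 := by exact_mod_cast i.pos.ne'
  have h0 : shrink n ⟨0, i.pos⟩ 0 = 0 := by
    ext
    change (((0 : ℕ) : ℝ) + (0 : ℝ)) / n = 0
    simp
  have h1 : shrink n ⟨n - 1, Nat.sub_one_lt i.pos.ne'⟩ 1 = 1 := by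
    ext
    change (((n - 1 : ℕ) : ℝ) + (1 : ℝ)) / n = 1
    rw [Nat.cast_sub i.pos]
    field_simp
    push_cast
    ring
  have h2 : shrink n i.rev unitHalf = σ (shrink n i unitHalf) := by
    rw [symm_shrink, symm_unitHalf]
  fin_cases k <;> simp [subSquare, sideSquare, squareSide, symm_unitHalf, h0, h1, h2]

/-- The centre of a small square, in the coordinates of its tile. -/
noncomputable abbrev squareCentre {T : Type*} {n : ℕ} (v : T × Fin n × Fin n) : I × I :=
  subSquare n v.2.1 v.2.2 (unitHalf, unitHalf)

/-- The midpoint of a side of a small square, in the coordinates of its tile. -/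
noncomputable abbrev squareMid {T : Type*} {n : ℕ} (v : T × Fin n × Fin n) (k : Fin 4) : I × I :=
  subSquare n v.2.1 v.2.2 (squareSide k unitHalf)

namespace PillowcaseCover

variable {T : Type*} (Ψ : PillowcaseCover T)

theorem glue_ne {d : T × Fin 4} (hd : Ψ.glue d ≠ d) : Ψ.glue (Ψ.glue d) ≠ Ψ.glue d := by
  rw [Ψ.glue_glue]
  exact hd.symm

theorem point_squareSide_glue {d : T × Fin 4} (hd : Ψ.glue d ≠ d) (x : I) :
    Ψ.point (Ψ.glue d).1 (squareSide (Ψ.glue d).2 (σ x)) = Ψ.point d.1 (squareSide d.2 x) :=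
  (Quot.sound (GlueRel.glue d hd x)).symm

/-- Two points of the tiles that are identified across the glued side `d`, away from corners. -/
def IsAcross (d : T × Fin 4) (a b : Σ _ : T, I × I) : Prop :=
  Ψ.glue d ≠ d ∧ ∃ x : I, (0 < x ∧ x < 1) ∧ a = ⟨d.1, squareSide d.2 x⟩ ∧
    b = ⟨(Ψ.glue d).1, squareSide (Ψ.glue d).2 (σ x)⟩

variable {Ψ}

theorem IsAcross.symm {d : T × Fin 4} {a b : Σ _ : T, I × I} (h : Ψ.IsAcross d a b) :
    Ψ.IsAcross (Ψ.glue d) b a := by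
  obtain ⟨hd, x, hx, ha, hb⟩ := h
  refine ⟨Ψ.glue_ne hd, σ x, symm_pos_and_lt_one_iff.2 hx, hb, ?_⟩
  rw [Ψ.glue_glue, unitInterval.symm_symm, ha]

theorem IsAcross.unique {d d' : T × Fin 4} {a b b' : Σ _ : T, I × I} (h : Ψ.IsAcross d a b)
    (h' : Ψ.IsAcross d' a b') : b = b' := by
  obtain ⟨hd, x, hx, ha, hb⟩ := h
  obtain ⟨hd', x', hx', ha', hb'⟩ := h'
  rw [ha] at ha'
  obtain ⟨h1, h2⟩ := Sigma.mk.inj_iff.1 ha'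
  obtain ⟨h3, h4⟩ := squareSide_injective hx (eq_of_heq h2)
  obtain rfl : d = d' := Prod.ext h1 h3
  rw [hb, hb', h4]

/-- A point which is not a corner of a tile is identified with at most one other point. -/
theorem eq_or_isAcross_of_eqvGen {a b : Σ _ : T, I × I}
    (h : Relation.EqvGen Ψ.GlueRel a b) :
    (NonCorner a.2 ↔ NonCorner b.2) ∧ (NonCorner a.2 → a = b ∨ ∃ d, Ψ.IsAcross d a b) := by
  induction h with
  | rel a b h =>
    obtain ⟨d, hd, x⟩ := h
    refine ⟨?_, fun hx => Or.inr ⟨d, hd, x, (nonCorner_squareSide _ _).1 hx, rfl, rfl⟩⟩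
    rw [nonCorner_squareSide, nonCorner_squareSide]
    exact symm_pos_and_lt_one_iff.symm
  | refl a => exact ⟨Iff.rfl, fun _ => Or.inl rfl⟩
  | symm a b _ ih =>
    refine ⟨ih.1.symm, fun hb => ?_⟩
    rcases ih.2 (ih.1.2 hb) with h | ⟨d, h⟩
    · exact Or.inl h.symm
    · exact Or.inr ⟨_, h.symm⟩
  | trans a b c _ _ ih1 ih2 =>
    refine ⟨ih1.1.trans ih2.1, fun ha => ?_⟩
    rcases ih1.2 ha with rfl | ⟨d, h⟩
    · exact ih2.2 ha
    · rcases ih2.2 (ih1.1.1 ha) with rfl | ⟨d', h'⟩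
      · exact Or.inr ⟨d, h⟩
      · exact Or.inl (h.symm.unique h')

theorem eq_or_isAcross_of_point_eq {t t' : T} {p p' : I × I} (hp : NonCorner p)
    (h : Ψ.point t p = Ψ.point t' p') :
    (⟨t, p⟩ : Σ _ : T, I × I) = ⟨t', p'⟩ ∨ ∃ d, Ψ.IsAcross d ⟨t, p⟩ ⟨t', p'⟩ :=
  (eq_or_isAcross_of_eqvGen (Quot.eqvGen_exact h)).2 hp

theorem centre_mem_openTile {n : ℕ} (v : T × Fin n × Fin n) : Ψ.centre v ∈ Ψ.openTile v.1 :=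
  ⟨_, ⟨shrink_pos _ unitHalf_pos, shrink_lt_one _ unitHalf_lt_one, shrink_pos _ unitHalf_pos,
    shrink_lt_one _ unitHalf_lt_one⟩, rfl⟩

/-- A tiled open set contains the vertices of a tile if and only if it contains the tile. -/
theorem IsTiledOpen.centre_mem_iff {U : Set Ψ.Space} (hU : Ψ.IsTiledOpen U) {n : ℕ}
    (v : T × Fin n × Fin n) : Ψ.centre v ∈ U ↔ Ψ.openTile v.1 ⊆ U := by
  refine ⟨fun h => (hU.tile v.1).resolve_right fun hd => ?_, fun h => h (centre_mem_openTile v)⟩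
  exact Set.disjoint_left.1 hd (centre_mem_openTile v) h

theorem isTiledOpen_univ : Ψ.IsTiledOpen Set.univ :=
  ⟨isOpen_univ, fun _ => Or.inl (Set.subset_univ _), fun _ => Or.inl (Set.subset_univ _)⟩

/-- The sides across which neighbouring tiles are joined inside a tiled open set. -/
def innerSides (Ψ : PillowcaseCover T) (U : Set Ψ.Space) : Set (T × Fin 4) :=
  {d | Ψ.glue d ≠ d ∧ Ψ.openSide d ⊆ U ∧ Ψ.openTile d.1 ⊆ U ∧ Ψ.openTile (Ψ.glue d).1 ⊆ U}

/-- The side through which an edge leaves its starting square. -/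
def EdgeFrom.side {U : Set Ψ.Space} {n : ℕ} {v : Ψ.Vertex U n} (e : Ψ.EdgeFrom U n v) : Fin 4 :=
  e.1.1

/-- The side through which an edge enters the square of its other end. -/
def EdgeFrom.headSide {U : Set Ψ.Space} {n : ℕ} {v : Ψ.Vertex U n} (e : Ψ.EdgeFrom U n v) :
    Fin 4 :=
  e.1.2.2

theorem EdgeFrom.point_eq {U : Set Ψ.Space} {n : ℕ} {v : Ψ.Vertex U n} (e : Ψ.EdgeFrom U n v) :
    Ψ.point v.1.1 (squareMid v.1 e.side) = Ψ.point e.head.1.1 (squareMid e.head.1 e.headSide) :=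
  e.2.2.1

theorem EdgeFrom.point_mem {U : Set Ψ.Space} {n : ℕ} {v : Ψ.Vertex U n} (e : Ψ.EdgeFrom U n v) :
    Ψ.point v.1.1 (squareMid v.1 e.side) ∈ U :=
  e.2.2.2

/-- The edge in the opposite direction. -/
def EdgeFrom.reverse {U : Set Ψ.Space} {n : ℕ} {v : Ψ.Vertex U n} (e : Ψ.EdgeFrom U n v) :
    Ψ.EdgeFrom U n e.head :=
  ⟨(e.headSide, (v, e.side)), fun h => e.2.1 h.symm, e.point_eq.symm,
    (congrArg (· ∈ U) e.point_eq).mp e.point_mem⟩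

/-- An edge of the graph stays in a tile or crosses a glued side. -/
theorem EdgeFrom.eq_or_isAcross {U : Set Ψ.Space} {n : ℕ} {v : Ψ.Vertex U n}
    (e : Ψ.EdgeFrom U n v) :
    (⟨v.1.1, squareMid v.1 e.side⟩ : Σ _ : T, I × I) =
        ⟨e.head.1.1, squareMid e.head.1 e.headSide⟩ ∨
      ∃ d, Ψ.IsAcross d ⟨v.1.1, squareMid v.1 e.side⟩
        ⟨e.head.1.1, squareMid e.head.1 e.headSide⟩ :=
  eq_or_isAcross_of_point_eq (nonCorner_subSquare _ _ _) e.point_eq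

theorem EdgeFrom.mem_innerSides {U : Set Ψ.Space} (hU : Ψ.IsTiledOpen U) {n : ℕ}
    {v : Ψ.Vertex U n} (e : Ψ.EdgeFrom U n v) {d : T × Fin 4}
    (h : Ψ.IsAcross d ⟨v.1.1, squareMid v.1 e.side⟩
        ⟨e.head.1.1, squareMid e.head.1 e.headSide⟩) :
    d ∈ Ψ.innerSides U := by
  obtain ⟨hd, x, hx, ha, hb⟩ := h
  obtain ⟨h1, h2⟩ := Sigma.mk.inj_iff.1 ha
  obtain ⟨h3, -⟩ := Sigma.mk.inj_iff.1 hb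
  refine ⟨hd, (hU.side d).resolve_right fun hdis => ?_, ?_, ?_⟩
  · refine Set.disjoint_left.1 hdis ⟨x, hx, rfl⟩ ?_
    have := e.point_mem
    rwa [eq_of_heq h2, h1] at this
  · rw [← h1]
    exact (hU.centre_mem_iff v.1).1 v.2
  · rw [← h3]
    exact (hU.centre_mem_iff e.head.1).1 e.head.2

/-- The degrees of the graphs `U_n` are bounded: an edge at `v` is determined by the side of `v`,
the side of its other end, and whether it stays in the tile or crosses a glued side. -/
theorem card_edgeFrom_le [Finite T] (U : Set Ψ.Space) (n : ℕ) (v : Ψ.Vertex U n) :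
    Fintype.card (Ψ.EdgeFrom U n v) ≤ 32 := by
  classical
  let f : Ψ.EdgeFrom U n v → Fin 4 × Fin 4 × Bool := fun e => (e.side, e.headSide, decide
    ((⟨v.1.1, squareMid v.1 e.side⟩ : Σ _ : T, I × I) =
      ⟨e.head.1.1, squareMid e.head.1 e.headSide⟩))
  have hf : Function.Injective f := by
    intro e e' h
    obtain ⟨h1, h2, h3⟩ : e.side = e'.side ∧ e.headSide = e'.headSide ∧ _ := by
      simpa only [f, Prod.mk.injEq] using h
    rw [decide_eq_decide] at h3
    have hpt : (⟨e.head.1.1, squareMid e.head.1 e.headSide⟩ :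
        Σ _ : T, I × I) = ⟨e'.head.1.1,
          squareMid e'.head.1 e'.headSide⟩ := by
      rcases e.eq_or_isAcross with h | ⟨d, h⟩
      · rw [← h, ← h3.1 h, h1]
      · rcases e'.eq_or_isAcross with h' | ⟨d', h'⟩
        · rw [← h', ← h3.2 h', h1]
        · rw [← h1] at h'
          exact h.unique h'
    obtain ⟨h4, h5⟩ := Sigma.mk.inj_iff.1 hpt
    have h6 := eq_of_heq h5
    rw [h2] at h6
    obtain ⟨h7, h8⟩ := subSquare_injective h6
    refine Subtype.ext (Prod.ext h1 (Prod.ext (Subtype.ext ?_) h2))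
    exact Prod.ext h4 (Prod.ext h7 h8)
  have := Fintype.card_le_of_injective f hf
  simpa using this

end PillowcaseCover

/-! ### Parallel transport on the tiles -/

theorem path_square_homotopic {p q : I × I} (γ γ' : Path p q) : γ.Homotopic γ' := by
  have : ContractibleSpace I :=
    (convex_Icc (0 : ℝ) 1).contractibleSpace ⟨0, by simp⟩
  exact SimplyConnectedSpace.paths_homotopic γ γ'

/-- The centre of a tile; the fibre over it serves to trivialise the bundle over the tile. -/
noncomputable abbrev tileCentre : I × I := (unitHalf, unitHalf)

namespace FlatUnitaryBundle

variable {T : Type*} {Ψ : PillowcaseCover T} (F : FlatUnitaryBundle Ψ.Space)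

/-- Parallel transport between two points of a tile along any path in the tile. -/
noncomputable def tileTransport (t : T) (p q : I × I) :
    F.fiber (Ψ.point t p) ≃ₗᵢ[ℂ] F.fiber (Ψ.point t q) :=
  F.transport ((segmentSq p q).map (Ψ.continuous_point t))

/-- The identification of the fibres over two equal points. -/
noncomputable def fiberCongr {x y : Ψ.Space} (h : x = y) : F.fiber x ≃ₗᵢ[ℂ] F.fiber y :=
  F.transport ((Path.refl x).cast rfl h.symm)

@[simp]
theorem fiberCongr_rfl {x : Ψ.Space} (h : x = x) (f : F.fiber x) : F.fiberCongr h f = f :=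
  F.transport_refl x f

theorem fiberCongr_trans {x y z : Ψ.Space} (h : x = y) (h' : y = z) (f : F.fiber x) :
    F.fiberCongr h' (F.fiberCongr h f) = F.fiberCongr (h.trans h') f := by
  subst h h'
  simp

theorem transport_cast {x y x' y' : Ψ.Space} (γ : Path x y) (hx : x' = x) (hy : y' = y)
    (f : F.fiber x') :
    F.transport (γ.cast hx hy) f = F.fiberCongr hy.symm (F.transport γ (F.fiberCongr hx f)) := by
  subst hx hy
  simp

theorem transport_map (t : T) {p q : I × I} (γ : Path p q) :
    F.transport (γ.map (Ψ.continuous_point t)) = F.tileTransport t p q :=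
  F.flat _ _ ((path_square_homotopic γ (segmentSq p q)).map
    ⟨Ψ.point t, Ψ.continuous_point t⟩)

theorem tileTransport_trans (t : T) (p q r : I × I) (f : F.fiber (Ψ.point t p)) :
    F.tileTransport t q r (F.tileTransport t p q f) = F.tileTransport t p r f := by
  rw [tileTransport, tileTransport, ← F.transport_trans, ← Path.map_trans, F.transport_map]

@[simp]
theorem tileTransport_self (t : T) (p : I × I) (f : F.fiber (Ψ.point t p)) :
    F.tileTransport t p p f = f := by
  rw [← F.transport_map t (Path.refl p)]
  exact F.transport_refl _ f

/-- Parallel transport along a glued side agrees on the two adjacent tiles. -/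
theorem fiberCongr_tileTransport_squareSide {d : T × Fin 4} (hd : Ψ.glue d ≠ d) (x y : I)
    (f : F.fiber (Ψ.point (Ψ.glue d).1 (squareSide (Ψ.glue d).2 (σ x)))) :
    F.fiberCongr (Ψ.point_squareSide_glue hd y)
      (F.tileTransport (Ψ.glue d).1 (squareSide (Ψ.glue d).2 (σ x))
        (squareSide (Ψ.glue d).2 (σ y)) f) =
    F.tileTransport d.1 (squareSide d.2 x) (squareSide d.2 y)
      (F.fiberCongr (Ψ.point_squareSide_glue hd x) f) := by
  have hγ := F.transport_map d.1 ((segmentI x y).map (continuous_squareSide d.2))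
  have hγ' := F.transport_map (Ψ.glue d).1 (((segmentI x y).map unitInterval.continuous_symm).map
    (continuous_squareSide (Ψ.glue d).2))
  rw [← hγ, ← hγ']
  have hcast : ((((segmentI x y).map unitInterval.continuous_symm).map
      (continuous_squareSide (Ψ.glue d).2)).map (Ψ.continuous_point (Ψ.glue d).1)) =
      ((((segmentI x y).map (continuous_squareSide d.2)).map (Ψ.continuous_point d.1)).cast
        (Ψ.point_squareSide_glue hd x) (Ψ.point_squareSide_glue hd y)) := by
    ext τ
    exact Ψ.point_squareSide_glue hd _
  rw [hcast, F.transport_cast, fiberCongr_trans, fiberCongr_rfl]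

/-- Parallel transport between the centres of two adjacent tiles, crossing the glued side `d` at
the parameter `x`. -/
noncomputable def sideTransport {d : T × Fin 4} (hd : Ψ.glue d ≠ d) (x : I) :
    F.fiber (Ψ.point (Ψ.glue d).1 tileCentre) ≃ₗᵢ[ℂ] F.fiber (Ψ.point d.1 tileCentre) :=
  ((F.tileTransport (Ψ.glue d).1 tileCentre (squareSide (Ψ.glue d).2 (σ x))).trans
    (F.fiberCongr (Ψ.point_squareSide_glue hd x))).trans
      (F.tileTransport d.1 (squareSide d.2 x) tileCentre)

/-- The transport across a side does not depend on the crossing point. -/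
theorem sideTransport_eq {d : T × Fin 4} (hd : Ψ.glue d ≠ d) (x y : I) (f) :
    F.sideTransport hd x f = F.sideTransport hd y f := by
  simp only [sideTransport, LinearIsometryEquiv.trans_apply]
  rw [← F.tileTransport_trans (Ψ.glue d).1 tileCentre (squareSide (Ψ.glue d).2 (σ y))
      (squareSide (Ψ.glue d).2 (σ x)), F.fiberCongr_tileTransport_squareSide hd y x,
    F.tileTransport_trans]

/-- The transport along an edge goes through the midpoint of the common side. -/
theorem transport_edge {U : Set Ψ.Space} {n : ℕ} {v : Ψ.Vertex U n} (e : Ψ.EdgeFrom U n v)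
    (f : F.fiber (Ψ.centre e.head.1)) :
    F.transport e.path f =
      F.tileTransport v.1.1 (squareMid v.1 e.side) (squareCentre v.1)
        (F.fiberCongr e.point_eq.symm
          (F.tileTransport e.head.1.1 (squareCentre e.head.1) (squareMid e.head.1 e.headSide)
            f)) := by
  have h1 := F.transport_trans (Ψ.halfEdge e.head.1 e.headSide)
    ((Ψ.halfEdge v.1 e.side).symm.cast e.2.2.1.symm rfl) f
  have h2 := F.transport_cast (Ψ.halfEdge v.1 e.side).symm e.2.2.1.symm rfl
    (F.transport (Ψ.halfEdge e.head.1 e.headSide) f)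
  have h3 : F.transport (Ψ.halfEdge v.1 e.side).symm =
      F.tileTransport v.1.1 (squareMid v.1 e.side) (squareCentre v.1) :=
    F.transport_map v.1.1 (segmentSq (squareCentre v.1) (squareMid v.1 e.side)).symm
  refine h1.trans (h2.trans ((F.fiberCongr_rfl _ _).trans ?_))
  exact LinearIsometryEquiv.congr_fun h3 _

theorem transport_reverse {U : Set Ψ.Space} {n : ℕ} {v : Ψ.Vertex U n} (e : Ψ.EdgeFrom U n v)
    (f : F.fiber (Ψ.centre e.head.1)) :
    F.transport e.reverse.path (F.transport e.path f) = f := by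
  refine (F.transport_edge e.reverse _).trans ?_
  rw [F.transport_edge e]
  have h1 := F.tileTransport_trans v.1.1 (squareMid v.1 e.side) (squareCentre v.1)
    (squareMid v.1 e.side)
  have h2 := F.fiberCongr_trans e.point_eq.symm e.point_eq
  have h3 := F.tileTransport_trans e.head.1.1 (squareCentre e.head.1)
    (squareMid e.head.1 e.headSide) (squareCentre e.head.1)
  refine Eq.trans ?_ ((h3 f).trans (F.tileTransport_self _ _ f))
  refine congrArg _ ?_
  refine Eq.trans ?_ ((h2 _).trans (F.fiberCongr_rfl _ _))
  refine congrArg _ ?_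
  exact (h1 _).trans (F.tileTransport_self _ _ _)

/-- A family of vectors at the centres of the tiles which is invariant under the transport across
the side `d` extends to a section over the two tiles which is flat across `d`. -/
theorem tileTransport_of_isAcross (y : ∀ t, F.fiber (Ψ.point t tileCentre)) {d : T × Fin 4}
    (hy : ∀ hd : Ψ.glue d ≠ d, F.sideTransport hd 0 (y (Ψ.glue d).1) = y d.1) {t t' : T}
    {p p' : I × I} (h : Ψ.IsAcross d ⟨t, p⟩ ⟨t', p'⟩) (heq : Ψ.point t' p' = Ψ.point t p) :
    F.fiberCongr heq (F.tileTransport t' tileCentre p' (y t')) =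
      F.tileTransport t tileCentre p (y t) := by
  obtain ⟨hd, x, hx, ha, hb⟩ := h
  cases ha
  cases hb
  rw [← hy hd, F.sideTransport_eq hd 0 x, sideTransport, LinearIsometryEquiv.trans_apply,
    LinearIsometryEquiv.trans_apply, F.tileTransport_trans, F.tileTransport_self]

theorem tileTransport_of_eq (y : ∀ t, F.fiber (Ψ.point t tileCentre)) {t t' : T}
    {p p' : I × I} (h : (⟨t, p⟩ : Σ _ : T, I × I) = ⟨t', p'⟩) (heq : Ψ.point t' p' = Ψ.point t p) :
    F.fiberCongr heq (F.tileTransport t' tileCentre p' (y t')) =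
      F.tileTransport t tileCentre p (y t) := by
  cases h
  rw [fiberCongr_rfl]

end FlatUnitaryBundle

/-! ### The Dirichlet energy of a section -/

namespace PillowcaseCover

variable {T : Type*} {Ψ : PillowcaseCover T}

/-- The reversal of the oriented edges. -/
def edgeReverse (Ψ : PillowcaseCover T) (U : Set Ψ.Space) (n : ℕ) :
    Equiv.Perm (Σ v : Ψ.Vertex U n, Ψ.EdgeFrom U n v) where
  toFun e := ⟨e.2.head, e.2.reverse⟩
  invFun e := ⟨e.2.head, e.2.reverse⟩
  left_inv _ := rfl
  right_inv _ := rfl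

open Classical in
/-- A sum over the vertices as a sum over all small squares of all tiles. -/
theorem sum_vertex [Fintype T] {M : Type*} [AddCommMonoid M] (U : Set Ψ.Space) (n : ℕ)
    (G : Ψ.Vertex U n → M) :
    ∑ v, G v = ∑ t, ∑ a ∈ Finset.range n, ∑ b ∈ Finset.range n,
      if h : ∃ (ha : a < n) (hb : b < n), Ψ.centre (t, ⟨a, ha⟩, ⟨b, hb⟩) ∈ U then
        G ⟨(t, ⟨a, h.1⟩, ⟨b, h.2.1⟩), h.2.2⟩ else 0 := by
  have h1 : ∑ v, G v = ∑ v : T × Fin n × Fin n,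
      if h : Ψ.centre v ∈ U then G ⟨v, h⟩ else 0 := by
    rw [← Finset.sum_filter_add_sum_filter_not Finset.univ (fun v => Ψ.centre v ∈ U)]
    rw [Finset.sum_eq_zero (s := Finset.univ.filter fun v => ¬ Ψ.centre v ∈ U)
      (fun v hv => dif_neg (Finset.mem_filter.1 hv).2), add_zero,
      Finset.sum_subtype (p := fun v => Ψ.centre v ∈ U) _ (fun v => by simp)]
    refine Finset.sum_congr rfl fun v _ => ?_
    rw [dif_pos v.2]
  rw [h1, Fintype.sum_prod_type]
  refine Finset.sum_congr rfl fun t _ => ?_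
  rw [Fintype.sum_prod_type, Finset.sum_range]
  refine Finset.sum_congr rfl fun a _ => ?_
  rw [Finset.sum_range]
  refine Finset.sum_congr rfl fun b _ => ?_
  by_cases h : Ψ.centre (t, a, b) ∈ U
  · rw [dif_pos h, dif_pos ⟨a.2, b.2, h⟩]
  · rw [dif_neg h, dif_neg]
    rintro ⟨_, _, h'⟩
    exact h h'

end PillowcaseCover

namespace FlatUnitaryBundle

variable {T : Type*} {Ψ : PillowcaseCover T} (F : FlatUnitaryBundle Ψ.Space)
  {U : Set Ψ.Space} {n : ℕ}

/-- The difference of a section along an edge. -/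
noncomputable def edgeDiff {v : Ψ.Vertex U n} (e : Ψ.EdgeFrom U n v) (f : F.Sections U n) :
    F.fiber (Ψ.centre v.1) :=
  f v - F.transport e.path (f e.head)

theorem edgeDiff_reverse {v : Ψ.Vertex U n} (e : Ψ.EdgeFrom U n v) (f : F.Sections U n) :
    F.edgeDiff e.reverse f = -F.transport e.reverse.path (F.edgeDiff e f) := by
  have h := map_sub (F.transport e.reverse.path) (f v) (F.transport e.path (f e.head))
  have h' := h.trans (congrArg (F.transport e.reverse.path (f v) - ·)
    (F.transport_reverse e (f e.head)))
  exact ((congrArg Neg.neg h').trans (neg_sub _ _)).symm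

/-- Summation by parts for the discrete Laplacian; each edge is counted in both directions. -/
theorem two_mul_inner_laplacian [Finite T] (f g : F.Sections U n) :
    2 * inner ℂ f (F.laplacian U n g) =
      ∑ v, ∑ e : Ψ.EdgeFrom U n v, inner ℂ (F.edgeDiff e f) (F.edgeDiff e g) := by
  have h1 : inner ℂ f (F.laplacian U n g) =
      ∑ e : Σ v : Ψ.Vertex U n, Ψ.EdgeFrom U n v, inner ℂ (f e.1) (F.edgeDiff e.2 g) := by
    rw [PiLp.inner_apply, Fintype.sum_sigma]
    refine Finset.sum_congr rfl fun v _ => ?_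
    exact inner_sum _ _ _
  have h2 : inner ℂ f (F.laplacian U n g) =
      ∑ e : Σ v : Ψ.Vertex U n, Ψ.EdgeFrom U n v,
        -inner ℂ (F.transport e.2.path (f e.2.head)) (F.edgeDiff e.2 g) := by
    rw [h1, ← Equiv.sum_comp (Ψ.edgeReverse U n)]
    refine Finset.sum_congr rfl fun e _ => ?_
    change inner ℂ (f e.2.head) (F.edgeDiff e.2.reverse g) = _
    rw [edgeDiff_reverse, inner_neg_right, ← LinearIsometryEquiv.inner_map_map
      (F.transport e.2.path)]
    congr 2
    exact F.transport_reverse e.2.reverse (F.edgeDiff e.2 g)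
  rw [two_mul]
  nth_rewrite 1 [h1]
  rw [h2, ← Finset.sum_add_distrib, Fintype.sum_sigma]
  refine Finset.sum_congr rfl fun v _ => Finset.sum_congr rfl fun e _ => ?_
  rw [← sub_eq_add_neg, ← inner_sub_left]
  rfl

/-- The Dirichlet energy at a vertex. -/
noncomputable def energyAt [Finite T] (f : F.Sections U n) (v : Ψ.Vertex U n) : ℝ :=
  ∑ e : Ψ.EdgeFrom U n v, ‖F.edgeDiff e f‖ ^ 2

theorem energyAt_nonneg [Finite T] (f : F.Sections U n) (v : Ψ.Vertex U n) :
    0 ≤ F.energyAt f v :=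
  Finset.sum_nonneg fun _ _ => sq_nonneg _

/-- The Dirichlet energy of a section, where each edge is counted in both directions. -/
noncomputable def energy [Finite T] (f : F.Sections U n) : ℝ :=
  ∑ v, F.energyAt f v

theorem energy_nonneg [Finite T] (f : F.Sections U n) : 0 ≤ F.energy f :=
  Finset.sum_nonneg fun v _ => F.energyAt_nonneg f v

theorem re_inner_laplacian [Finite T] (f : F.Sections U n) :
    (inner ℂ f (F.laplacian U n f)).re = F.energy f / 2 := by
  have h := congrArg Complex.re (F.two_mul_inner_laplacian f f)
  have h2 : ∀ (v : Ψ.Vertex U n) (e : Ψ.EdgeFrom U n v),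
      (inner ℂ (F.edgeDiff e f) (F.edgeDiff e f)).re = ‖F.edgeDiff e f‖ ^ 2 := fun v e => by
    rw [inner_self_eq_norm_sq_to_K]
    norm_cast
  simp only [Complex.re_sum, h2] at h
  rw [show (2 : ℂ) = ((2 : ℝ) : ℂ) by norm_num, Complex.re_ofReal_mul] at h
  change 2 * _ = F.energy f at h
  linarith

theorem isSymmetric_laplacian [Finite T] : (F.laplacian U n).IsSymmetric := by
  intro f g
  have h1 := F.two_mul_inner_laplacian f g
  have h2 := congrArg (starRingEnd ℂ) (F.two_mul_inner_laplacian g f)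
  simp only [map_mul, map_sum, inner_conj_symm] at h2
  have h3 : (starRingEnd ℂ) (2 : ℂ) = 2 := Complex.conj_ofNat 2
  rw [h3, ← h1] at h2
  exact mul_left_cancel₀ two_ne_zero h2

theorem energy_le [Finite T] (f : F.Sections U n) : F.energy f ≤ 128 * ‖f‖ ^ 2 := by
  have hsum : ∑ v, ‖f v‖ ^ 2 = ‖f‖ ^ 2 := (PiLp.norm_sq_eq_of_L2 _ f).symm
  have h1 : F.energy f ≤ ∑ e : Σ v : Ψ.Vertex U n, Ψ.EdgeFrom U n v,
      (2 * ‖f e.1‖ ^ 2 + 2 * ‖f e.2.head‖ ^ 2) := by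
    rw [energy, Fintype.sum_sigma]
    refine Finset.sum_le_sum fun v _ => Finset.sum_le_sum fun e _ => ?_
    have h := norm_sub_le (f v) (F.transport e.path (f e.head))
    rw [LinearIsometryEquiv.norm_map] at h
    have h0 := norm_nonneg (F.edgeDiff e f)
    rw [edgeDiff] at h0 ⊢
    nlinarith [sq_nonneg (‖f v‖ - ‖f e.head‖)]
  have h2 : ∑ e : Σ v : Ψ.Vertex U n, Ψ.EdgeFrom U n v, ‖f e.2.head‖ ^ 2 =
      ∑ e : Σ v : Ψ.Vertex U n, Ψ.EdgeFrom U n v, ‖f e.1‖ ^ 2 :=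
    Equiv.sum_comp (Ψ.edgeReverse U n) fun e => ‖f e.1‖ ^ 2
  have h3 : ∑ e : Σ v : Ψ.Vertex U n, Ψ.EdgeFrom U n v, ‖f e.1‖ ^ 2 ≤ 32 * ‖f‖ ^ 2 := by
    rw [Fintype.sum_sigma, ← hsum, Finset.mul_sum]
    refine Finset.sum_le_sum fun v _ => ?_
    change ∑ _e : Ψ.EdgeFrom U n v, ‖f v‖ ^ 2 ≤ _
    rw [Finset.sum_const, nsmul_eq_mul]
    refine mul_le_mul_of_nonneg_right ?_ (sq_nonneg _)
    exact_mod_cast PillowcaseCover.card_edgeFrom_le U n v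
  rw [Finset.sum_add_distrib, ← Finset.mul_sum, ← Finset.mul_sum, h2] at h1
  linarith

open Classical in
/-- The value of a section at the small square `(a, b)` of the tile `t`, transported to the centre
of the tile; it is zero if there is no such vertex. -/
noncomputable def tileValue (U : Set Ψ.Space) (n : ℕ) (t : T) (a b : ℕ) :
    F.Sections U n →ₗ[ℂ] F.fiber (Ψ.point t tileCentre) :=
  if h : ∃ (ha : a < n) (hb : b < n), Ψ.centre (t, ⟨a, ha⟩, ⟨b, hb⟩) ∈ U then
    (F.tileTransport t (squareCentre (t, (⟨a, h.1⟩ : Fin n), ⟨b, h.2.1⟩)) tileCentre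
      ).toLinearEquiv.toLinearMap ∘ₗ
      PiLp.projₗ 2 (fun v : Ψ.Vertex U n => F.fiber (Ψ.centre v.1))
        ⟨(t, ⟨a, h.1⟩, ⟨b, h.2.1⟩), h.2.2⟩
  else 0

theorem tileValue_apply (f : F.Sections U n) (v : Ψ.Vertex U n) :
    F.tileValue U n v.1.1 v.1.2.1 v.1.2.2 f =
      F.tileTransport v.1.1 (squareCentre v.1) tileCentre (f v) := by
  rw [tileValue, dif_pos ⟨v.1.2.1.2, v.1.2.2.2, v.2⟩]
  rfl

theorem tileValue_of_not {t : T} {a b : ℕ}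
    (h : ¬ ∃ (ha : a < n) (hb : b < n), Ψ.centre (t, ⟨a, ha⟩, ⟨b, hb⟩) ∈ U)
    (f : F.Sections U n) : F.tileValue U n t a b f = 0 := by
  rw [tileValue, dif_neg h, LinearMap.zero_apply]

theorem norm_sq_eq_sum_tileValue [Fintype T] (f : F.Sections U n) :
    ‖f‖ ^ 2 = ∑ t, ∑ a ∈ Finset.range n, ∑ b ∈ Finset.range n,
      ‖F.tileValue U n t a b f‖ ^ 2 := by
  rw [PiLp.norm_sq_eq_of_L2, PillowcaseCover.sum_vertex]
  refine Finset.sum_congr rfl fun t _ => Finset.sum_congr rfl fun a _ =>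
    Finset.sum_congr rfl fun b _ => ?_
  split_ifs with h
  · have := F.tileValue_apply f ⟨(t, ⟨a, h.1⟩, ⟨b, h.2.1⟩), h.2.2⟩
    rw [this]
    exact congrArg (· ^ 2) (LinearIsometryEquiv.norm_map _ _).symm
  · rw [F.tileValue_of_not h]
    simp

theorem fiberCongr_point (t : T) {p q : I × I} (h : p = q) (heq : Ψ.point t p = Ψ.point t q)
    (f : F.fiber (Ψ.point t p)) : F.fiberCongr heq f = F.tileTransport t p q f := by
  subst h
  simp

/-- The difference along an edge which stays in a tile. -/
theorem norm_tileValue_sub_sq_le [Finite T] (f : F.Sections U n) {t : T} {p q : Fin n × Fin n}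
    (hp : Ψ.centre (t, p) ∈ U) (hq : Ψ.centre (t, q) ∈ U) (hU : Ψ.openTile t ⊆ U) {k l : Fin 4}
    (hkl : k ≠ l)
    (h : subSquare n p.1 p.2 (squareSide k unitHalf) = subSquare n q.1 q.2 (squareSide l unitHalf))
    (hmem : subSquare n p.1 p.2 (squareSide k unitHalf) ∈
      {p : I × I | 0 < p.1 ∧ p.1 < 1 ∧ 0 < p.2 ∧ p.2 < 1}) :
    ‖F.tileValue U n t p.1 p.2 f - F.tileValue U n t q.1 q.2 f‖ ^ 2 ≤
      F.energyAt f ⟨(t, p), hp⟩ := by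
  let e : Ψ.EdgeFrom U n ⟨(t, p), hp⟩ := ⟨(k, (⟨(t, q), hq⟩, l)),
    fun h => hkl (congrArg Prod.snd h), congrArg (Ψ.point t) h, hU ⟨_, hmem, rfl⟩⟩
  refine le_trans (le_of_eq ?_) (Finset.single_le_sum
    (f := fun e : Ψ.EdgeFrom U n ⟨(t, p), hp⟩ => ‖F.edgeDiff e f‖ ^ 2)
    (fun _ _ => sq_nonneg _) (Finset.mem_univ e))
  have h1 := F.tileValue_apply f ⟨(t, p), hp⟩
  have h2 := F.tileValue_apply f ⟨(t, q), hq⟩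
  have h3 := F.transport_edge e (f ⟨(t, q), hq⟩)
  have h4 := F.fiberCongr_point t h.symm e.point_eq.symm
    (F.tileTransport t (squareCentre (t, q)) (squareMid (t, q) l) (f ⟨(t, q), hq⟩))
  have h5 := F.tileTransport_trans t (squareCentre (t, q)) (squareMid (t, q) l)
    (squareMid (t, p) k) (f ⟨(t, q), hq⟩)
  have h6 := F.tileTransport_trans t (squareCentre (t, q)) (squareMid (t, p) k)
    (squareCentre (t, p)) (f ⟨(t, q), hq⟩)
  have h7 := F.tileTransport_trans t (squareCentre (t, q))
    (squareCentre (t, p)) tileCentre (f ⟨(t, q), hq⟩)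
  have h8 : F.transport e.path (f ⟨(t, q), hq⟩) =
      F.tileTransport t (squareCentre (t, q)) (squareCentre (t, p)) (f ⟨(t, q), hq⟩) :=
    h3.trans ((congrArg (F.tileTransport t (squareMid (t, p) k) (squareCentre (t, p)))
      (h4.trans h5)).trans h6)
  let x : F.fiber (Ψ.point t (squareCentre (t, p))) := f ⟨(t, p), hp⟩
  have h9 : F.edgeDiff e f = x -
      F.tileTransport t (squareCentre (t, q)) (squareCentre (t, p)) (f ⟨(t, q), hq⟩) :=
    congrArg (fun y => f ⟨(t, p), hp⟩ - y) h8
  have h10 := LinearIsometryEquiv.norm_map (F.tileTransport t (squareCentre (t, p)) tileCentre)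
    (x - F.tileTransport t (squareCentre (t, q)) (squareCentre (t, p)) (f ⟨(t, q), hq⟩))
  rw [map_sub, h7] at h10
  change ‖F.tileValue U n t p.1 p.2 f - F.tileValue U n t q.1 q.2 f‖ ^ 2 = ‖F.edgeDiff e f‖ ^ 2
  rw [h9]
  exact congrArg (· ^ 2) ((congrArg norm (congrArg₂ (· - ·) h1 h2)).trans h10)

theorem tileTransport_fiberCongr_tileTransport {d : T × Fin 4} (hd : Ψ.glue d ≠ d) {x : I}
    {p p' : I × I} (hp : p = squareSide d.2 x) (hp' : p' = squareSide (Ψ.glue d).2 (σ x))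
    (heq : Ψ.point (Ψ.glue d).1 p' = Ψ.point d.1 p)
    (g : F.fiber (Ψ.point (Ψ.glue d).1 tileCentre)) :
    F.tileTransport d.1 p tileCentre (F.fiberCongr heq
      (F.tileTransport (Ψ.glue d).1 tileCentre p' g)) = F.sideTransport hd 0 g := by
  subst hp hp'
  rw [F.sideTransport_eq hd 0 x]
  rfl

/-- The difference along an edge which crosses a side of a tile. -/
theorem norm_tileValue_sub_sideTransport_sq_le [Finite T] (hU : Ψ.IsTiledOpen U)
    (f : F.Sections U n) {d : T × Fin 4}
    (hd : d ∈ Ψ.innerSides U) (i : Fin n) :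
    ‖F.tileValue U n d.1 (sideSquare n d.2 i).1 (sideSquare n d.2 i).2 f -
      F.sideTransport hd.1 0 (F.tileValue U n (Ψ.glue d).1 (sideSquare n (Ψ.glue d).2 i.rev).1
        (sideSquare n (Ψ.glue d).2 i.rev).2 f)‖ ^ 2 ≤
      F.energyAt f ⟨(d.1, sideSquare n d.2 i), (hU.centre_mem_iff _).2 hd.2.2.1⟩ := by
  set v : Ψ.Vertex U n := ⟨(d.1, sideSquare n d.2 i), (hU.centre_mem_iff _).2 hd.2.2.1⟩ with hv
  set w : Ψ.Vertex U n := ⟨((Ψ.glue d).1, sideSquare n (Ψ.glue d).2 i.rev),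
    (hU.centre_mem_iff _).2 hd.2.2.2⟩ with hw
  have hp : squareMid v.1 d.2 = squareSide d.2 (shrink n i unitHalf) := subSquare_sideSquare _ _
  have hp' : squareMid w.1 (Ψ.glue d).2 =
      squareSide (Ψ.glue d).2 (σ (shrink n i unitHalf)) := by
    rw [symm_shrink, symm_unitHalf]
    exact subSquare_sideSquare _ _
  have heq : Ψ.point d.1 (squareMid v.1 d.2) =
      Ψ.point (Ψ.glue d).1 (squareMid w.1 (Ψ.glue d).2) := by
    rw [hp, hp', Ψ.point_squareSide_glue hd.1]
  let e : Ψ.EdgeFrom U n v := ⟨(d.2, (w, (Ψ.glue d).2)),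
    fun h => hd.1 (Prod.ext (congrArg (fun x => x.1.1.1) h).symm (congrArg Prod.snd h).symm), heq,
    hd.2.1 ⟨shrink n i unitHalf, ⟨shrink_pos _ unitHalf_pos, shrink_lt_one _ unitHalf_lt_one⟩,
      congrArg (Ψ.point d.1) hp.symm⟩⟩
  refine le_trans (le_of_eq ?_) (Finset.single_le_sum
    (f := fun e : Ψ.EdgeFrom U n v => ‖F.edgeDiff e f‖ ^ 2)
    (fun _ _ => sq_nonneg _) (Finset.mem_univ e))
  have h1 := F.tileValue_apply f v
  have h2 := F.tileValue_apply f w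
  have h3 := F.transport_edge e (f w)
  have h4 := F.tileTransport_trans (Ψ.glue d).1 (squareCentre w.1) tileCentre
    (squareMid w.1 (Ψ.glue d).2) (f w)
  have h5 := F.tileTransport_fiberCongr_tileTransport hd.1 hp hp' heq.symm
    (F.tileTransport (Ψ.glue d).1 (squareCentre w.1) tileCentre (f w))
  rw [h4] at h5
  have h6 := F.tileTransport_trans d.1 (squareMid v.1 d.2) (squareCentre v.1) tileCentre
    (F.fiberCongr heq.symm (F.tileTransport (Ψ.glue d).1 (squareCentre w.1)
      (squareMid w.1 (Ψ.glue d).2) (f w)))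
  have h7 : F.tileTransport d.1 (squareCentre v.1) tileCentre (F.transport e.path (f w)) =
      F.sideTransport hd.1 0 (F.tileTransport (Ψ.glue d).1 (squareCentre w.1) tileCentre (f w)) :=
    (congrArg (F.tileTransport d.1 (squareCentre v.1) tileCentre) h3).trans (h6.trans h5)
  have h8 := LinearIsometryEquiv.norm_map (F.tileTransport d.1 (squareCentre v.1) tileCentre)
    (f v - F.transport e.path (f w))
  have h9 : F.tileTransport d.1 (squareCentre v.1) tileCentre (f v - F.transport e.path (f w)) =
      F.tileValue U n d.1 (sideSquare n d.2 i).1 (sideSquare n d.2 i).2 f -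
      F.sideTransport hd.1 0 (F.tileValue U n (Ψ.glue d).1 (sideSquare n (Ψ.glue d).2 i.rev).1
        (sideSquare n (Ψ.glue d).2 i.rev).2 f) :=
    (map_sub _ _ _).trans (congrArg₂ (· - ·) h1.symm
      (h7.trans (congrArg (F.sideTransport hd.1 0) h2.symm)))
  rw [h9] at h8
  exact congrArg (· ^ 2) h8

end FlatUnitaryBundle

/-! ### The eigenvalues of the discrete Laplacian -/

namespace FlatUnitaryBundle

variable {T : Type*} {Ψ : PillowcaseCover T} (F : FlatUnitaryBundle Ψ.Space)
  {U : Set Ψ.Space} {n : ℕ}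

/-- The difference of a section between neighbouring small squares of a tile is bounded by its
energy at the first one; both vanish over the tiles outside `U`. -/
theorem norm_tileValue_sub_sq_le_dite [Finite T] (hU : Ψ.IsTiledOpen U) (f : F.Sections U n)
    (t : T) {p q : Fin n × Fin n} {k l : Fin 4} (hkl : k ≠ l)
    (h : subSquare n p.1 p.2 (squareSide k unitHalf) = subSquare n q.1 q.2 (squareSide l unitHalf))
    (hmem : subSquare n p.1 p.2 (squareSide k unitHalf) ∈
      {p : I × I | 0 < p.1 ∧ p.1 < 1 ∧ 0 < p.2 ∧ p.2 < 1}) :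
    ‖F.tileValue U n t q.1 q.2 f - F.tileValue U n t p.1 p.2 f‖ ^ 2 ≤
      open Classical in
      if h : ∃ (ha : (p.1 : ℕ) < n) (hb : (p.2 : ℕ) < n),
          Ψ.centre (t, ⟨p.1, ha⟩, ⟨p.2, hb⟩) ∈ U then
        F.energyAt f ⟨(t, ⟨p.1, h.1⟩, ⟨p.2, h.2.1⟩), h.2.2⟩ else 0 := by
  split_ifs with hp
  · have hU' := (hU.centre_mem_iff _).1 hp.2.2
    rw [norm_sub_rev]
    exact F.norm_tileValue_sub_sq_le f ((hU.centre_mem_iff (t, p)).2 hU')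
      ((hU.centre_mem_iff (t, q)).2 hU') hU' hkl h hmem
  · have hp' : ¬ Ψ.openTile t ⊆ U := fun h' => hp ⟨p.1.2, p.2.2, (hU.centre_mem_iff _).2 h'⟩
    rw [F.tileValue_of_not fun ⟨_, _, h'⟩ => hp' ((hU.centre_mem_iff _).1 h'),
      F.tileValue_of_not fun ⟨_, _, h'⟩ => hp' ((hU.centre_mem_iff _).1 h')]
    simp

theorem sum_gridEnergyH_tileValue_le [Fintype T] (hU : Ψ.IsTiledOpen U) (f : F.Sections U n) :
    ∑ t, gridEnergyH n (fun a b => F.tileValue U n t a b f) ≤ F.energy f := by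
  classical
  rw [energy, PillowcaseCover.sum_vertex]
  refine Finset.sum_le_sum fun t _ => ?_
  rw [gridEnergyH, Finset.sum_comm]
  refine le_trans (Finset.sum_le_sum (g := fun a => ∑ b ∈ Finset.range n,
    if h : ∃ (ha : a < n) (hb : b < n), Ψ.centre (t, ⟨a, ha⟩, ⟨b, hb⟩) ∈ U then
        F.energyAt f ⟨(t, ⟨a, h.1⟩, ⟨b, h.2.1⟩), h.2.2⟩ else 0)
    fun a ha => Finset.sum_le_sum fun b hb => ?_)
    (Finset.sum_le_sum_of_subset_of_nonneg (Finset.range_mono (Nat.sub_le n 1))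
      fun a _ _ => Finset.sum_nonneg fun b _ => ?_)
  · have ha' : a + 1 < n := by have := Finset.mem_range.1 ha; omega
    have hb' := Finset.mem_range.1 hb
    have hs := shrink_one_eq_shrink_zero (a := (⟨a, by omega⟩ : Fin n)) (a' := ⟨a + 1, ha'⟩) rfl
    refine F.norm_tileValue_sub_sq_le_dite hU f t (p := (⟨a, by omega⟩, ⟨b, hb'⟩))
      (q := (⟨a + 1, ha'⟩, ⟨b, hb'⟩)) (k := 1) (l := 3) (by decide) ?_ ?_
    · simp only [subSquare, squareSide, symm_unitHalf, hs]
    · refine ⟨shrink_one_pos _, ?_, shrink_pos _ unitHalf_pos, shrink_lt_one _ unitHalf_lt_one⟩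
      change shrink n _ 1 < 1
      rw [hs]
      exact shrink_zero_lt_one _
  · split_ifs
    · exact F.energyAt_nonneg f _
    · exact le_rfl

theorem sum_gridEnergyV_tileValue_le [Fintype T] (hU : Ψ.IsTiledOpen U) (f : F.Sections U n) :
    ∑ t, gridEnergyV n (fun a b => F.tileValue U n t a b f) ≤ F.energy f := by
  classical
  rw [energy, PillowcaseCover.sum_vertex]
  refine Finset.sum_le_sum fun t _ => ?_
  rw [gridEnergyV]
  refine Finset.sum_le_sum fun a ha => ?_
  refine le_trans (Finset.sum_le_sum (g := fun b =>
    if h : ∃ (ha : a < n) (hb : b < n), Ψ.centre (t, ⟨a, ha⟩, ⟨b, hb⟩) ∈ U then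
        F.energyAt f ⟨(t, ⟨a, h.1⟩, ⟨b, h.2.1⟩), h.2.2⟩ else 0) fun b hb => ?_)
    (Finset.sum_le_sum_of_subset_of_nonneg (Finset.range_mono (Nat.sub_le n 1)) fun b _ _ => ?_)
  · have hb' : b + 1 < n := by have := Finset.mem_range.1 hb; omega
    have ha' := Finset.mem_range.1 ha
    have hs := shrink_one_eq_shrink_zero (a := (⟨b, by omega⟩ : Fin n)) (a' := ⟨b + 1, hb'⟩) rfl
    refine F.norm_tileValue_sub_sq_le_dite hU f t (p := (⟨a, ha'⟩, ⟨b, by omega⟩))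
      (q := (⟨a, ha'⟩, ⟨b + 1, hb'⟩)) (k := 2) (l := 0) (by decide) ?_ ?_
    · simp only [subSquare, squareSide, symm_unitHalf, hs]
    · simp only [subSquare, squareSide, symm_unitHalf, hs]
      exact ⟨shrink_pos _ unitHalf_pos, shrink_lt_one _ unitHalf_lt_one, hs ▸ shrink_one_pos _,
        shrink_zero_lt_one _⟩
  · split_ifs
    · exact F.energyAt_nonneg f _
    · exact le_rfl

/-- The sums of the differences of a section over a glued side are controlled by its energy. -/
theorem sum_norm_tileValue_sub_sideTransport_sq_le [Finite T] (hU : Ψ.IsTiledOpen U)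
    (f : F.Sections U n) {d : T × Fin 4} (hd : d ∈ Ψ.innerSides U) :
    ∑ i : Fin n, ‖F.tileValue U n d.1 (sideSquare n d.2 i).1 (sideSquare n d.2 i).2 f -
      F.sideTransport hd.1 0 (F.tileValue U n (Ψ.glue d).1 (sideSquare n (Ψ.glue d).2 i.rev).1
        (sideSquare n (Ψ.glue d).2 i.rev).2 f)‖ ^ 2 ≤ F.energy f := by
  classical
  refine (Finset.sum_le_sum fun i _ =>
    F.norm_tileValue_sub_sideTransport_sq_le hU f hd i).trans ?_
  have hinj : Function.Injective fun i : Fin n =>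
      (⟨(d.1, sideSquare n d.2 i), (hU.centre_mem_iff _).2 hd.2.2.1⟩ : Ψ.Vertex U n) := by
    intro i j h
    exact sideSquare_injective n d.2 (congrArg (fun v => v.1.2) h)
  rw [← Finset.sum_image (f := fun v => F.energyAt f v) hinj.injOn]
  exact Finset.sum_le_sum_of_subset_of_nonneg (Finset.subset_univ _)
    fun v _ _ => F.energyAt_nonneg f v

/-- The sums of the values of a section over the blocks of side `l` of the tiles. -/
noncomputable def blockSum (U : Set Ψ.Space) (n l N : ℕ) :
    F.Sections U n →ₗ[ℂ] (∀ t : T, Fin N × Fin N → F.fiber (Ψ.point t tileCentre)) :=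
  LinearMap.pi fun t => LinearMap.pi fun p =>
    ∑ a ∈ (Finset.range n).filter (fun a => a / l = p.1),
      ∑ b ∈ (Finset.range n).filter (fun b => b / l = p.2), F.tileValue U n t a b

/-- The hypothesis `n ≤ N l` says that the blocks cover the tiles. -/
theorem norm_sq_le_of_blockSum_eq_zero [Finite T] (hU : Ψ.IsTiledOpen U) (f : F.Sections U n)
    {l N : ℕ} (hl : 1 ≤ l) (hN : n ≤ N * l) (h : F.blockSum U n l N f = 0) :
    ‖f‖ ^ 2 ≤ 4 * ((l : ℝ) - 1) * l * F.energy f := by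
  cases nonempty_fintype T
  have hl' : (1 : ℝ) ≤ l := by exact_mod_cast hl
  rw [F.norm_sq_eq_sum_tileValue]
  have h1 : ∀ t, ∑ a ∈ Finset.range n, ∑ b ∈ Finset.range n, ‖F.tileValue U n t a b f‖ ^ 2 ≤
      2 * ((l : ℝ) - 1) * l * (gridEnergyH n (fun a b => F.tileValue U n t a b f) +
        gridEnergyV n (fun a b => F.tileValue U n t a b f)) := by
    intro t
    refine sum_norm_sq_le_of_block_sum_eq_zero (fun a b => F.tileValue U n t a b f) n hl ?_
    intro i j
    have hlt : ∀ a ∈ Finset.range n, a / l < N := fun a ha =>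
      (Nat.div_lt_iff_lt_mul hl).2 ((Finset.mem_range.1 ha).trans_le hN)
    by_cases hi : i < N
    · by_cases hj : j < N
      · have := congrFun (congrFun h t) (⟨i, hi⟩, ⟨j, hj⟩)
        simpa [blockSum] using this
      · refine Finset.sum_eq_zero fun a _ => Finset.sum_eq_zero fun b hb => ?_
        rw [Finset.mem_filter] at hb
        exact absurd (hb.2 ▸ hlt b hb.1) hj
    · refine Finset.sum_eq_zero fun a ha => ?_
      rw [Finset.mem_filter] at ha
      exact absurd (ha.2 ▸ hlt a ha.1) hi
  refine (Finset.sum_le_sum fun t _ => h1 t).trans ?_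
  rw [← Finset.mul_sum, Finset.sum_add_distrib]
  have h2 := F.sum_gridEnergyH_tileValue_le hU f
  have h3 := F.sum_gridEnergyV_tileValue_le hU f
  have h4 : 0 ≤ ((l : ℝ) - 1) * l := mul_nonneg (by linarith) (by linarith)
  nlinarith

theorem finrank_blockSum_codomain [Fintype T] (N : ℕ) :
    Module.finrank ℂ (∀ t : T, Fin N × Fin N → F.fiber (Ψ.point t tileCentre)) =
      (∑ t, Module.finrank ℂ (F.fiber (Ψ.point t tileCentre))) * N ^ 2 := by
  rw [Module.finrank_pi_fintype, Finset.sum_mul]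
  refine Finset.sum_congr rfl fun t _ => ?_
  rw [Module.finrank_pi_fintype]
  simp
  ring

theorem isSymmetric_sq_smul_laplacian [Finite T] :
    ((n : ℂ) ^ 2 • F.laplacian U n).IsSymmetric :=
  F.isSymmetric_laplacian.smul (by simp)

theorem re_inner_sq_smul_laplacian [Finite T] (f : F.Sections U n) :
    (inner ℂ f (((n : ℂ) ^ 2 • F.laplacian U n) f)).re = (n : ℝ) ^ 2 * (F.energy f / 2) := by
  rw [LinearMap.smul_apply, inner_smul_right, ← F.re_inner_laplacian,
    show (n : ℂ) ^ 2 = (((n : ℝ) ^ 2 : ℝ) : ℂ) by push_cast; rfl, Complex.re_ofReal_mul]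

/-- The number of eigenvalues of `n² Δ` below `N² / 16` is at most a constant times `N²`: a section
whose sums over about `N²` blocks of each tile vanish has large energy. -/
theorem card_eigenvalues_laplacian_lt_le [Fintype T] (hU : Ψ.IsTiledOpen U) (hn : 1 ≤ n) {N : ℕ}
    (hN : 1 ≤ N) :
    (Finset.univ.filter fun i =>
      (F.isSymmetric_sq_smul_laplacian (U := U) (n := n)).eigenvalues rfl i <
        (N : ℝ) ^ 2 / 16).card ≤
      (∑ t, Module.finrank ℂ (F.fiber (Ψ.point t tileCentre))) * N ^ 2 := by
  -- the side of the blocks is `l = ⌈n / N⌉`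
  obtain ⟨l, hl, hnl, hle⟩ : ∃ l : ℕ, 1 ≤ l ∧ n ≤ N * l ∧
      (N : ℝ) ^ 2 * (((l : ℝ) - 1) * l) ≤ 2 * (n : ℝ) ^ 2 := by
    have h1 := Nat.div_add_mod (n - 1) N
    have h2 := Nat.mod_lt (n - 1) hN
    refine ⟨(n - 1) / N + 1, Nat.le_add_left 1 _, ?_, ?_⟩
    · rw [Nat.mul_add]
      omega
    · have h3 : N * ((n - 1) / N) ≤ n := by omega
      have h4 : (N : ℝ) * ((n - 1) / N : ℕ) ≤ n := by exact_mod_cast h3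
      push_cast
      set q : ℝ := (((n - 1) / N : ℕ) : ℝ) with hq
      rcases Nat.eq_zero_or_pos ((n - 1) / N) with h0 | h0
      · have : q = 0 := by rw [hq, h0]; simp
        rw [this]
        simp
      · have h5 : (1 : ℝ) ≤ q := by rw [hq]; exact_mod_cast h0
        have h6 : (N : ℝ) * (q + 1) ≤ 2 * n := by
          have : (0 : ℝ) ≤ N := Nat.cast_nonneg N
          nlinarith
        have h7 : 0 ≤ (N : ℝ) * q := by positivity
        have h8 : 0 ≤ (N : ℝ) * (q + 1) := by positivity
        calc (N : ℝ) ^ 2 * ((q + 1 - 1) * (q + 1)) = (N * q) * (N * (q + 1)) := by ring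
          _ ≤ n * (2 * n) := mul_le_mul h4 h6 h8 (Nat.cast_nonneg n)
          _ = 2 * (n : ℝ) ^ 2 := by ring
  have h := card_eigenvalues_lt_le (F.isSymmetric_sq_smul_laplacian (U := U) (n := n))
    (F.blockSum U n l N) (c := (N : ℝ) ^ 2 / 16) ?_
  · rwa [F.finrank_blockSum_codomain] at h
  · intro f hf
    have h1 := F.norm_sq_le_of_blockSum_eq_zero hU f hl hnl hf
    rw [F.re_inner_sq_smul_laplacian]
    have h2 := mul_le_mul_of_nonneg_right hle (F.energy_nonneg f)
    have h3 := mul_le_mul_of_nonneg_left h1 (by positivity : (0 : ℝ) ≤ (N : ℝ) ^ 2 / 16)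
    linarith

end FlatUnitaryBundle

/-! ### The spectral gap -/

/-- The trace inequality for the small squares along any side of a tile. -/
theorem sum_sideSquare_norm_sq_le {E : Type*} [NormedAddCommGroup E] [NormedSpace ℂ E]
    (g : ℕ → ℕ → E) {n : ℕ} (h0 : ∑ a ∈ Finset.range n, ∑ b ∈ Finset.range n, g a b = 0)
    (k : Fin 4) :
    ∑ i : Fin n, ‖g (sideSquare n k i).1 (sideSquare n k i).2‖ ^ 2 ≤
      2 * n * (gridEnergyH n g + gridEnergyV n g) := by
  rcases Nat.eq_zero_or_pos n with rfl | hn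
  · simp
  have hrev : ∀ f : ℕ → ℝ, ∑ i : Fin n, f i.rev = ∑ b ∈ Finset.range n, f b := fun f =>
    (Equiv.sum_comp Fin.revPerm fun i : Fin n => f i).trans (Finset.sum_range f).symm
  fin_cases k
  · exact (Finset.sum_range fun a => ‖g a 0‖ ^ 2).symm.trans_le (sum_row_norm_sq_le g h0 hn)
  · exact (Finset.sum_range fun b => ‖g (n - 1) b‖ ^ 2).symm.trans_le
      (sum_column_norm_sq_le g h0 (Nat.sub_one_lt hn.ne'))
  · exact (hrev fun a => ‖g a (n - 1)‖ ^ 2).trans_le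
      (sum_row_norm_sq_le g h0 (Nat.sub_one_lt hn.ne'))
  · exact (hrev fun b => ‖g 0 b‖ ^ 2).trans_le (sum_column_norm_sq_le g h0 hn)

/-- A linear map between finite-dimensional Hermitian spaces is bounded from below on the
orthogonal complement of its kernel. -/
theorem exists_norm_sq_le_of_mem_orthogonal_ker {V W : Type*} [NormedAddCommGroup V]
    [InnerProductSpace ℂ V] [FiniteDimensional ℂ V] [NormedAddCommGroup W] [NormedSpace ℂ W]
    (L : V →ₗ[ℂ] W) :
    ∃ K : ℝ, 0 ≤ K ∧ ∀ x ∈ (LinearMap.ker L)ᗮ, ‖x‖ ^ 2 ≤ K * ‖L x‖ ^ 2 := by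
  have hker : LinearMap.ker (L.domRestrict (LinearMap.ker L)ᗮ) = ⊥ := by
    rw [LinearMap.ker_eq_bot']
    intro x hx
    have h : (x : V) ∈ LinearMap.ker L ⊓ (LinearMap.ker L)ᗮ := ⟨hx, x.2⟩
    rw [Submodule.inf_orthogonal_eq_bot] at h
    exact Subtype.ext h
  obtain ⟨K, -, hK⟩ := LinearMap.exists_antilipschitzWith _ hker
  refine ⟨(K : ℝ) ^ 2, sq_nonneg _, fun x hx => ?_⟩
  have h : ‖x‖ ≤ K * ‖L x‖ := by
    have h := hK.le_mul_dist ⟨x, hx⟩ 0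
    rw [map_zero, dist_zero_right, dist_zero_right] at h
    exact h
  rw [← mul_pow]
  exact pow_le_pow_left₀ (norm_nonneg x) h 2

namespace FlatUnitaryBundle

variable {T : Type*} {Ψ : PillowcaseCover T} (F : FlatUnitaryBundle Ψ.Space)
  {U : Set Ψ.Space} {n : ℕ}

/-- Families of vectors over the centres of the tiles. -/
abbrev TileSections {T : Type*} {Ψ : PillowcaseCover T} (F : FlatUnitaryBundle Ψ.Space) : Type _ :=
  PiLp 2 fun t : T => F.fiber (Ψ.point t tileCentre)

open Classical in
/-- The differences of a family of vectors over the centres of the tiles across the sides inside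
`U`. Its kernel consists of the flat sections over `U`, and of arbitrary vectors over the tiles
outside `U`. -/
noncomputable def tileDiff (U : Set Ψ.Space) :
    F.TileSections →ₗ[ℂ] PiLp 2 fun d : T × Fin 4 => F.fiber (Ψ.point d.1 tileCentre) where
  toFun x := WithLp.toLp 2 fun d => if h : d ∈ Ψ.innerSides U then
    x d.1 - F.sideTransport h.1 0 (x (Ψ.glue d).1) else 0
  map_add' x y := by
    ext d
    by_cases h : d ∈ Ψ.innerSides U
    · simp [h]
      abel
    · simp [h]
  map_smul' c x := by
    ext d
    by_cases h : d ∈ Ψ.innerSides U <;> simp [h, smul_sub]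

theorem tileDiff_apply {d : T × Fin 4} (h : d ∈ Ψ.innerSides U) (x : F.TileSections) :
    F.tileDiff U x d = x d.1 - F.sideTransport h.1 0 (x (Ψ.glue d).1) := by
  simp [tileDiff, h]

theorem tileDiff_apply_of_notMem {d : T × Fin 4} (h : d ∉ Ψ.innerSides U) (x : F.TileSections) :
    F.tileDiff U x d = 0 := by
  simp [tileDiff, h]

/-- The section which is flat on each tile, with prescribed values at the centres. -/
noncomputable def ofTileSections (U : Set Ψ.Space) (n : ℕ) (x : F.TileSections) : F.Sections U n :=
  WithLp.toLp 2 fun v => F.tileTransport v.1.1 tileCentre (squareCentre v.1) (x v.1.1)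

/-- A family of vectors without jumps across the sides inside `U` extends to a flat section, which
is harmonic. -/
theorem laplacian_ofTileSections [Finite T] (hU : Ψ.IsTiledOpen U) {x : F.TileSections}
    (hx : F.tileDiff U x = 0) : F.laplacian U n (F.ofTileSections U n x) = 0 := by
  ext v
  refine Finset.sum_eq_zero fun e _ => sub_eq_zero.2 ?_
  symm
  refine (F.transport_edge e _).trans ?_
  have h1 := F.tileTransport_trans e.head.1.1 tileCentre (squareCentre e.head.1)
    (squareMid e.head.1 e.headSide) (x e.head.1.1)
  have h2 : F.fiberCongr e.point_eq.symm (F.tileTransport e.head.1.1 tileCentre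
      (squareMid e.head.1 e.headSide) (x e.head.1.1)) =
      F.tileTransport v.1.1 tileCentre (squareMid v.1 e.side) (x v.1.1) := by
    rcases e.eq_or_isAcross with h | ⟨d, h⟩
    · exact F.tileTransport_of_eq (fun t => x t) h _
    · refine F.tileTransport_of_isAcross (fun t => x t) (fun hd => ?_) h _
      have h3 := F.tileDiff_apply (e.mem_innerSides hU h) x
      rw [hx] at h3
      exact (sub_eq_zero.1 h3.symm).symm
  have h3 := F.tileTransport_trans v.1.1 tileCentre (squareMid v.1 e.side) (squareCentre v.1)
    (x v.1.1)
  refine Eq.trans (congrArg _ ?_) h3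
  exact (congrArg _ h1).trans h2

/-- The means of a section over the tiles. -/
noncomputable def tileMean (f : F.Sections U n) : F.TileSections :=
  WithLp.toLp 2 fun t => ((n : ℂ) ^ 2)⁻¹ • ∑ a ∈ Finset.range n, ∑ b ∈ Finset.range n,
    F.tileValue U n t a b f

theorem sum_tileValue_sub_tileMean (hn : 1 ≤ n) (f : F.Sections U n) (t : T) :
    ∑ a ∈ Finset.range n, ∑ b ∈ Finset.range n,
      (F.tileValue U n t a b f - F.tileMean f t) = 0 := by
  have hn0 : (n : ℂ) ≠ 0 := by exact_mod_cast (by omega : n ≠ 0)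
  simp only [Finset.sum_sub_distrib, Finset.sum_const, Finset.card_range]
  rw [sub_eq_zero, ← mul_nsmul, ← Nat.cast_smul_eq_nsmul ℂ]
  change _ = ((n * n : ℕ) : ℂ) • (((n : ℂ) ^ 2)⁻¹ • _)
  rw [smul_smul]
  push_cast
  rw [← sq, mul_inv_cancel₀ (pow_ne_zero 2 hn0), one_smul]

theorem inner_ofTileSections [Fintype T] (hn : 1 ≤ n) (x : F.TileSections) (f : F.Sections U n) :
    inner ℂ (F.ofTileSections U n x) f = (n : ℂ) ^ 2 * inner ℂ x (F.tileMean f) := by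
  have hn0 : (n : ℂ) ≠ 0 := by exact_mod_cast (by omega : n ≠ 0)
  rw [PiLp.inner_apply, PillowcaseCover.sum_vertex, PiLp.inner_apply, Finset.mul_sum]
  refine Finset.sum_congr rfl fun t _ => ?_
  change _ = (n : ℂ) ^ 2 * inner ℂ (x t) (((n : ℂ) ^ 2)⁻¹ • ∑ a ∈ Finset.range n,
    ∑ b ∈ Finset.range n, F.tileValue U n t a b f)
  rw [inner_smul_right, ← mul_assoc, mul_inv_cancel₀ (pow_ne_zero 2 hn0), one_mul, inner_sum]
  refine Finset.sum_congr rfl fun a _ => ?_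
  rw [inner_sum]
  refine Finset.sum_congr rfl fun b _ => ?_
  split_ifs with h
  · have h1 := F.tileValue_apply f ⟨(t, ⟨a, h.1⟩, ⟨b, h.2.1⟩), h.2.2⟩
    have h2 := F.tileTransport_trans t tileCentre
      (squareCentre (t, (⟨a, h.1⟩ : Fin n), (⟨b, h.2.1⟩ : Fin n))) tileCentre (x t)
    have h3 := LinearIsometryEquiv.inner_map_map (F.tileTransport t
      (squareCentre (t, (⟨a, h.1⟩ : Fin n), (⟨b, h.2.1⟩ : Fin n))) tileCentre)
      (F.tileTransport t tileCentre
        (squareCentre (t, (⟨a, h.1⟩ : Fin n), (⟨b, h.2.1⟩ : Fin n))) (x t))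
      (f ⟨(t, ⟨a, h.1⟩, ⟨b, h.2.1⟩), h.2.2⟩)
    rw [h2, F.tileTransport_self] at h3
    exact h3.symm.trans (congrArg (inner ℂ (x t)) h1.symm)
  · rw [F.tileValue_of_not h, inner_zero_right]

/-- The jump of the tile means of a section across a side is controlled by the energy. -/
theorem norm_tileDiff_tileMean_sq_le [Finite T] (hU : Ψ.IsTiledOpen U) (hn : 1 ≤ n)
    (f : F.Sections U n) {d : T × Fin 4} (hd : d ∈ Ψ.innerSides U) :
    ‖F.tileDiff U (F.tileMean f) d‖ ^ 2 ≤ 27 * F.energy f := by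
  cases nonempty_fintype T
  have hn1 : (1 : ℝ) ≤ n := by exact_mod_cast hn
  have htrace : ∀ t k, ∑ i : Fin n, ‖F.tileValue U n t (sideSquare n k i).1 (sideSquare n k i).2 f -
      F.tileMean f t‖ ^ 2 ≤ 4 * n * F.energy f := by
    intro t k
    have h1 := sum_sideSquare_norm_sq_le (fun a b => F.tileValue U n t a b f - F.tileMean f t)
      (F.sum_tileValue_sub_tileMean hn f t) k
    have h2 : gridEnergyH n (fun a b => F.tileValue U n t a b f - F.tileMean f t) ≤
        F.energy f := by
      refine le_trans ?_ (F.sum_gridEnergyH_tileValue_le hU f)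
      refine le_trans (le_of_eq ?_) (Finset.single_le_sum
        (f := fun t => gridEnergyH n (fun a b => F.tileValue U n t a b f)) (fun t _ => ?_)
        (Finset.mem_univ t))
      · simp only [gridEnergyH, sub_sub_sub_cancel_right]
      · exact Finset.sum_nonneg fun _ _ => Finset.sum_nonneg fun _ _ => sq_nonneg _
    have h3 : gridEnergyV n (fun a b => F.tileValue U n t a b f - F.tileMean f t) ≤
        F.energy f := by
      refine le_trans ?_ (F.sum_gridEnergyV_tileValue_le hU f)
      refine le_trans (le_of_eq ?_) (Finset.single_le_sum
        (f := fun t => gridEnergyV n (fun a b => F.tileValue U n t a b f)) (fun t _ => ?_)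
        (Finset.mem_univ t))
      · simp only [gridEnergyV, sub_sub_sub_cancel_right]
      · exact Finset.sum_nonneg fun _ _ => Finset.sum_nonneg fun _ _ => sq_nonneg _
    nlinarith
  have h1 := htrace d.1 d.2
  have h2 := htrace (Ψ.glue d).1 (Ψ.glue d).2
  rw [← Equiv.sum_comp Fin.revPerm] at h2
  have h3 := F.sum_norm_tileValue_sub_sideTransport_sq_le hU f hd
  have h4 : (n : ℝ) * ‖F.tileDiff U (F.tileMean f) d‖ ^ 2 ≤
      3 * (4 * n * F.energy f) + 3 * F.energy f + 3 * (4 * n * F.energy f) := by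
    refine le_trans ?_ (add_le_add (add_le_add (mul_le_mul_of_nonneg_left h1 (by norm_num))
      (mul_le_mul_of_nonneg_left h3 (by norm_num))) (mul_le_mul_of_nonneg_left h2 (by norm_num)))
    rw [Finset.mul_sum, Finset.mul_sum, Finset.mul_sum, ← Finset.sum_add_distrib,
      ← Finset.sum_add_distrib, show (n : ℝ) * ‖F.tileDiff U (F.tileMean f) d‖ ^ 2 =
        ∑ _i : Fin n, ‖F.tileDiff U (F.tileMean f) d‖ ^ 2 by simp]
    refine Finset.sum_le_sum fun i _ => ?_
    rw [F.tileDiff_apply hd]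
    change _ ≤ 3 * ‖F.tileValue U n d.1 (sideSquare n d.2 i).1 (sideSquare n d.2 i).2 f -
      F.tileMean f d.1‖ ^ 2 + 3 * _ + 3 * ‖F.tileValue U n (Ψ.glue d).1
        (sideSquare n (Ψ.glue d).2 i.rev).1 (sideSquare n (Ψ.glue d).2 i.rev).2 f -
      F.tileMean f (Ψ.glue d).1‖ ^ 2
    set x := F.tileValue U n d.1 (sideSquare n d.2 i).1 (sideSquare n d.2 i).2 f
    set y := F.tileValue U n (Ψ.glue d).1 (sideSquare n (Ψ.glue d).2 i.rev).1
      (sideSquare n (Ψ.glue d).2 i.rev).2 f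
    rw [← (F.sideTransport hd.1 0).norm_map (y - F.tileMean f (Ψ.glue d).1), map_sub]
    set z := F.sideTransport hd.1 0 y
    set m := F.tileMean f d.1
    set m' := F.sideTransport hd.1 0 (F.tileMean f (Ψ.glue d).1)
    have h5 : m - m' = -(x - m) + (x - z) + (z - m') := by abel
    have h6 : ‖m - m'‖ ≤ ‖x - m‖ + ‖x - z‖ + ‖z - m'‖ := by
      rw [h5]
      refine (norm_add₃_le).trans ?_
      rw [norm_neg]
    have h7 := pow_le_pow_left₀ (norm_nonneg _) h6 2
    nlinarith [sq_nonneg (‖x - m‖ - ‖x - z‖), sq_nonneg (‖x - z‖ - ‖z - m'‖),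
      sq_nonneg (‖x - m‖ - ‖z - m'‖)]
  have h5 := F.energy_nonneg f
  have h6 : (n : ℝ) * ‖F.tileDiff U (F.tileMean f) d‖ ^ 2 ≤ n * (27 * F.energy f) := by
    nlinarith
  exact le_of_mul_le_mul_left h6 (by linarith)

/-- Poincaré inequality: a section is controlled by its means over the tiles and its energy. -/
theorem norm_sq_le_tileMean [Fintype T] (hU : Ψ.IsTiledOpen U) (hn : 1 ≤ n)
    (f : F.Sections U n) :
    ‖f‖ ^ 2 ≤ 2 * (n : ℝ) ^ 2 * ‖F.tileMean f‖ ^ 2 + 8 * (n : ℝ) ^ 2 * F.energy f := by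
  have h1 : ∀ t, ∑ a ∈ Finset.range n, ∑ b ∈ Finset.range n, ‖F.tileValue U n t a b f‖ ^ 2 ≤
      2 * (n : ℝ) ^ 2 * ‖F.tileMean f t‖ ^ 2 + 4 * (n : ℝ) ^ 2 *
        (gridEnergyH n (fun a b => F.tileValue U n t a b f) +
          gridEnergyV n (fun a b => F.tileValue U n t a b f)) := by
    intro t
    have h2 : ∀ a ∈ Finset.range n, ∑ b ∈ Finset.range n,
        ‖F.tileValue U n t a b f - F.tileMean f t‖ ^ 2 ≤ 2 * n *
        (gridEnergyH n (fun a b => F.tileValue U n t a b f) +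
          gridEnergyV n (fun a b => F.tileValue U n t a b f)) := by
      intro a ha
      have h := sum_column_norm_sq_le (fun a b => F.tileValue U n t a b f - F.tileMean f t)
        (F.sum_tileValue_sub_tileMean hn f t) (Finset.mem_range.1 ha)
      simpa only [gridEnergyH, gridEnergyV, sub_sub_sub_cancel_right] using h
    have h3 := Finset.sum_le_sum h2
    rw [Finset.sum_const, Finset.card_range, nsmul_eq_mul] at h3
    have h4 : ∑ a ∈ Finset.range n, ∑ b ∈ Finset.range n, ‖F.tileValue U n t a b f‖ ^ 2 ≤
        ∑ a ∈ Finset.range n, ∑ b ∈ Finset.range n,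
          (2 * ‖F.tileMean f t‖ ^ 2 + 2 * ‖F.tileValue U n t a b f - F.tileMean f t‖ ^ 2) := by
      refine Finset.sum_le_sum fun a _ => Finset.sum_le_sum fun b _ => ?_
      have h5 : ‖F.tileValue U n t a b f‖ ≤
          ‖F.tileMean f t‖ + ‖F.tileValue U n t a b f - F.tileMean f t‖ := by
        have := norm_add_le (F.tileMean f t) (F.tileValue U n t a b f - F.tileMean f t)
        rwa [add_sub_cancel] at this
      have h6 := pow_le_pow_left₀ (norm_nonneg _) h5 2
      nlinarith [sq_nonneg (‖F.tileMean f t‖ - ‖F.tileValue U n t a b f - F.tileMean f t‖)]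
    simp only [Finset.sum_add_distrib, ← Finset.mul_sum, Finset.sum_const, Finset.card_range,
      nsmul_eq_mul] at h4
    linarith
  rw [F.norm_sq_eq_sum_tileValue, PiLp.norm_sq_eq_of_L2]
  refine (Finset.sum_le_sum fun t _ => h1 t).trans ?_
  rw [Finset.sum_add_distrib, ← Finset.mul_sum, ← Finset.mul_sum, Finset.sum_add_distrib]
  have h2 := F.sum_gridEnergyH_tileValue_le hU f
  have h3 := F.sum_gridEnergyV_tileValue_le hU f
  have h4 : (0 : ℝ) ≤ 4 * (n : ℝ) ^ 2 := by positivity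
  nlinarith

/-- Uniform spectral gap: the tile means of a section orthogonal to the flat sections are
controlled by their jumps across the sides. -/
theorem exists_norm_sq_le_energy [Finite T] (hU : Ψ.IsTiledOpen U) :
    ∃ K : ℝ, 0 < K ∧ ∀ n : ℕ, 1 ≤ n → ∀ f : F.Sections U n,
      (∀ g, F.laplacian U n g = 0 → inner ℂ g f = 0) → ‖f‖ ^ 2 ≤ K * (n : ℝ) ^ 2 * F.energy f := by
  cases nonempty_fintype T
  obtain ⟨K, hK0, hK⟩ := exists_norm_sq_le_of_mem_orthogonal_ker (F.tileDiff U)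
  refine ⟨2 * (K * (Fintype.card (T × Fin 4) * 27)) + 8, by positivity, fun n hn f hf => ?_⟩
  have hn0 : (n : ℂ) ≠ 0 := by exact_mod_cast (by omega : n ≠ 0)
  have h1 : F.tileMean f ∈ (LinearMap.ker (F.tileDiff U))ᗮ := by
    rw [Submodule.mem_orthogonal]
    intro x hx
    have h := hf _ (F.laplacian_ofTileSections (n := n) hU (LinearMap.mem_ker.1 hx))
    rw [F.inner_ofTileSections hn] at h
    exact (mul_eq_zero.1 h).resolve_left (pow_ne_zero 2 hn0)
  have h2 := hK _ h1
  have h3 : ‖F.tileDiff U (F.tileMean f)‖ ^ 2 ≤ Fintype.card (T × Fin 4) * (27 * F.energy f) := by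
    rw [PiLp.norm_sq_eq_of_L2, ← nsmul_eq_mul, ← Finset.card_univ, ← Finset.sum_const]
    refine Finset.sum_le_sum fun d _ => ?_
    by_cases hd : d ∈ Ψ.innerSides U
    · exact F.norm_tileDiff_tileMean_sq_le hU hn f hd
    · rw [F.tileDiff_apply_of_notMem hd, norm_zero]
      have := F.energy_nonneg f
      nlinarith
  have h4 := F.norm_sq_le_tileMean hU hn f
  have h5 := h2.trans (mul_le_mul_of_nonneg_left h3 hK0)
  have h6 := mul_le_mul_of_nonneg_left h5 (by positivity : (0 : ℝ) ≤ 2 * (n : ℝ) ^ 2)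
  linarith

/-- The rescaled Laplacians `n² Δ` of the discretizations of a tiled open set have a uniform
spectral gap, eigenvalues at most `64 n²`, and a uniformly bounded trace of `(1 + n² Δ)⁻²`. -/
theorem exists_spectralBounds [Finite T] (hU : Ψ.IsTiledOpen U) :
    ∃ c C₀ : ℝ, 0 < c ∧ 0 ≤ C₀ ∧ ∀ n : ℕ, 1 ≤ n →
      SpectralBounds ((n : ℂ) ^ 2 • F.laplacian U n) c (64 * (n : ℝ) ^ 2) C₀ := by
  cases nonempty_fintype T
  obtain ⟨K, hK0, hK⟩ := F.exists_norm_sq_le_energy hU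
  refine ⟨(2 * K)⁻¹, 2048 * (∑ t, Module.finrank ℂ (F.fiber (Ψ.point t tileCentre)) : ℕ),
    by positivity, by positivity, fun n hn => ?_⟩
  have hA := F.isSymmetric_sq_smul_laplacian (U := U) (n := n)
  have hn1 : (1 : ℝ) ≤ n := by exact_mod_cast hn
  have hn0 : (n : ℂ) ^ 2 ≠ 0 := pow_ne_zero 2 (by exact_mod_cast (by omega : n ≠ 0))
  have heig : ∀ i, hA.eigenvalues rfl i =
      (n : ℝ) ^ 2 * (F.energy (hA.eigenvectorBasis rfl i) / 2) := by
    intro i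
    rw [← F.re_inner_sq_smul_laplacian, hA.apply_eigenvectorBasis, inner_smul_right,
      inner_self_eq_norm_sq_to_K, (hA.eigenvectorBasis rfl).norm_eq_one]
    simp
  have hnonneg : ∀ i, 0 ≤ hA.eigenvalues rfl i := fun i => by
    rw [heig]
    have := F.energy_nonneg (hA.eigenvectorBasis rfl i)
    positivity
  refine ⟨hA, fun i => ?_, fun i => ?_, ?_⟩
  · refine or_iff_not_imp_left.2 fun hne => ?_
    have h1 := hK n hn (hA.eigenvectorBasis rfl i) (fun g hg => by
      have h2 := hA g (hA.eigenvectorBasis rfl i)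
      rw [LinearMap.smul_apply, hg, smul_zero, inner_zero_left, hA.apply_eigenvectorBasis,
        inner_smul_right] at h2
      refine (mul_eq_zero.1 h2.symm).resolve_left ?_
      exact fun h => hne (Complex.ofReal_eq_zero.1 h))
    rw [(hA.eigenvectorBasis rfl).norm_eq_one, one_pow] at h1
    rw [inv_le_iff_one_le_mul₀ (by positivity)]
    have h3 := heig i
    nlinarith
  · rw [heig]
    have h1 := F.energy_le (hA.eigenvectorBasis rfl i)
    rw [(hA.eigenvectorBasis rfl).norm_eq_one] at h1
    nlinarith
  · refine sum_inv_sq_le_of_card_le _ hnonneg fun N hN => ?_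
    exact_mod_cast F.card_eigenvalues_laplacian_lt_le hU hn hN

end FlatUnitaryBundle

/-! ### Approximation by functions Lipschitz on the tiles -/

section Bernstein

theorem bernstein_le_one {N : ℕ} (k : Fin (N + 1)) (x : I) : bernstein N k x ≤ 1 := by
  rw [← bernstein.probability N x]
  exact Finset.single_le_sum (f := fun k : Fin (N + 1) => bernstein N k x)
    (fun _ _ => bernstein_nonneg) (Finset.mem_univ k)

theorem exists_abs_bernstein_sub_le (N : ℕ) :
    ∃ K : ℝ, 0 ≤ K ∧ ∀ (k : Fin (N + 1)) (x y : I),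
      |bernstein N k x - bernstein N k y| ≤ K * |(x : ℝ) - y| := by
  have h : ∀ k : Fin (N + 1), ∃ K : ℝ, 0 ≤ K ∧ ∀ x y : I,
      |bernstein N k x - bernstein N k y| ≤ K * |(x : ℝ) - y| := by
    intro k
    set p := bernsteinPolynomial ℝ N k with hp
    obtain ⟨K, hK⟩ := (isCompact_Icc (a := (0 : ℝ)) (b := 1)).exists_bound_of_continuousOn
      p.derivative.continuous.continuousOn
    refine ⟨K, (norm_nonneg _).trans (hK 0 (by simp)), fun x y => ?_⟩
    have := (convex_Icc (0 : ℝ) 1).norm_image_sub_le_of_norm_deriv_le (f := fun x => p.eval x)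
      (C := K) (fun x _ => p.differentiable.differentiableAt)
      (fun x hx => by rw [Polynomial.deriv]; exact hK x hx) y.2 x.2
    exact this
  choose K hK0 hK using h
  refine ⟨∑ k, K k, Finset.sum_nonneg fun k _ => hK0 k, fun k x y => (hK k x y).trans ?_⟩
  exact mul_le_mul_of_nonneg_right (Finset.single_le_sum (fun k _ => hK0 k) (Finset.mem_univ k))
    (abs_nonneg _)

theorem bernstein_symm {N : ℕ} (k : Fin (N + 1)) (x : I) :
    bernstein N k.rev (σ x) = bernstein N k x := by
  have hk : (k : ℕ) ≤ N := Nat.lt_succ_iff.1 k.2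
  have hrev : (k.rev : ℕ) = N - k := by rw [Fin.val_rev]; omega
  rw [bernstein_apply, bernstein_apply, hrev, Nat.choose_symm hk, Nat.sub_sub_self hk,
    unitInterval.coe_symm_eq, sub_sub_cancel]
  ring

theorem bernstein_z_rev {N : ℕ} (hN : N ≠ 0) (k : Fin (N + 1)) :
    bernstein.z k.rev = σ (bernstein.z k) := by
  have hk : (k : ℕ) ≤ N := Nat.lt_succ_iff.1 k.2
  have hrev : (k.rev : ℕ) = N - k := by rw [Fin.val_rev]; omega
  have hN' : (N : ℝ) ≠ 0 := by exact_mod_cast hN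
  ext
  change ((k.rev : ℕ) : ℝ) / N = 1 - ((k : ℕ) : ℝ) / N
  rw [hrev, Nat.cast_sub hk]
  field_simp

/-- Bernstein approximation commutes with the reflection of the interval. -/
theorem bernsteinApproximation_symm {N : ℕ} (hN : N ≠ 0) (f g : C(I, ℝ))
    (hfg : ∀ x, g (σ x) = f x) (x : I) :
    bernsteinApproximation N g (σ x) = bernsteinApproximation N f x := by
  rw [bernsteinApproximation.apply, bernsteinApproximation.apply, ← Equiv.sum_comp Fin.revPerm]
  refine Finset.sum_congr rfl fun k _ => ?_
  rw [Fin.revPerm_apply, bernstein_symm, bernstein_z_rev hN, hfg]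

theorem bernsteinApproximation_apply_apply (N : ℕ) (f : C(I, C(I, ℝ))) (x y : I) :
    bernsteinApproximation N f x y = ∑ k : Fin (N + 1), bernstein N k x * f (bernstein.z k) y := by
  rw [bernsteinApproximation.apply, ContinuousMap.coe_sum, Finset.sum_apply]
  rfl

theorem abs_bernsteinApproximation_sub_le (N : ℕ) {f g : C(I, ℝ)} {δ : ℝ}
    (h : ∀ x, |f x - g x| ≤ δ) (x : I) :
    |bernsteinApproximation N f x - bernsteinApproximation N g x| ≤ δ := by
  rw [bernsteinApproximation.apply, bernsteinApproximation.apply, ← Finset.sum_sub_distrib]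
  refine (Finset.abs_sum_le_sum_abs _ _).trans ?_
  rw [← one_mul δ, ← bernstein.probability N x, Finset.sum_mul]
  refine Finset.sum_le_sum fun k _ => ?_
  rw [← smul_sub, smul_eq_mul, abs_mul, abs_of_nonneg bernstein_nonneg]
  exact mul_le_mul_of_nonneg_left (h _) bernstein_nonneg

/-- The tensor product Bernstein approximation of a function on the square. -/
noncomputable def squareBernstein (N : ℕ) (f : C(I, C(I, ℝ))) (p : I × I) : ℝ :=
  bernsteinApproximation N (bernsteinApproximation N f p.1) p.2

theorem squareBernstein_eq_sum (N : ℕ) (f : C(I, C(I, ℝ))) (p : I × I) :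
    squareBernstein N f p = ∑ j : Fin (N + 1), ∑ i : Fin (N + 1),
      bernstein N j p.2 * bernstein N i p.1 * f (bernstein.z i) (bernstein.z j) := by
  rw [squareBernstein, bernsteinApproximation.apply]
  refine Finset.sum_congr rfl fun j _ => ?_
  rw [bernsteinApproximation_apply_apply, smul_eq_mul, Finset.mul_sum]
  simp only [mul_assoc]

theorem exists_abs_squareBernstein_sub_le (N : ℕ) (f : C(I, C(I, ℝ))) :
    ∃ K : ℝ, 0 ≤ K ∧ ∀ p q : I × I, |squareBernstein N f p - squareBernstein N f q| ≤
      K * (|(p.1 : ℝ) - q.1| + |(p.2 : ℝ) - q.2|) := by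
  obtain ⟨K, hK0, hK⟩ := exists_abs_bernstein_sub_le N
  refine ⟨∑ j : Fin (N + 1), ∑ i : Fin (N + 1), K * |f (bernstein.z i) (bernstein.z j)|,
    by positivity, fun p q => ?_⟩
  rw [squareBernstein_eq_sum, squareBernstein_eq_sum, ← Finset.sum_sub_distrib, Finset.sum_mul]
  refine (Finset.abs_sum_le_sum_abs _ _).trans (Finset.sum_le_sum fun j _ => ?_)
  rw [← Finset.sum_sub_distrib, Finset.sum_mul]
  refine (Finset.abs_sum_le_sum_abs _ _).trans (Finset.sum_le_sum fun i _ => ?_)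
  rw [← sub_mul, abs_mul, mul_right_comm]
  refine mul_le_mul_of_nonneg_right ?_ (abs_nonneg _)
  have h1 : bernstein N j p.2 * bernstein N i p.1 - bernstein N j q.2 * bernstein N i q.1 =
      bernstein N j p.2 * (bernstein N i p.1 - bernstein N i q.1) +
        (bernstein N j p.2 - bernstein N j q.2) * bernstein N i q.1 := by ring
  rw [h1, mul_add]
  refine (abs_add_le _ _).trans (add_le_add ?_ ?_)
  · rw [abs_mul, abs_of_nonneg bernstein_nonneg]
    exact (mul_le_of_le_one_left (abs_nonneg _) (bernstein_le_one j _)).trans (hK i _ _)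
  · rw [abs_mul, abs_of_nonneg (bernstein_nonneg (x := q.1))]
    exact (mul_le_of_le_one_right (abs_nonneg _) (bernstein_le_one i _)).trans (hK j _ _)

open Filter Topology in
theorem eventually_abs_squareBernstein_sub_lt (f : C(I, C(I, ℝ))) {δ : ℝ} (hδ : 0 < δ) :
    ∀ᶠ N in atTop, ∀ p : I × I, |squareBernstein N f p - f p.1 p.2| < δ := by
  -- `g` is `f` with the two variables exchanged
  let g : C(I, C(I, ℝ)) := ContinuousMap.curry ⟨fun p : I × I => f p.2 p.1,
    (ContinuousMap.continuous_uncurry_of_continuous f).comp continuous_swap⟩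
  have h1 : ∀ᶠ N in atTop, dist (bernsteinApproximation N f) f < δ / 2 :=
    (tendsto_iff_dist_tendsto_zero.1 (bernsteinApproximation_uniform f)).eventually_lt_const
      (half_pos hδ)
  have h2 : ∀ᶠ N in atTop, dist (bernsteinApproximation N g) g < δ / 2 :=
    (tendsto_iff_dist_tendsto_zero.1 (bernsteinApproximation_uniform g)).eventually_lt_const
      (half_pos hδ)
  filter_upwards [h1, h2] with N h1 h2 p
  have h3 : ∀ x y, |bernsteinApproximation N f x y - f x y| ≤ δ / 2 := fun x y => by
    have h := (ContinuousMap.dist_apply_le_dist (f := bernsteinApproximation N f x) (g := f x)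
      y).trans ((ContinuousMap.dist_apply_le_dist x).trans h1.le)
    rwa [Real.dist_eq] at h
  have h4 : |bernsteinApproximation N (f p.1) p.2 - f p.1 p.2| < δ / 2 := by
    have h := lt_of_le_of_lt ((ContinuousMap.dist_apply_le_dist
      (f := bernsteinApproximation N g p.2) (g := g p.2) p.1).trans (ContinuousMap.dist_apply_le_dist p.2)) h2
    rw [Real.dist_eq, bernsteinApproximation_apply_apply] at h
    rw [bernsteinApproximation.apply]
    exact h
  have h5 := abs_bernsteinApproximation_sub_le N (h3 p.1) p.2
  have h6 := abs_sub_le (squareBernstein N f p) (bernsteinApproximation N (f p.1) p.2) (f p.1 p.2)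
  change |squareBernstein N f p - bernsteinApproximation N (f p.1) p.2| ≤ δ / 2 at h5
  linarith

end Bernstein

/-- On a side of the square, the tensor product Bernstein approximation is the Bernstein
approximation of the restriction to the side. -/
theorem squareBernstein_squareSide {N : ℕ} (hN : N ≠ 0) (f : C(I, C(I, ℝ))) (g : C(I, ℝ))
    (k : Fin 4) (hg : ∀ x, g x = f (squareSide k x).1 (squareSide k x).2) (x : I) :
    squareBernstein N f (squareSide k x) = bernsteinApproximation N g x := by
  fin_cases k
  · change bernsteinApproximation N (bernsteinApproximation N f x) 0 = _
    rw [bernsteinApproximation.apply_zero, bernsteinApproximation_apply_apply,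
      bernsteinApproximation.apply]
    exact Finset.sum_congr rfl fun k _ => congrArg _ (hg _).symm
  · change bernsteinApproximation N (bernsteinApproximation N f 1) x = _
    rw [bernsteinApproximation.apply_one hN]
    exact congrArg (fun g => bernsteinApproximation N g x)
      (ContinuousMap.ext fun y => (hg y).symm)
  · change bernsteinApproximation N (bernsteinApproximation N f (σ x)) 1 = _
    rw [bernsteinApproximation.apply_one hN, bernsteinApproximation_apply_apply,
      ← bernsteinApproximation_symm hN g (g.comp ⟨σ, unitInterval.continuous_symm⟩)
        (fun y => congrArg g (unitInterval.symm_symm y)), bernsteinApproximation.apply]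
    refine Finset.sum_congr rfl fun k _ => congrArg _ ?_
    refine Eq.trans ?_ (hg _).symm
    change _ = f (σ (σ _)) 1
    rw [unitInterval.symm_symm]
  · change bernsteinApproximation N (bernsteinApproximation N f 0) (σ x) = _
    rw [bernsteinApproximation.apply_zero]
    refine bernsteinApproximation_symm hN _ _ (fun y => ?_) x
    exact (hg y).symm

namespace PillowcaseCover

variable {T : Type*} {Ψ : PillowcaseCover T}

/-- A function on the surface in the coordinates of a tile. -/
def tileFun (ψ : C(Ψ.Space, ℝ)) (t : T) : C(I, C(I, ℝ)) :=
  ContinuousMap.curry (ψ.comp ⟨Ψ.point t, Ψ.continuous_point t⟩)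

/-- A continuous function on the surface is uniformly approximated by functions which are Lipschitz
on each tile: the Bernstein approximations on the tiles agree on glued sides. -/
theorem exists_lipschitz_approx [Finite T] (ψ : C(Ψ.Space, ℝ)) {δ : ℝ} (hδ : 0 < δ) :
    ∃ (h : Ψ.Space → ℝ) (K : ℝ), 0 < K ∧ (∀ x, |h x - ψ x| < δ) ∧
      ∀ t p q, |h (Ψ.point t p) - h (Ψ.point t q)| ≤
        K * (|(p.1 : ℝ) - q.1| + |(p.2 : ℝ) - q.2|) := by
  cases nonempty_fintype T
  obtain ⟨N, hN, hN0⟩ := ((Filter.eventually_all.2 fun t =>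
    eventually_abs_squareBernstein_sub_lt (tileFun ψ t) hδ).and
      (Filter.eventually_ne_atTop 0)).exists
  have hglue : ∀ a b : Σ _ : T, I × I, Ψ.GlueRel a b →
      squareBernstein N (tileFun ψ a.1) a.2 = squareBernstein N (tileFun ψ b.1) b.2 := by
    rintro _ _ ⟨d, hd, x⟩
    let g : T × Fin 4 → C(I, ℝ) := fun d => ψ.comp ⟨fun x => Ψ.point d.1 (squareSide d.2 x),
      (Ψ.continuous_point d.1).comp (continuous_squareSide d.2)⟩
    rw [squareBernstein_squareSide hN0 (tileFun ψ d.1) (g d) d.2 (fun _ => rfl),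
      squareBernstein_squareSide hN0 (tileFun ψ (Ψ.glue d).1) (g (Ψ.glue d)) (Ψ.glue d).2
        (fun _ => rfl)]
    exact (bernsteinApproximation_symm hN0 _ _
      (fun y => congrArg ψ (Ψ.point_squareSide_glue hd y)) x).symm
  choose K hK0 hK using fun t => exists_abs_squareBernstein_sub_le N (tileFun ψ t)
  refine ⟨Quot.lift (fun a => squareBernstein N (tileFun ψ a.1) a.2) hglue, 1 + ∑ t, K t,
    add_pos_of_pos_of_nonneg one_pos (Finset.sum_nonneg fun t _ => hK0 t), ?_, fun t p q => ?_⟩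
  · rintro ⟨t, p⟩
    exact hN t p
  · refine (hK t p q).trans (mul_le_mul_of_nonneg_right ?_ (by positivity))
    have := Finset.single_le_sum (fun t _ => hK0 t) (Finset.mem_univ t)
    linarith

theorem abs_centre_sub_sideMid_le {h : Ψ.Space → ℝ} {K : ℝ} (hK : 0 < K)
    (hL : ∀ t p q, |h (Ψ.point t p) - h (Ψ.point t q)| ≤
        K * (|(p.1 : ℝ) - q.1| + |(p.2 : ℝ) - q.2|)) {n : ℕ} (v : T × Fin n × Fin n) (k : Fin 4) :
    |h (Ψ.centre v) - h (Ψ.sideMid v k)| ≤ 2 * K / n := by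
  refine (hL v.1 _ _).trans ?_
  refine (mul_le_mul_of_nonneg_left (add_le_add (abs_shrink_sub_le v.2.1 _ _)
    (abs_shrink_sub_le v.2.2 _ _)) hK.le).trans (le_of_eq ?_)
  ring

end PillowcaseCover

/-! ### Locality of the discrete Laplacian -/

namespace FlatUnitaryBundle

variable {T : Type*} {Ψ : PillowcaseCover T} (F : FlatUnitaryBundle Ψ.Space)
  {U : Set Ψ.Space} {n : ℕ}

@[simp]
theorem restrict_apply (f : F.Sections Set.univ n) (v : Ψ.Vertex U n) :
    F.restrict U n f v = f ⟨v.1, Set.mem_univ _⟩ :=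
  rfl

theorem extend_apply_of_mem (f : F.Sections U n) (v : Ψ.Vertex Set.univ n)
    (h : Ψ.centre v.1 ∈ U) : F.extend U n f v = f ⟨v.1, h⟩ :=
  dif_pos h

theorem extend_apply_of_notMem (f : F.Sections U n) (v : Ψ.Vertex Set.univ n)
    (h : Ψ.centre v.1 ∉ U) : F.extend U n f v = 0 :=
  dif_neg h

theorem restrict_comp_extend : F.restrict U n ∘ₗ F.extend U n = LinearMap.id := by
  ext f v
  exact F.extend_apply_of_mem f _ v.2

theorem inner_extend_left [Finite T] (f : F.Sections U n) (g : F.Sections Set.univ n) :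
    inner ℂ (F.extend U n f) g = inner ℂ f (F.restrict U n g) := by
  classical
  cases nonempty_fintype T
  rw [PiLp.inner_apply, PiLp.inner_apply, PillowcaseCover.sum_vertex, PillowcaseCover.sum_vertex]
  refine Finset.sum_congr rfl fun t _ => Finset.sum_congr rfl fun a ha =>
    Finset.sum_congr rfl fun b hb => ?_
  have ha' := Finset.mem_range.1 ha
  have hb' := Finset.mem_range.1 hb
  rw [dif_pos ⟨ha', hb', Set.mem_univ _⟩]
  split_ifs with h
  · rw [F.extend_apply_of_mem f _ h.2.2]
    rfl
  · rw [F.extend_apply_of_notMem f _ fun h' => h ⟨ha', hb', h'⟩, inner_zero_left]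

theorem extend_restrict (f : F.Sections Set.univ n)
    (hf : ∀ v, Ψ.centre v.1 ∉ U → f v = 0) : F.extend U n (F.restrict U n f) = f := by
  ext v
  by_cases h : Ψ.centre v.1 ∈ U
  · rw [F.extend_apply_of_mem _ v h, F.restrict_apply]
  · rw [F.extend_apply_of_notMem _ v h, hf v h]

/-- An edge of `U_n` as an edge of `Ψ_n`. -/
def _root_.PillowcaseCover.EdgeFrom.toUniv {v : Ψ.Vertex U n} (e : Ψ.EdgeFrom U n v) :
    Ψ.EdgeFrom Set.univ n ⟨v.1, Set.mem_univ _⟩ :=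
  ⟨(e.side, (⟨e.head.1, Set.mem_univ _⟩, e.headSide)), fun h => e.2.1
    (Prod.ext (Subtype.ext (congrArg (fun x => x.1.1) h)) (congrArg (fun x => x.2) h)),
    e.point_eq, Set.mem_univ _⟩

theorem _root_.PillowcaseCover.EdgeFrom.toUniv_injective (v : Ψ.Vertex U n) :
    Function.Injective
      (PillowcaseCover.EdgeFrom.toUniv : Ψ.EdgeFrom U n v → Ψ.EdgeFrom Set.univ n _) := by
  intro e e' h
  have h' := congrArg Subtype.val h
  exact Subtype.ext (Prod.ext (congrArg (fun x => x.1) h')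
    (Prod.ext (Subtype.ext (congrArg (fun x => x.2.1.1) h')) (congrArg (fun x => x.2.2) h')))

/-- A function which is nearly constant along half-edges, and which is small outside `U`. Its
superlevel sets measure the graph distance to the complement of `U`. -/
structure IsCutoff (U : Set Ψ.Space) (n : ℕ) (h : Ψ.Space → ℝ) (a₀ η : ℝ) : Prop where
  mem : ∀ x, a₀ < h x → x ∈ U
  abs_sub_le : ∀ (v : T × Fin n × Fin n) k, |h (Ψ.centre v) - h (Ψ.sideMid v k)| ≤ η

variable {F}

/-- A section whose support lies in the superlevel set `{a < h}`. -/
def SupportedAbove (h : Ψ.Space → ℝ) (a : ℝ) (f : F.Sections Set.univ n) : Prop :=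
  ∀ v, f v ≠ 0 → a < h (Ψ.centre v.1)

variable {h : Ψ.Space → ℝ} {a₀ η a : ℝ} {f : F.Sections Set.univ n}

theorem SupportedAbove.extend_restrict (hh : IsCutoff U n h a₀ η) (hf : SupportedAbove h a f)
    (ha : a₀ ≤ a) : F.extend U n (F.restrict U n f) = f :=
  F.extend_restrict f fun v hv => by
    by_contra hne
    exact hv (hh.mem _ (ha.trans_lt (hf v hne)))

/-- Along an edge at which a section does not vanish identically, the cutoff stays large. -/
theorem SupportedAbove.lt_of_edgeDiff_ne_zero (hh : IsCutoff U n h a₀ η)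
    (hf : SupportedAbove h a f) {v : Ψ.Vertex Set.univ n} (e : Ψ.EdgeFrom Set.univ n v)
    (he : F.edgeDiff e f ≠ 0) :
    a - 2 * η < h (Ψ.centre v.1) ∧ a - 2 * η < h (Ψ.centre e.head.1) ∧
      a - 2 * η < h (Ψ.sideMid v.1 e.side) := by
  have h1 := abs_sub_le_iff.1 (hh.abs_sub_le v.1 e.side)
  have h2 := abs_sub_le_iff.1 (hh.abs_sub_le e.head.1 e.headSide)
  have h3 : Ψ.sideMid v.1 e.side = Ψ.sideMid e.head.1 e.headSide := e.point_eq
  rw [← h3] at h2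
  have h0 : 0 ≤ η := (abs_nonneg _).trans (hh.abs_sub_le v.1 e.side)
  have h4 : a < h (Ψ.centre v.1) ∨ a < h (Ψ.centre e.head.1) := by
    by_contra! hcon
    have h5 : f v = 0 := by
      by_contra hne
      exact (hf v hne).not_ge hcon.1
    have h6 : f e.head = 0 := by
      by_contra hne
      exact (hf e.head hne).not_ge hcon.2
    apply he
    rw [edgeDiff, h5, h6, map_zero, sub_zero]
  rcases h4 with h4 | h4
  · exact ⟨by linarith, by linarith, by linarith⟩
  · exact ⟨by linarith, by linarith, by linarith⟩

theorem SupportedAbove.laplacian [Finite T] (hh : IsCutoff U n h a₀ η) (hf : SupportedAbove h a f) :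
    SupportedAbove h (a - 2 * η) (F.laplacian Set.univ n f) := by
  intro v hv
  obtain ⟨e, -, he⟩ := Finset.exists_ne_zero_of_sum_ne_zero hv
  exact (hf.lt_of_edgeDiff_ne_zero hh e he).1

/-- The Laplacians of `Ψ_n` and of `U_n` agree on sections supported away from the boundary
of `U`. -/
theorem SupportedAbove.laplacian_eq [Finite T] (hh : IsCutoff U n h a₀ η)
    (hf : SupportedAbove h a f) (ha : a₀ ≤ a - 2 * η) :
    F.laplacian Set.univ n f = F.extend U n (F.laplacian U n (F.restrict U n f)) := by
  classical
  ext v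
  have hmem : ∀ (e : Ψ.EdgeFrom Set.univ n v), F.edgeDiff e f ≠ 0 →
      Ψ.centre v.1 ∈ U ∧ Ψ.centre e.head.1 ∈ U ∧ Ψ.sideMid v.1 e.side ∈ U := by
    intro e he
    obtain ⟨h1, h2, h3⟩ := hf.lt_of_edgeDiff_ne_zero hh e he
    exact ⟨hh.mem _ (ha.trans_lt h1), hh.mem _ (ha.trans_lt h2), hh.mem _ (ha.trans_lt h3)⟩
  by_cases hv : Ψ.centre v.1 ∈ U
  · rw [F.extend_apply_of_mem _ v hv]
    change ∑ e : Ψ.EdgeFrom Set.univ n v, F.edgeDiff e f =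
      ∑ e : Ψ.EdgeFrom U n ⟨v.1, hv⟩, F.edgeDiff e (F.restrict U n f)
    symm
    refine Finset.sum_of_injOn PillowcaseCover.EdgeFrom.toUniv
      (PillowcaseCover.EdgeFrom.toUniv_injective _).injOn (fun _ _ => Finset.mem_coe.2
        (Finset.mem_univ _)) ?_ ?_
    · intro e _ he
      by_contra hne
      obtain ⟨-, h2, h3⟩ := hmem e hne
      exact he ⟨⟨(e.side, (⟨e.head.1, h2⟩, e.headSide)), fun h => e.2.1
        (Prod.ext (Subtype.ext (congrArg (fun x => x.1.1) h)) (congrArg (fun x => x.2) h)),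
        e.point_eq, h3⟩, Finset.mem_coe.2 (Finset.mem_univ _), rfl⟩
    · intro e _
      rfl
  · rw [F.extend_apply_of_notMem _ v hv]
    refine Finset.sum_eq_zero fun e _ => ?_
    by_contra hne
    exact hv (hmem e hne).1

theorem SupportedAbove.pow_apply [Finite T] (hh : IsCutoff U n h a₀ η)
    (hf : SupportedAbove h a f) (c : ℂ) (j : ℕ) (ha : a₀ ≤ a - 2 * η * j) :
    SupportedAbove h (a - 2 * η * j) (((c • F.laplacian Set.univ n) ^ j) f) ∧
      ((c • F.laplacian Set.univ n) ^ j) f =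
        F.extend U n (((c • F.laplacian U n) ^ j) (F.restrict U n f)) := by
  induction j with
  | zero =>
    simp only [pow_zero, Module.End.one_apply, Nat.cast_zero, mul_zero, sub_zero] at ha ⊢
    exact ⟨hf, (hf.extend_restrict hh ha).symm⟩
  | succ j ih =>
    push_cast at ha ⊢
    by_cases hv : Nonempty (T × Fin n × Fin n)
    · have h0 : 0 ≤ η := (abs_nonneg _).trans (hh.abs_sub_le hv.some 0)
      obtain ⟨h1, h2⟩ := ih (by linarith)
      set g := ((c • F.laplacian Set.univ n) ^ j) f with hg
      have h3 := h1.laplacian hh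
      have h4 := h1.laplacian_eq hh (by linarith)
      have h5 : F.restrict U n g = ((c • F.laplacian U n) ^ j) (F.restrict U n f) := by
        rw [h2]
        exact LinearMap.congr_fun F.restrict_comp_extend _
      rw [pow_succ', pow_succ', Module.End.mul_apply, Module.End.mul_apply, ← hg, ← h5,
        LinearMap.smul_apply, LinearMap.smul_apply, map_smul, ← h4]
      refine ⟨fun v hv => ?_, rfl⟩
      have h6 := h3 v fun h0 => hv (by rw [PiLp.smul_apply, h0, smul_zero])
      linarith
    · have : IsEmpty (Ψ.Vertex Set.univ n) := ⟨fun v => hv ⟨v.1⟩⟩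
      exact ⟨fun v => isEmptyElim v, PiLp.ext fun v => isEmptyElim v⟩

theorem SupportedAbove.aeval_apply [Finite T] (hh : IsCutoff U n h a₀ η) (hη : 0 ≤ η)
    (hf : SupportedAbove h a f) (c : ℂ) {m : ℕ} (hm : 1 ≤ m)
    (ha : a₀ ≤ a - 2 * η * ((m : ℝ) - 1)) {p : Polynomial ℂ} (hp : p.degree < m) :
    Polynomial.aeval (c • F.laplacian Set.univ n) p f =
      F.extend U n (Polynomial.aeval (c • F.laplacian U n) p (F.restrict U n f)) := by
  have hp' : p.natDegree < m := by
    rcases eq_or_ne p 0 with rfl | hp0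
    · rw [Polynomial.natDegree_zero]
      omega
    · exact (Polynomial.natDegree_lt_iff_degree_lt hp0).2 hp
  rw [Polynomial.aeval_eq_sum_range' hp', Polynomial.aeval_eq_sum_range' hp', LinearMap.sum_apply,
    LinearMap.sum_apply, map_sum]
  refine Finset.sum_congr rfl fun j hj => ?_
  have hj' : (j : ℝ) + 1 ≤ m := by exact_mod_cast Finset.mem_range.1 hj
  rw [LinearMap.smul_apply, LinearMap.smul_apply, map_smul,
    (hf.pow_apply hh c j (by nlinarith)).2]

theorem mulFun_apply (φ : C(Ψ.Space, ℝ)) (f : F.Sections Set.univ n) (v) :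
    F.mulFun n φ f v = (φ (Ψ.centre v.1) : ℂ) • f v :=
  rfl

theorem isSymmetric_mulFun [Finite T] (φ : C(Ψ.Space, ℝ)) : (F.mulFun n φ).IsSymmetric := by
  intro f g
  rw [PiLp.inner_apply, PiLp.inner_apply]
  refine Finset.sum_congr rfl fun v _ => ?_
  rw [mulFun_apply, mulFun_apply, inner_smul_left, inner_smul_right, Complex.conj_ofReal]

theorem norm_mulFun_apply_le [Finite T] (φ : C(Ψ.Space, ℝ)) (h0 : ∀ x, 0 ≤ φ x)
    (h1 : ∀ x, φ x ≤ 1) (f : F.Sections Set.univ n) : ‖F.mulFun n φ f‖ ≤ ‖f‖ := by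
  rw [← abs_of_nonneg (norm_nonneg (F.mulFun n φ f)), ← abs_of_nonneg (norm_nonneg f),
    ← sq_le_sq, PiLp.norm_sq_eq_of_L2, PiLp.norm_sq_eq_of_L2]
  refine Finset.sum_le_sum fun v _ => pow_le_pow_left₀ (norm_nonneg _) ?_ 2
  rw [mulFun_apply, norm_smul, Complex.norm_real, Real.norm_of_nonneg (h0 _)]
  exact mul_le_of_le_one_left (norm_nonneg _) (h1 _)

end FlatUnitaryBundle

/-! ### The renormalized zeta function -/

theorem SpectralBounds.mono {E : Type*} [NormedAddCommGroup E] [InnerProductSpace ℂ E]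
    [FiniteDimensional ℂ E] {A : E →ₗ[ℂ] E} {c c' Λ C₀ C₀' : ℝ} (h : SpectralBounds A c Λ C₀)
    (hc : c' ≤ c) (hC : C₀ ≤ C₀') : SpectralBounds A c' Λ C₀' :=
  ⟨h.isSymmetric, fun i => (h.gap i).imp_right hc.trans, h.le, h.sum_le.trans hC⟩

namespace FlatUnitaryBundle

variable {T : Type*} {Ψ : PillowcaseCover T} (F : FlatUnitaryBundle Ψ.Space)

/-- The contribution of one tiled open set to the renormalized zeta function is bounded. -/
theorem exists_bound_trace_mulFun [Finite T] {U : Set Ψ.Space} (hU : Ψ.IsTiledOpen U)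
    (φ ψ : C(Ψ.Space, ℝ)) (h0 : ∀ x, 0 ≤ φ x) (h1 : ∀ x, φ x ≤ 1)
    (hφψ : ∀ x, φ x ≠ 0 → ψ x = 1) (hψ : ∀ x, ψ x ≠ 0 → x ∈ U) {r : ℝ} (hr : 0 ≤ r) :
    ∃ C : ℝ, ∀ s : ℂ, ‖s‖ ≤ r → ∀ n : ℕ, 1 ≤ n →
      ‖LinearMap.trace ℂ (F.Sections Set.univ n) (F.mulFun n φ ∘ₗ
        (F.laplacianPower Set.univ n s -
          F.extend U n ∘ₗ F.laplacianPower U n s ∘ₗ F.restrict U n))‖ ≤ C := by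
  obtain ⟨c, C₀, hc, hC₀, hA⟩ := F.exists_spectralBounds Ψ.isTiledOpen_univ
  obtain ⟨c', C₀', hc', hC₀', hB⟩ := F.exists_spectralBounds hU
  -- `ψ = 1` near the support of `φ` and `ψ = 0` outside `U`, so `h > 3 / 4` on the former and
  -- `h < 1 / 4` on the latter; `h` changes by at most `4 K / n` along an edge
  obtain ⟨h, K, hK, hψh, hL⟩ := PillowcaseCover.exists_lipschitz_approx ψ
    (δ := 1 / 4) (by norm_num)
  have hε : 0 < 1 / (8 * K) := by positivity
  obtain ⟨C, hC⟩ := exists_bound_trace_perpPower (r := r) (c := min c c') (Λ := 64)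
    (C₀ := max C₀ C₀') hr (lt_min hc hc') (by norm_num) (hC₀.trans (le_max_left _ _)) hε
  refine ⟨C, fun s hs n hn => ?_⟩
  have hn0 : (0 : ℝ) < n := by exact_mod_cast hn
  have hcut : IsCutoff U n h (1 / 4) (2 * K / n) := by
    refine ⟨fun x hx => hψ x fun h0 => ?_, PillowcaseCover.abs_centre_sub_sideMid_le hK hL⟩
    have := abs_lt.1 (hψh x)
    rw [h0] at this
    linarith
  have hm0 : 0 < 1 / (8 * K) * n := by positivity
  have hm1 : 1 ≤ ⌈1 / (8 * K) * (n : ℝ)⌉₊ := Nat.one_le_iff_ne_zero.2 (Nat.ceil_pos.2 hm0).ne'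
  have hm2 : ((⌈1 / (8 * K) * (n : ℝ)⌉₊ : ℕ) : ℝ) - 1 ≤ 1 / (8 * K) * n := by
    linarith [Nat.ceil_lt_add_one hm0.le]
  refine hC _ _ n hn ((hA n hn).mono (min_le_left _ _) (le_max_left _ _))
    ((hB n hn).mono (min_le_right _ _) (le_max_right _ _)) _ _ F.inner_extend_left
    F.restrict_comp_extend _ (isSymmetric_mulFun φ) (norm_mulFun_apply_le φ h0 h1) _ hm1
    (Nat.le_ceil _) (fun p hp => LinearMap.ext fun f => ?_) s hs
  have hsupp : SupportedAbove h (3 / 4) (F.mulFun n φ f) := by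
    intro v hv
    have h2 : φ (Ψ.centre v.1) ≠ 0 := fun h2 => hv (by
      rw [mulFun_apply, h2, Complex.ofReal_zero, zero_smul])
    have := abs_lt.1 (hψh (Ψ.centre v.1))
    rw [hφψ _ h2] at this
    linarith
  refine hsupp.aeval_apply hcut (by positivity) _ hm1 ?_ hp
  have h2 : 2 * (2 * K / n) * (((⌈1 / (8 * K) * (n : ℝ)⌉₊ : ℕ) : ℝ) - 1) ≤
      2 * (2 * K / n) * (1 / (8 * K) * n) := mul_le_mul_of_nonneg_left hm2 (by positivity)
  have h3 : 2 * (2 * K / n) * (1 / (8 * K) * n) = 1 / 2 := by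
    field_simp
    norm_num
  linarith

end FlatUnitaryBundle

theorem mainTheorem8 {T : Type*} [Finite T] (Ψ : PillowcaseCover T)
    (F : FlatUnitaryBundle Ψ.Space) {ι : Type*} [Fintype ι] (U : ι → Set Ψ.Space)
    (hU : ∀ α, Ψ.IsTiledOpen (U α))
    (φ : PartitionOfUnity ι Ψ.Space) (hφ : φ.IsSubordinate U)
    (ψ : ι → C(Ψ.Space, ℝ))
    (hψ_one : ∀ α, ∃ V : Set Ψ.Space, IsOpen V ∧ tsupport (φ α) ⊆ V ∧ ∀ x ∈ V, ψ α x = 1)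
    (hψ_supp : ∀ α, tsupport (ψ α) ⊆ U α)
    (K : Set ℂ) (hK : IsCompact K) :
    ∃ C : ℝ, 0 < C ∧ ∀ s ∈ K, ∀ n : ℕ, 1 ≤ n →
      ‖F.renormalizedZeta U φ ψ n s‖ ≤ C := by
  obtain ⟨r, hr0, hr⟩ := hK.isBounded.exists_pos_norm_le
  have hφψ : ∀ α x, φ α x ≠ 0 → ψ α x = 1 := fun α x hx => by
    obtain ⟨V, -, hV, hV1⟩ := hψ_one α
    exact hV1 x (hV (subset_tsupport _ hx))
  choose C hC using fun α => F.exists_bound_trace_mulFun (hU α) (φ α) (ψ α) (φ.nonneg α)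
    (φ.le_one α) (hφψ α) (fun x hx => hψ_supp α (subset_tsupport _ hx)) hr0.le
  -- `ψ` drops out of the trace since `ψ φ = φ`
  have hmul : ∀ α n, F.mulFun n (ψ α) ∘ₗ F.mulFun n (φ α) = F.mulFun n (φ α) := by
    intro α n
    ext f v
    change (ψ α (Ψ.centre v.1) : ℂ) • ((φ α (Ψ.centre v.1) : ℂ) • f v) =
      (φ α (Ψ.centre v.1) : ℂ) • f v
    by_cases h : φ α (Ψ.centre v.1) = 0
    · rw [h, Complex.ofReal_zero, zero_smul, smul_zero]
    · rw [hφψ α _ h, Complex.ofReal_one, one_smul]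
  have hsum : ∀ n, ∑ α, F.mulFun n (φ α) = LinearMap.id := by
    intro n
    ext f v
    have h := φ.sum_eq_one (Set.mem_univ (Ψ.centre v.1))
    rw [finsum_eq_sum_of_fintype] at h
    rw [LinearMap.sum_apply, WithLp.ofLp_sum, Finset.sum_apply]
    simp only [FlatUnitaryBundle.mulFun_apply]
    rw [← Finset.sum_smul, ← Complex.ofReal_sum, h, Complex.ofReal_one, one_smul]
    rfl
  have hzeta : ∀ n s, F.renormalizedZeta U φ ψ n s =
      ∑ α, LinearMap.trace ℂ (F.Sections Set.univ n) (F.mulFun n (φ α) ∘ₗ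
        (F.laplacianPower Set.univ n s -
          F.extend (U α) n ∘ₗ F.laplacianPower (U α) n s ∘ₗ F.restrict (U α) n)) := by
    intro n s
    have h1 : ∀ α, LinearMap.trace ℂ (F.Sections Set.univ n) (F.mulFun n (φ α) ∘ₗ
        F.extend (U α) n ∘ₗ F.laplacianPower (U α) n s ∘ₗ F.restrict (U α) n ∘ₗ
          F.mulFun n (ψ α)) = LinearMap.trace ℂ (F.Sections Set.univ n) (F.mulFun n (φ α) ∘ₗ
        F.extend (U α) n ∘ₗ F.laplacianPower (U α) n s ∘ₗ F.restrict (U α) n) := by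
      intro α
      have h2 := LinearMap.trace_mul_comm ℂ (F.mulFun n (φ α) ∘ₗ F.extend (U α) n ∘ₗ
        F.laplacianPower (U α) n s ∘ₗ F.restrict (U α) n) (F.mulFun n (ψ α))
      refine h2.trans (congrArg _ ?_)
      rw [Module.End.mul_eq_comp, ← LinearMap.comp_assoc, hmul]
    rw [FlatUnitaryBundle.renormalizedZeta, map_sub, map_sum]
    simp only [h1, LinearMap.comp_sub, map_sub, Finset.sum_sub_distrib]
    congr 1
    have h3 := Finset.sum_mul Finset.univ (fun α => F.mulFun n (φ α))
      (F.laplacianPower Set.univ n s)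
    rw [hsum] at h3
    rw [← map_sum]
    exact congrArg _ h3
  refine ⟨1 + ∑ α, |C α|, by positivity, fun s hs n hn => ?_⟩
  rw [hzeta]
  refine (norm_sum_le _ _).trans ((Finset.sum_le_sum fun α _ =>
    (hC α s (hr s hs) n hn).trans (le_abs_self _)).trans ?_)
  linarith
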